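/- Let $\mathbb{C}[\![h]\!]$ be the ring of formal power series, $q = e^{h/2}$, $[n] = \frac{q^n-q^{-n}}{q-q^{-1}}$ and $[n]! = [1][2]\cdots[n]$. Let $U_h(\mathfrak{sl}_2)$ be the $\mathbb{C}[\![h]\!]$-algebra topologically generated (in the $h$-adic topology) by $H, x, y$ with the relations $$Hx - xH = 2x,\qquad Hy - yH = -2y,\qquad xy - yx = \frac{e^{\frac h2 H}-e^{-\frac h2 H}}{e^{\frac h2}-e^{-\frac h2}},$$ and put $k = e^{\frac h4 H}$. Tensor products are $h$-adically completed tensor products over $\mathbb{C}[\![h]\!]$. There is exactly one topological Hopf algebra structure on $U_h(\mathfrak{sl}_2)$, with coproduct $\Delta$, counit $\varepsilon$ and antipode $S$, such that $$\Delta(x) = x\otimes k + k^{-1}\otimes x,\quad \Delta(y) = y\otimes k + k^{-1}\otimes y,\quad \Delta(H) = H\otimes 1 + 1\otimes H,$$ $$\varepsilon(x)=\varepsilon(y)=\varepsilon(H)=0,\qquad S(x) = -qx,\quad S(y) = -q^{-1}y,\quad S(H) = -H.$$ With this structure, let $$R = e^{\frac h4 H\otimes H}\sum_{n\ge 0}\frac{(q-q^{-1})^n}{[n]!}\,q^{\frac12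 n(n-3)}\,(kx)^n\otimes(k^{-1}y)^n,$$ $$v = e^{-\frac h4 H^2}\sum_{n\ge 0}\frac{(q^{-1}-q)^n}{[n]!}\,q^{-\frac12 n(n+3)}\,k^{-2(n+1)}y^n x^n .$$ Then $(U_h(\mathfrak{sl}_2), R, v)$ is a ribbon Hopf algebra. That is, with $\tau(a\otimes b) = b\otimes a$: (1) $R$ is invertible, $\tau(\Delta(a)) = R\,\Delta(a)\,R^{-1}$ for all $a$, $(\Delta\otimes\mathrm{id})(R) = R_{13}R_{23}$ and $(\mathrm{id}\otimes\Delta)(R) = R_{13}R_{12}$; (2) writing $R = \sum_i\alpha_i\otimes\beta_i$ and $u = \sum_i S(\beta_i)\alpha_i$, the element $v$ is central, $v^2 = S(u)u$, $S(v) = v$, $\varepsilon(v) = 1$, and $\Delta(v) = (\tau(R)R)^{-1}(v\otimes v)$. Moreover $v = k^{-2}u$. -/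

import Mathlib

open scoped TensorProduct

noncomputable section

namespace QuantumSl2

/-! ### The ground ring `ℂ⟦h⟧` and `h`-adic completion -/

/-- The ring `ℂ⟦h⟧` of formal power series. -/
abbrev K : Type := PowerSeries ℂ

/-- The indeterminate `h`. -/
abbrev h : K := PowerSeries.X

/-- The ideal `(h)` of `ℂ⟦h⟧`. -/
abbrev hIdeal : Ideal K := Ideal.span {(PowerSeries.X : PowerSeries ℂ)}

/-- The submodule `hⁿ M` of a `ℂ⟦h⟧`-module `M`. -/
abbrev hPow (M : Type*) [AddCommGroup M] [Module K M] (n : ℕ) : Submodule K M :=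
  hIdeal ^ n • (⊤ : Submodule K M)

/-- The underlying module of the `h`-adic completion `lim A / hⁿ A` of a `ℂ⟦h⟧`-algebra `A`. -/
def Completion (A : Type*) [Ring A] [Algebra K A] : Type _ := AdicCompletion hIdeal A

namespace Completion

section Basic

variable {A : Type*} [Ring A] [Algebra K A]

instance : AddCommGroup (Completion A) := inferInstanceAs (AddCommGroup (AdicCompletion hIdeal A))

instance : Module K (Completion A) := inferInstanceAs (Module K (AdicCompletion hIdeal A))

instance : IsAdicComplete hIdeal (Completion A) :=
  AdicCompletion.isAdicComplete (M := A) (I := hIdeal) ⟨{PowerSeries.X}, by simp⟩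

theorem map_hPow {M N : Type*} [AddCommGroup M] [Module K M] [AddCommGroup N] [Module K N]
    (f : M →ₗ[K] N) {n : ℕ} {a : M} (ha : a ∈ hPow M n) : f a ∈ hPow N n := by
  have h1 : (hPow M n).map f ≤ hPow N n := by
    rw [hPow, Submodule.map_smul'']
    exact Submodule.smul_mono le_rfl le_top
  exact h1 (Submodule.mem_map_of_mem ha)

theorem mul_mem_hPow_left {n : ℕ} {a : A} (ha : a ∈ hPow A n) (b : A) : a * b ∈ hPow A n :=
  map_hPow (LinearMap.mulRight K b) ha

theorem mul_mem_hPow_right {n : ℕ} {a : A} (ha : a ∈ hPow A n) (b : A) : b * a ∈ hPow A n :=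
  map_hPow (LinearMap.mulLeft K b) ha

/-- Multiplication on `A / hⁿ A`. -/
def qmul (n : ℕ) : A ⧸ hPow A n → A ⧸ hPow A n → A ⧸ hPow A n :=
  Quotient.map₂ (· * ·) fun a a' haa b b' hbb => by
    replace haa := (Submodule.quotientRel_def _).1 haa
    replace hbb := (Submodule.quotientRel_def _).1 hbb
    refine (Submodule.quotientRel_def _).2 ?_
    change a * b - a' * b' ∈ hPow A n
    have e : a * b - a' * b' = (a - a') * b + a' * (b - b') := by noncomm_ring
    rw [e]
    exact add_mem (mul_mem_hPow_left haa b) (mul_mem_hPow_right hbb a')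

theorem qmul_mk (n : ℕ) (a b : A) :
    qmul n (Submodule.Quotient.mk a) (Submodule.Quotient.mk b) =
      (Submodule.Quotient.mk (a * b) : A ⧸ hPow A n) := rfl

/-- The component in `A / hⁿ A`. -/
def comp (n : ℕ) : Completion A →ₗ[K] A ⧸ hPow A n := AdicCompletion.eval hIdeal A n

theorem comp_ext {a b : Completion A} (hab : ∀ n, comp n a = comp n b) : a = b :=
  AdicCompletion.ext hab

theorem comp_surj (n : ℕ) (a : Completion A) :
    ∃ r : A, comp n a = Submodule.Quotient.mk r :=
  let ⟨r, hr⟩ := Submodule.Quotient.mk_surjective _ (comp n a)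
  ⟨r, hr.symm⟩

instance : One (Completion A) := ⟨AdicCompletion.of hIdeal A 1⟩

instance : Mul (Completion A) :=
  ⟨fun a b => ⟨fun n => qmul n (comp n a) (comp n b), by
    intro m n hmn
    have key : ∀ c : Completion A,
        AdicCompletion.transitionMap hIdeal A hmn (comp n c) = comp m c :=
      fun c => AdicCompletion.transitionMap_comp_eval_apply hIdeal A hmn c
    change AdicCompletion.transitionMap hIdeal A hmn (qmul n (comp n a) (comp n b)) =
      qmul m (comp m a) (comp m b)
    rw [← key a, ← key b]
    obtain ⟨r, hr⟩ := comp_surj n a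
    obtain ⟨s, hs⟩ := comp_surj n b
    rw [hr, hs]
    rfl⟩⟩

theorem comp_mul (n : ℕ) (a b : Completion A) :
    comp n (a * b) = qmul n (comp n a) (comp n b) := rfl

theorem comp_one (n : ℕ) : comp n (1 : Completion A) = Submodule.Quotient.mk 1 := rfl

instance : Ring (Completion A) where
  __ := (inferInstance : AddCommGroup (Completion A))
  mul := (· * ·)
  one := 1
  left_distrib a b c := comp_ext fun n => by
    obtain ⟨r, hr⟩ := comp_surj n a
    obtain ⟨s, hs⟩ := comp_surj n b
    obtain ⟨t, ht⟩ := comp_surj n c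
    change comp n (a * (b + c)) = comp n (a * b + a * c)
    simp only [map_add, comp_mul, hr, hs, ht, qmul_mk, ← Submodule.Quotient.mk_add, mul_add]
  right_distrib a b c := comp_ext fun n => by
    obtain ⟨r, hr⟩ := comp_surj n a
    obtain ⟨s, hs⟩ := comp_surj n b
    obtain ⟨t, ht⟩ := comp_surj n c
    change comp n ((a + b) * c) = comp n (a * c + b * c)
    simp only [map_add, comp_mul, hr, hs, ht, qmul_mk, ← Submodule.Quotient.mk_add, add_mul]
  zero_mul a := comp_ext fun n => by
    obtain ⟨r, hr⟩ := comp_surj n a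
    change comp n ((0 : Completion A) * a) = comp n 0
    rw [comp_mul, map_zero, hr, ← Submodule.Quotient.mk_zero, qmul_mk, zero_mul]
  mul_zero a := comp_ext fun n => by
    obtain ⟨r, hr⟩ := comp_surj n a
    change comp n (a * (0 : Completion A)) = comp n 0
    rw [comp_mul, map_zero, hr, ← Submodule.Quotient.mk_zero, qmul_mk, mul_zero]
  mul_assoc a b c := comp_ext fun n => by
    obtain ⟨r, hr⟩ := comp_surj n a
    obtain ⟨s, hs⟩ := comp_surj n b
    obtain ⟨t, ht⟩ := comp_surj n c
    simp only [comp_mul, hr, hs, ht, qmul_mk, mul_assoc]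
  one_mul a := comp_ext fun n => by
    obtain ⟨r, hr⟩ := comp_surj n a
    rw [comp_mul, comp_one, hr, qmul_mk, one_mul]
  mul_one a := comp_ext fun n => by
    obtain ⟨r, hr⟩ := comp_surj n a
    rw [comp_mul, comp_one, hr, qmul_mk, mul_one]

instance : Algebra K (Completion A) :=
  Algebra.ofModule
    (fun c a b => comp_ext fun n => by
      obtain ⟨r, hr⟩ := comp_surj n a
      obtain ⟨s, hs⟩ := comp_surj n b
      simp only [map_smul, comp_mul, hr, hs, qmul_mk, ← Submodule.Quotient.mk_smul,
        smul_mul_assoc])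
    (fun c a b => comp_ext fun n => by
      obtain ⟨r, hr⟩ := comp_surj n a
      obtain ⟨s, hs⟩ := comp_surj n b
      simp only [map_smul, comp_mul, hr, hs, qmul_mk, ← Submodule.Quotient.mk_smul,
        mul_smul_comm])

/-- The canonical algebra homomorphism `A → lim A / hⁿ A`. -/
def of (A : Type*) [Ring A] [Algebra K A] : A →ₐ[K] Completion A :=
  AlgHom.ofLinearMap (AdicCompletion.of hIdeal A) rfl (fun _ _ => rfl)

/-- The continuous extension of a `ℂ⟦h⟧`-linear map `A → N` into an `h`-adically complete module. -/
def extend {N : Type*} [AddCommGroup N] [Module K N] [IsAdicComplete hIdeal N] (f : A →ₗ[K] N) :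
    Completion A →ₗ[K] N :=
  (AdicCompletion.ofLinearEquiv hIdeal N).symm.toLinearMap ∘ₗ
    (AdicCompletion.map hIdeal f).restrictScalars K

theorem extend_of {N : Type*} [AddCommGroup N] [Module K N] [IsAdicComplete hIdeal N]
    (f : A →ₗ[K] N) (a : A) : extend f (of A a) = f a := by
  change (AdicCompletion.ofLinearEquiv hIdeal N).symm
    (AdicCompletion.map hIdeal f (AdicCompletion.of hIdeal A a)) = f a
  rw [AdicCompletion.map_of, AdicCompletion.ofLinearEquiv_symm_of]

/-- The linear map of completions induced by a linear map of algebras. -/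
def mapLin {B : Type*} [Ring B] [Algebra K B] (f : A →ₗ[K] B) : Completion A →ₗ[K] Completion B :=
  (AdicCompletion.map hIdeal f).restrictScalars K

theorem mapLin_of {B : Type*} [Ring B] [Algebra K B] (f : A →ₗ[K] B) (a : A) :
    mapLin f (of A a) = of B (f a) :=
  AdicCompletion.map_of hIdeal f a

theorem comp_mapLin {B : Type*} [Ring B] [Algebra K B] (f : A →ₗ[K] B) {n : ℕ} {c : Completion A}
    {r : A} (hr : comp n c = Submodule.Quotient.mk r) :
    comp n (mapLin f c) = Submodule.Quotient.mk (f r) := by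
  change LinearMap.reduceModIdeal (hIdeal ^ n) f (comp n c) = _
  rw [hr]
  rfl

/-- The homomorphism of completions induced by a homomorphism of algebras. -/
def map {B : Type*} [Ring B] [Algebra K B] (f : A →ₐ[K] B) : Completion A →ₐ[K] Completion B :=
  AlgHom.ofLinearMap (mapLin f.toLinearMap)
    (by rw [← map_one (of A), mapLin_of, AlgHom.toLinearMap_apply, map_one, map_one])
    (fun a b => comp_ext fun n => by
      obtain ⟨r, hr⟩ := comp_surj n a
      obtain ⟨s, hs⟩ := comp_surj n b
      have hrs : comp n (a * b) = Submodule.Quotient.mk (r * s) := by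
        rw [comp_mul, hr, hs, qmul_mk]
      rw [comp_mul, comp_mapLin _ hr, comp_mapLin _ hs, comp_mapLin _ hrs, qmul_mk]
      simp only [AlgHom.toLinearMap_apply, map_mul])

theorem map_of {B : Type*} [Ring B] [Algebra K B] (f : A →ₐ[K] B) (a : A) :
    map f (of A a) = of B (f a) :=
  mapLin_of f.toLinearMap a

end Basic

end Completion

/-! ### Convergent sums -/

theorem pow_smul_mem {M : Type*} [AddCommGroup M] [Module K M] {c : K} {n : ℕ}
    (hc : c ∈ hIdeal ^ n) (m : M) : c • m ∈ hPow M n :=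
  Submodule.smul_mem_smul hc trivial

theorem h_mem : h ∈ hIdeal := Ideal.subset_span rfl

section Sums

variable {M : Type*} [AddCommGroup M] [Module K M] [IsAdicComplete hIdeal M]

/-- The sum `∑ aₙ` of a sequence with `aₙ ∈ hⁿ M` in an `h`-adically complete module `M`. -/
def adicSum (a : ℕ → M) (ha : ∀ n, a n ∈ hPow M n) : M :=
  (AdicCompletion.ofLinearEquiv hIdeal M).symm
    (AdicCompletion.mk hIdeal M
      (AdicCompletion.AdicCauchySequence.mk hIdeal M (fun n => ∑ i ∈ Finset.range n, a i)
        (fun n => by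
          rw [SModEq.sub_mem, Finset.sum_range_succ, sub_add_cancel_left]
          exact neg_mem (ha n))))

/-- `adicSum a` is the limit of the partial sums. -/
theorem adicSum_spec (a : ℕ → M) (ha : ∀ n, a n ∈ hPow M n) (n : ℕ) :
    adicSum a ha - ∑ i ∈ Finset.range n, a i ∈ hPow M n := by
  have e : AdicCompletion.of hIdeal M (adicSum a ha) = _ :=
    AdicCompletion.of_ofLinearEquiv_symm hIdeal _
  have e' := congrArg (AdicCompletion.eval hIdeal M n) e
  rw [AdicCompletion.eval_of] at e'
  exact (Submodule.Quotient.eq _).1 e'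

variable {A : Type*} [Ring A] [Algebra K A] [IsAdicComplete hIdeal A]

/-- The scalar `hⁿ / n!`. -/
def divPow (n : ℕ) : K := PowerSeries.C ((n.factorial : ℂ)⁻¹) * h ^ n

theorem divPow_mem (n : ℕ) : divPow n ∈ hIdeal ^ n :=
  Ideal.mul_mem_left _ _ (Ideal.pow_mem_pow h_mem n)

/-- The exponential `e^{h a} = ∑ hⁿ aⁿ / n!` in an `h`-adically complete algebra. -/
def hexp (a : A) : A := adicSum (fun n => divPow n • a ^ n) (fun n => pow_smul_mem (divPow_mem n) _)

end Sums

/-! ### Quantum numbers -/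

/-- The constant `c ∈ ℂ` as a power series. -/
abbrev cst (c : ℂ) : K := PowerSeries.C c

/-- `q ^ r = e^{r h / 2}`, for a complex number `r`. -/
def qpow (r : ℂ) : K := PowerSeries.mk fun n => (r / 2) ^ n * ((n.factorial : ℂ)⁻¹)

/-- `q = e^{h/2}`. -/
def q : K := qpow 1

/-- `q⁻¹ = e^{-h/2}`. -/
def qi : K := qpow (-1)

theorem qpow_zero : qpow 0 = 1 := by
  ext n
  rcases n with _ | n <;> simp [qpow, PowerSeries.coeff_one]

theorem qpow_add (r s : ℂ) : qpow (r + s) = qpow r * qpow s := by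
  have key : ∀ t : ℂ, qpow t = PowerSeries.rescale (t / 2) (PowerSeries.exp ℂ) := by
    intro t
    ext n
    simp [qpow, PowerSeries.coeff_rescale, PowerSeries.coeff_exp]
  rw [key, key, key, PowerSeries.exp_mul_exp_eq_exp_add, add_div]

theorem q_mul_qi : q * qi = 1 := by
  rw [q, qi, ← qpow_add, add_neg_cancel, qpow_zero]

/-- The quantum integer `[n] = (qⁿ - q⁻ⁿ) / (q - q⁻¹)`, written as
`qⁿ⁻¹ + qⁿ⁻³ + ⋯ + q¹⁻ⁿ`. -/
def qInt (n : ℕ) : K := ∑ i ∈ Finset.range n, qpow ((n : ℂ) - 1 - 2 * i)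

theorem qInt_mul (n : ℕ) : qInt n * (q - qi) = qpow n - qpow (-n) := by
  have key : ∀ m : ℕ, (∑ i ∈ Finset.range m, qpow ((n : ℂ) - 1 - 2 * i)) * (q - qi) =
      qpow n - qpow (n - 2 * m) := by
    intro m
    induction m with
    | zero => simp
    | succ m ih =>
      rw [Finset.sum_range_succ, add_mul, ih, mul_sub, q, qi, ← qpow_add, ← qpow_add]
      have e1 : (n : ℂ) - 1 - 2 * m + 1 = n - 2 * m := by ring
      have e2 : (n : ℂ) - 1 - 2 * m + -1 = n - 2 * ((m + 1 : ℕ) : ℂ) := by push_cast; ring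
      rw [e1, e2]
      ring
  rw [qInt, key n]
  congr 2
  ring

/-- The quantum factorial `[n]! = [1] [2] ⋯ [n]`. -/
def qFact (n : ℕ) : K := ∏ i ∈ Finset.range n, qInt (i + 1)

theorem constantCoeff_qFact_ne_zero (n : ℕ) : PowerSeries.constantCoeff (qFact n) ≠ 0 := by
  have h1 : ∀ r, PowerSeries.constantCoeff (qpow r) = 1 := by
    intro r
    rw [← PowerSeries.coeff_zero_eq_constantCoeff_apply]
    simp [qpow]
  rw [qFact, map_prod, Finset.prod_ne_zero_iff]
  intro i _
  rw [qInt, map_sum]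
  simp only [h1, Finset.sum_const, Finset.card_range, nsmul_eq_mul, mul_one]
  exact_mod_cast Nat.succ_ne_zero i

/-- The inverse of `[n]!` in `ℂ⟦h⟧` is a genuine inverse. -/
theorem qFact_mul_inv (n : ℕ) : qFact n * (qFact n)⁻¹ = 1 :=
  PowerSeries.mul_inv_cancel _ (constantCoeff_qFact_ne_zero n)

/-- The power series `(q - q⁻¹) / h`. -/
def qDiffDivH : K := PowerSeries.mk fun n => PowerSeries.coeff (n + 1) (q - qi)

theorem h_mul_qDiffDivH : h * qDiffDivH = q - qi := by
  ext n
  rcases n with _ | n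
  · simp [q, qi, qpow]
  · rw [mul_comm, PowerSeries.coeff_succ_mul_X, qDiffDivH, PowerSeries.coeff_mk]

theorem qDiffDivH_mul_inv : qDiffDivH * qDiffDivH⁻¹ = 1 := by
  apply PowerSeries.mul_inv_cancel
  rw [← PowerSeries.coeff_zero_eq_constantCoeff_apply, qDiffDivH, PowerSeries.coeff_mk]
  simp [q, qi, qpow]
  norm_num

theorem q_sub_qi_mem : q - qi ∈ hIdeal := by
  rw [← h_mul_qDiffDivH]
  exact Ideal.mul_mem_right _ _ h_mem

theorem qi_sub_q_mem : qi - q ∈ hIdeal := by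
  rw [← neg_sub]
  exact neg_mem q_sub_qi_mem

/-! ### Topological Hopf algebras over `ℂ⟦h⟧` -/

section Hopf

variable (A : Type*) [Ring A] [Algebra K A]

/-- The completed tensor square of `A`. -/
abbrev CT2 : Type _ := Completion (A ⊗[K] A)

/-- The completed tensor cube of `A`. -/
abbrev CT3 : Type _ := Completion ((A ⊗[K] A) ⊗[K] A)

variable {A}

/-- The element `a ⊗ b` of the completed tensor square. -/
def ten (a b : A) : CT2 A := Completion.of (A ⊗[K] A) (a ⊗ₜ[K] b)

/-- `a ↦ a ⊗ 1 ⊗ 1` -/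
def leg1 : A →ₐ[K] (A ⊗[K] A) ⊗[K] A :=
  Algebra.TensorProduct.includeLeft.comp Algebra.TensorProduct.includeLeft

/-- `a ↦ 1 ⊗ a ⊗ 1` -/
def leg2 : A →ₐ[K] (A ⊗[K] A) ⊗[K] A :=
  Algebra.TensorProduct.includeLeft.comp Algebra.TensorProduct.includeRight

/-- `a ↦ 1 ⊗ 1 ⊗ a` -/
def leg3 : A →ₐ[K] (A ⊗[K] A) ⊗[K] A := Algebra.TensorProduct.includeRight

/-- `a ⊗ b ↦ a ⊗ b ⊗ 1`, on the completed tensor square. -/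
def leg12 : CT2 A →ₐ[K] CT3 A := Completion.map Algebra.TensorProduct.includeLeft

/-- `a ⊗ b ↦ a ⊗ 1 ⊗ b`, on the completed tensor square. -/
def leg13 : CT2 A →ₐ[K] CT3 A :=
  Completion.map (Algebra.TensorProduct.map Algebra.TensorProduct.includeLeft (AlgHom.id K A))

/-- `a ⊗ b ↦ 1 ⊗ a ⊗ b`, on the completed tensor square. -/
def leg23 : CT2 A →ₐ[K] CT3 A :=
  Completion.map (Algebra.TensorProduct.map Algebra.TensorProduct.includeRight (AlgHom.id K A))

/-- The twist `a ⊗ b ↦ b ⊗ a`, on the completed tensor square. -/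
def twist : CT2 A →ₐ[K] CT2 A :=
  Completion.map (Algebra.TensorProduct.comm K A A).toAlgHom

/-- For a linear map `Δ`, the map `Δ ⊗ id : a ⊗ b ↦ Δ(a) ⊗ b` on the completed tensor square. -/
def tensorId (Δ : A →ₗ[K] CT2 A) : CT2 A →ₗ[K] CT3 A :=
  Completion.extend (LinearMap.mul' K (CT3 A) ∘ₗ TensorProduct.map (leg12.toLinearMap ∘ₗ Δ)
    ((Completion.of _).comp leg3).toLinearMap)

/-- For a linear map `Δ`, the map `id ⊗ Δ : a ⊗ b ↦ a ⊗ Δ(b)` on the completed tensor square. -/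
def idTensor (Δ : A →ₗ[K] CT2 A) : CT2 A →ₗ[K] CT3 A :=
  Completion.extend (LinearMap.mul' K (CT3 A) ∘ₗ TensorProduct.map
    ((Completion.of _).comp leg1).toLinearMap (leg23.toLinearMap ∘ₗ Δ))

/-- For linear maps `f, g`, the map `a ⊗ b ↦ f(a) g(b)` on the completed tensor square. -/
def mulMap [IsAdicComplete hIdeal A] (f g : A →ₗ[K] A) : CT2 A →ₗ[K] A :=
  Completion.extend (LinearMap.mul' K A ∘ₗ TensorProduct.map f g)

variable (A)

/-- The structure of a topological Hopf algebra on an `h`-adically complete `ℂ⟦h⟧`-algebra `A`: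
tensor products are completed, and maps, being `ℂ⟦h⟧`-linear, are continuous. -/
@[ext]
structure HopfStructure [IsAdicComplete hIdeal A] where
  /-- The coproduct `Δ`, an algebra homomorphism. -/
  comul : A →ₐ[K] CT2 A
  /-- The counit `ε`, an algebra homomorphism. -/
  counit : A →ₐ[K] K
  /-- The antipode `S`, an algebra anti-homomorphism. -/
  antipodeOp : A →ₐ[K] Aᵐᵒᵖ
  /-- `(Δ ⊗ id) ∘ Δ = (id ⊗ Δ) ∘ Δ` -/
  coassoc : ∀ a, tensorId comul.toLinearMap (comul a) = idTensor comul.toLinearMap (comul a)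
  /-- `(ε ⊗ id) ∘ Δ = id` -/
  counit_left : ∀ a,
    mulMap ((Algebra.linearMap K A) ∘ₗ counit.toLinearMap) LinearMap.id (comul a) = a
  /-- `(id ⊗ ε) ∘ Δ = id` -/
  counit_right : ∀ a,
    mulMap LinearMap.id ((Algebra.linearMap K A) ∘ₗ counit.toLinearMap) (comul a) = a
  /-- `m ∘ (S ⊗ id) ∘ Δ = η ∘ ε` -/
  antipode_left : ∀ a,
    mulMap ((MulOpposite.opLinearEquiv K).symm.toLinearMap ∘ₗ antipodeOp.toLinearMap)
      LinearMap.id (comul a) = algebraMap K A (counit a)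
  /-- `m ∘ (id ⊗ S) ∘ Δ = η ∘ ε` -/
  antipode_right : ∀ a,
    mulMap LinearMap.id
      ((MulOpposite.opLinearEquiv K).symm.toLinearMap ∘ₗ antipodeOp.toLinearMap)
      (comul a) = algebraMap K A (counit a)

variable {A}

namespace HopfStructure

variable [IsAdicComplete hIdeal A] (𝓗 : HopfStructure A)

/-- The antipode as a linear map `A → A`. -/
def antipode : A →ₗ[K] A :=
  (MulOpposite.opLinearEquiv K).symm.toLinearMap ∘ₗ 𝓗.antipodeOp.toLinearMap

/-- `R` is a universal R-matrix: `(A, R)` is a quasi-triangular Hopf algebra. -/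
structure IsUniversalR (R : CT2 A) : Prop where
  isUnit : IsUnit R
  twist_comul : ∀ a, twist (𝓗.comul a) = R * 𝓗.comul a * Ring.inverse R
  comul_left : tensorId 𝓗.comul.toLinearMap R = leg13 R * leg23 R
  comul_right : idTensor 𝓗.comul.toLinearMap R = leg13 R * leg12 R

/-- The element `u = ∑ S(βᵢ) αᵢ`, where `R = ∑ αᵢ ⊗ βᵢ`. -/
def u (R : CT2 A) : A := mulMap 𝓗.antipode LinearMap.id (twist R)

/-- `(A, R, v)` is a ribbon Hopf algebra. In the last condition `τ(R) R` is a unit, since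
`R` is one. -/
structure IsRibbon (R : CT2 A) (v : A) : Prop where
  isUniversalR : 𝓗.IsUniversalR R
  central : ∀ a, v * a = a * v
  sq : v ^ 2 = 𝓗.antipode (𝓗.u R) * 𝓗.u R
  antipode_v : 𝓗.antipode v = v
  counit_v : 𝓗.counit v = 1
  comul_v : 𝓗.comul v = Ring.inverse (twist R * R) * ten v v

end HopfStructure

end Hopf

/-! ### The quantized universal enveloping algebra of `sl₂` -/

/-- Names for the three generators. -/
inductive Gen : Type
  | H
  | x
  | y

/-- The `h`-adically completed free `ℂ⟦h⟧`-algebra on `H, x, y`, that is, formal power series in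
`h` with coefficients in the free `ℂ`-algebra. -/
def Free : Type := Completion (FreeAlgebra K Gen)

instance : Ring Free := inferInstanceAs (Ring (Completion (FreeAlgebra K Gen)))
instance : Algebra K Free := inferInstanceAs (Algebra K (Completion (FreeAlgebra K Gen)))
instance : IsAdicComplete hIdeal Free :=
  inferInstanceAs (IsAdicComplete hIdeal (Completion (FreeAlgebra K Gen)))

/-- The free generators. -/
def gen (g : Gen) : Free := Completion.of (FreeAlgebra K Gen) (FreeAlgebra.ι K g)

/-- The scalar `((1/2)ⁿ⁺¹ - (-1/2)ⁿ⁺¹) hⁿ / (n+1)!`. -/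
def sinhCoeff (n : ℕ) : K :=
  cst (((1 / 2 : ℂ) ^ (n + 1) - (-1 / 2 : ℂ) ^ (n + 1)) * ((n + 1).factorial : ℂ)⁻¹) * h ^ n

theorem sinhCoeff_mem (n : ℕ) : sinhCoeff n ∈ hIdeal ^ n :=
  Ideal.mul_mem_left _ _ (Ideal.pow_mem_pow h_mem n)

/-- The quotient `(e^{ha/2} - e^{-ha/2}) / (e^{h/2} - e^{-h/2})`, for an element `a` of an
`h`-adically complete algebra: both series are divided by `h`, after which the denominator is
a unit of `ℂ⟦h⟧`. -/
def bracket {A : Type*} [Ring A] [Algebra K A] [IsAdicComplete hIdeal A] (a : A) : A :=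
  qDiffDivH⁻¹ • adicSum (fun n => sinhCoeff n • a ^ (n + 1))
    (fun n => pow_smul_mem (sinhCoeff_mem n) _)

/-- The numerator is the product of the denominator and the quotient. -/
theorem bracket_spec {A : Type*} [Ring A] [Algebra K A] [IsAdicComplete hIdeal A] (a : A) :
    (q - qi) • bracket a = hexp (cst (1 / 2) • a) - hexp (cst (-1 / 2) • a) := by
  have e1 : (q - qi) • bracket a = h • adicSum (fun n => sinhCoeff n • a ^ (n + 1))
      (fun n => pow_smul_mem (sinhCoeff_mem n) _) := by
    rw [bracket, smul_smul, ← h_mul_qDiffDivH, mul_assoc, qDiffDivH_mul_inv, mul_one]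
  rw [e1, ← sub_eq_zero]
  refine IsHausdorff.haus (I := hIdeal) inferInstance _ fun n => ?_
  rw [SModEq.zero]
  have l1 := Submodule.smul_mem _ h (adicSum_spec (fun n => sinhCoeff n • a ^ (n + 1))
      (fun n => pow_smul_mem (sinhCoeff_mem n) _) n)
  have mono : hPow A (n + 1) ≤ hPow A n :=
    Submodule.smul_mono (Ideal.pow_le_pow_right n.le_succ) le_rfl
  have l2 := mono (adicSum_spec (fun n => divPow n • (cst (1 / 2) • a) ^ n)
    (fun n => pow_smul_mem (divPow_mem n) _) (n + 1))
  have l3 := mono (adicSum_spec (fun n => divPow n • (cst (-1 / 2) • a) ^ n)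
    (fun n => pow_smul_mem (divPow_mem n) _) (n + 1))
  have e2 : h • ∑ i ∈ Finset.range n, sinhCoeff i • a ^ (i + 1) =
      ∑ i ∈ Finset.range (n + 1), divPow i • (cst (1 / 2) • a) ^ i -
        ∑ i ∈ Finset.range (n + 1), divPow i • (cst (-1 / 2) • a) ^ i := by
    rw [← Finset.sum_sub_distrib, Finset.sum_range_succ', Finset.smul_sum]
    simp only [pow_zero, sub_self, add_zero]
    refine Finset.sum_congr rfl fun i _ => ?_
    rw [smul_pow, smul_pow, smul_smul, smul_smul, smul_smul, ← sub_smul]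
    congr 1
    simp only [sinhCoeff, divPow, cst, ← map_pow, map_mul, map_sub]
    ring
  have l4 := sub_mem l1 (sub_mem l2 l3)
  rw [smul_sub, e2] at l4
  unfold hexp
  convert l4 using 1
  abel

/-- The defining relations. -/
inductive Rel : Free → Free → Prop
  | Hx : Rel (gen .H * gen .x - gen .x * gen .H) (2 * gen .x)
  | Hy : Rel (gen .H * gen .y - gen .y * gen .H) (-(2 * gen .y))
  | xy : Rel (gen .x * gen .y - gen .y * gen .x) (bracket (gen .H))

/-- The quantized universal enveloping algebra `U_h(sl₂)`: the `ℂ⟦h⟧`-algebra topologically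
generated by `H, x, y` with the defining relations. It is the quotient of the completed free
algebra by the `h`-adic closure of the two-sided ideal of the relations, formed here as
the completion of the quotient by that ideal. -/
def Uh : Type := Completion (RingQuot Rel)

instance : Ring Uh := inferInstanceAs (Ring (Completion (RingQuot Rel)))
instance : Algebra K Uh := inferInstanceAs (Algebra K (Completion (RingQuot Rel)))
instance : IsAdicComplete hIdeal Uh :=
  inferInstanceAs (IsAdicComplete hIdeal (Completion (RingQuot Rel)))

namespace Uh

/-- The projection from the completed free algebra. -/
def proj : Free →ₐ[K] Uh := (Completion.of (RingQuot Rel)).comp (RingQuot.mkAlgHom K Rel)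

/-- The generator `H`. -/
def H : Uh := proj (gen .H)

/-- The generator `x`. -/
def x : Uh := proj (gen .x)

/-- The generator `y`. -/
def y : Uh := proj (gen .y)

/-- `k = e^{hH/4}` -/
def k : Uh := hexp (cst (1 / 4) • H)

/-- `k⁻¹ = e^{-hH/4}` -/
def ki : Uh := hexp (cst (-1 / 4) • H)

/-- The scalar `((q - q⁻¹)ⁿ / [n]!) q^{n(n-3)/2}`. -/
def coeffR (n : ℕ) : K := (q - qi) ^ n * (qFact n)⁻¹ * qpow ((n : ℂ) * (n - 3) / 2)

theorem coeffR_mem (n : ℕ) : coeffR n ∈ hIdeal ^ n :=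
  Ideal.mul_mem_right _ _ (Ideal.mul_mem_right _ _ (Ideal.pow_mem_pow q_sub_qi_mem n))

/-- `R = e^{(h/4) H ⊗ H} ∑ ((q - q⁻¹)ⁿ / [n]!) q^{n(n-3)/2} (k x)ⁿ ⊗ (k⁻¹ y)ⁿ` -/
def R : CT2 Uh :=
  hexp (cst (1 / 4) • ten H H) *
    adicSum (fun n => coeffR n • ten ((k * x) ^ n) ((ki * y) ^ n))
      (fun n => pow_smul_mem (coeffR_mem n) _)

/-- The scalar `((q⁻¹ - q)ⁿ / [n]!) q^{-n(n+3)/2}`. -/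
def coeffV (n : ℕ) : K := (qi - q) ^ n * (qFact n)⁻¹ * qpow (-((n : ℂ) * (n + 3) / 2))

theorem coeffV_mem (n : ℕ) : coeffV n ∈ hIdeal ^ n :=
  Ideal.mul_mem_right _ _ (Ideal.mul_mem_right _ _ (Ideal.pow_mem_pow qi_sub_q_mem n))

/-- `v = e^{-(h/4) H²} ∑ ((q⁻¹ - q)ⁿ / [n]!) q^{-n(n+3)/2} k^{-2(n+1)} yⁿ xⁿ` -/
def v : Uh :=
  hexp (cst (-1 / 4) • H ^ 2) *
    adicSum (fun n => coeffV n • (ki ^ (2 * (n + 1)) * y ^ n * x ^ n))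
      (fun n => pow_smul_mem (coeffV_mem n) _)

/-- The values on the generators of the coproduct, the counit and the antipode of `U_h(sl₂)`. -/
structure IsStandard (𝓗 : HopfStructure Uh) : Prop where
  comul_x : 𝓗.comul x = ten x k + ten ki x
  comul_y : 𝓗.comul y = ten y k + ten ki y
  comul_H : 𝓗.comul H = ten H 1 + ten 1 H
  counit_x : 𝓗.counit x = 0
  counit_y : 𝓗.counit y = 0
  counit_H : 𝓗.counit H = 0
  antipode_x : 𝓗.antipode x = -(q • x)
  antipode_y : 𝓗.antipode y = -(qi • y)
  antipode_H : 𝓗.antipode H = -H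

end Uh

end QuantumSl2

end

/-!
`U_h(sl₂)` has the universal property that homomorphisms into an `h`-adically complete algebra are
given by elements which satisfy the defining relations (`Uh.lift`), and linear maps are
automatically continuous, so that identities between them can be checked on pure tensors
(`ten_linearMap_ext`) or on the generators (`Uh.linearMap_ext_of_mul`). This gives the existence and
uniqueness of the Hopf algebra structure. Functions of two commuting elements, such as
`e^{h(a + b)}`, are treated in the completion `TwoVar` of a polynomial ring in two variables, whose
elements are determined by their values at points (`TwoVar.ext_of_eval`).

With `e = k x` and `f = k⁻¹ y`, the matrix is `R = e^{(h/4) H ⊗ H} Θ`, where `Θ = ∑ cₙ eⁿ ⊗ fⁿ` is a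
`q`-exponential series. Conjugation by `e^{(h/4) H ⊗ H}` multiplies by powers of `k`, the series
satisfies the addition formula `hasAdicSum_coeffR_add`, and its commutator with `1 ⊗ e` or `f ⊗ 1`
telescopes (`quasiR_commutator`). These three facts prove that `R` is a universal R-matrix.

Moving the Gaussian `e^{-(h/4) H²}` to the left in `u = ∑ S(βᵢ) αᵢ` shows that `v = k⁻² u`
(`Uh.v_eq`). A telescoping sum shows that `u f = S²(f) u`, so that `v` commutes with `y`; the
anti-automorphism which exchanges `x` and `y` fixes `v`, so that `v` commutes with `x` as well.

For `S(v) = v`, both `v` and `S(v)` are, up to the Gaussian, series in the commuting elements `H`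
and `y x`, built from `yⁿ xⁿ` and `xⁿ yⁿ` respectively. At the points `H = c`,
`y x = [j] [c + j + 1]` with `j` a natural number, both reduce to `q`-binomial series, with
exponents `j` and `-j - 1`, and have the sum `q^{-(2j+1)c - 2j² - 2j}`
(`Uh.lowerSum_eq_raiseSum`). There are enough such points to conclude.

For `Δ(v)`, one starts from `R Δ(u) = ∑ (S ⊗ S)(Δ(βᵢ)) R Δ(αᵢ)`. The hexagon identities
`(Δ ⊗ id)(R) = R₁₃ R₂₃` and `(id ⊗ Δ)(R) = R₁₃ R₁₂` split this into four successive operations,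
each of which multiplies by the legs of one copy of `R`. The first one turns `R` into `1`, the next
two turn `1` into `u ⊗ 1` and then into `u ⊗ u`, and the last one multiplies by `τ(R)⁻¹`. This is
`Uh.R_mul_comul_drinfeld`; with `v = k⁻² u` central it gives `Δ(v) = (τ(R) R)⁻¹ (v ⊗ v)`. Finally,
`v² = S(u) u` follows from `u = k² v` and `S(u) = v k⁻²`.
-/

noncomputable section

namespace QuantumSl2

/-! ### Adic topology -/

section Adic

variable {M N : Type*} [AddCommGroup M] [Module K M] [AddCommGroup N] [Module K N]

theorem mem_hPow {n : ℕ} {a : M} : a ∈ hPow M n ↔ ∃ m : M, h ^ n • m = a := by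
  rw [hPow, hIdeal, Ideal.span_singleton_pow, Submodule.ideal_span_singleton_smul,
    Submodule.mem_smul_pointwise_iff_exists]
  simp

theorem hPow_anti {m n : ℕ} (hmn : m ≤ n) : hPow M n ≤ hPow M m :=
  Submodule.smul_mono (Ideal.pow_le_pow_right hmn) le_rfl

theorem eq_of_sub_mem_hPow [IsAdicComplete hIdeal M] {a b : M} (hab : ∀ n, a - b ∈ hPow M n) :
    a = b := by
  rw [← sub_eq_zero]
  refine IsHausdorff.haus (I := hIdeal) inferInstance _ fun n => ?_
  rw [SModEq.zero]
  exact hab n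

theorem isAdicComplete_of_linearEquiv [IsAdicComplete hIdeal M] (e : M ≃ₗ[K] N) :
    IsAdicComplete hIdeal N where
  haus' b hb := by
    rw [← e.symm.map_eq_zero_iff]
    refine IsHausdorff.haus (I := hIdeal) inferInstance _ fun n => ?_
    rw [SModEq.zero]
    exact Completion.map_hPow e.symm.toLinearMap (SModEq.zero.1 (hb n))
  prec' f hf := by
    obtain ⟨L, hL⟩ := IsPrecomplete.prec (I := hIdeal) (M := M) inferInstance
      (f := fun n => e.symm (f n)) (fun {m n} hmn => by
        rw [SModEq.sub_mem, ← map_sub]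
        exact Completion.map_hPow e.symm.toLinearMap (SModEq.sub_mem.1 (hf hmn)))
    refine ⟨e L, fun n => ?_⟩
    rw [SModEq.sub_mem]
    have := Completion.map_hPow e.toLinearMap (SModEq.sub_mem.1 (hL n))
    simpa using this

instance {A : Type*} [Ring A] [Algebra K A] [IsAdicComplete hIdeal A] :
    IsAdicComplete hIdeal Aᵐᵒᵖ :=
  isAdicComplete_of_linearEquiv (MulOpposite.opLinearEquiv K : A ≃ₗ[K] Aᵐᵒᵖ)

theorem mem_hPow_ground {n : ℕ} {a : K} : a ∈ hPow K n ↔ ∀ m < n, PowerSeries.coeff m a = 0 := by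
  rw [mem_hPow, ← PowerSeries.X_pow_dvd_iff]
  exact ⟨fun ⟨m, hm⟩ => ⟨m, hm.symm⟩, fun ⟨m, hm⟩ => ⟨m, hm.symm⟩⟩

instance : IsAdicComplete hIdeal K where
  haus' a ha := by
    ext m
    exact mem_hPow_ground.1 (SModEq.zero.1 (ha (m + 1))) m m.lt_succ_self
  prec' f hf := by
    refine ⟨PowerSeries.mk fun m => PowerSeries.coeff m (f (m + 1)), fun n => ?_⟩
    rw [SModEq.sub_mem]
    refine mem_hPow_ground.2 fun m hm => ?_
    have := mem_hPow_ground.1 (SModEq.sub_mem.1 (hf (Nat.succ_le_of_lt hm))) m m.lt_succ_self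
    rw [map_sub, PowerSeries.coeff_mk, sub_eq_zero]
    rw [map_sub, sub_eq_zero] at this
    exact this.symm

/-- The sequence `a` has the `h`-adic sum `s`, where the `n`-th remainder is divisible by `hⁿ`. -/
def HasAdicSum (a : ℕ → M) (s : M) : Prop :=
  ∀ n, s - ∑ i ∈ Finset.range n, a i ∈ hPow M n

namespace HasAdicSum

variable {a b : ℕ → M} {s t : M}

theorem unique [IsAdicComplete hIdeal M] (hs : HasAdicSum a s) (ht : HasAdicSum a t) : s = t :=
  eq_of_sub_mem_hPow fun n => by
    have := sub_mem (hs n) (ht n)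
    rwa [sub_sub_sub_cancel_right] at this

theorem map (f : M →ₗ[K] N) (hs : HasAdicSum a s) : HasAdicSum (fun n => f (a n)) (f s) :=
  fun n => by
    rw [← map_sum, ← map_sub]
    exact Completion.map_hPow f (hs n)

theorem term_mem (hs : HasAdicSum a s) (n : ℕ) : a n ∈ hPow M n := by
  have := sub_mem (hs n) (hPow_anti n.le_succ (hs (n + 1)))
  rwa [Finset.sum_range_succ, sub_sub_sub_cancel_left, add_sub_cancel_left] at this

theorem add (hs : HasAdicSum a s) (ht : HasAdicSum b t) :
    HasAdicSum (fun n => a n + b n) (s + t) := fun n => by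
  rw [Finset.sum_add_distrib, add_sub_add_comm]
  exact add_mem (hs n) (ht n)

theorem neg (hs : HasAdicSum a s) : HasAdicSum (fun n => -a n) (-s) := fun n => by
  rw [Finset.sum_neg_distrib, ← neg_sub', neg_mem_iff]
  exact hs n

theorem sub (hs : HasAdicSum a s) (ht : HasAdicSum b t) :
    HasAdicSum (fun n => a n - b n) (s - t) := by
  simpa only [sub_eq_add_neg] using hs.add ht.neg

theorem congr (hs : HasAdicSum a s) (hab : ∀ n, a n = b n) : HasAdicSum b s :=
  (funext hab : a = b) ▸ hs

/-- Prepending the terms of a sequence whose first entry vanishes. -/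
theorem of_succ (hs : HasAdicSum (fun n => a (n + 1)) s) (ha : ∀ n, a n ∈ hPow M n) :
    HasAdicSum a (a 0 + s) := fun n => by
  rcases n with _ | n
  · exact mem_hPow.2 ⟨_, by rw [pow_zero, one_smul]⟩
  · rw [Finset.sum_range_succ']
    have e : a 0 + s - (∑ i ∈ Finset.range n, a (i + 1) + a 0) =
        (s - ∑ i ∈ Finset.range (n + 1), a (i + 1)) + a (n + 1) := by
      rw [Finset.sum_range_succ]; abel
    rw [e]
    exact add_mem (hs (n + 1)) (ha (n + 1))

theorem single : HasAdicSum (fun n => if n = 0 then s else 0) s := fun n => by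
  rcases n with _ | n
  · exact mem_hPow.2 ⟨_, by rw [pow_zero, one_smul]⟩
  · simp

end HasAdicSum

theorem adicSum_hasAdicSum [IsAdicComplete hIdeal M] (a : ℕ → M) (ha : ∀ n, a n ∈ hPow M n) :
    HasAdicSum a (adicSum a ha) :=
  adicSum_spec a ha

end Adic

section AdicAlgebra

variable {A B : Type*} [Ring A] [Algebra K A] [Ring B] [Algebra K B]

theorem mul_mem_hPow {m n : ℕ} {a b : A} (ha : a ∈ hPow A m) (hb : b ∈ hPow A n) :
    a * b ∈ hPow A (m + n) := by
  obtain ⟨a, rfl⟩ := mem_hPow.1 ha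
  obtain ⟨b, rfl⟩ := mem_hPow.1 hb
  exact mem_hPow.2 ⟨a * b, by rw [smul_mul_smul_comm, pow_add]⟩

namespace HasAdicSum

variable {a b : ℕ → A} {s t : A}

theorem mul_left (c : A) (hs : HasAdicSum a s) : HasAdicSum (fun n => c * a n) (c * s) :=
  hs.map (LinearMap.mulLeft K c)

theorem mul_right (c : A) (hs : HasAdicSum a s) : HasAdicSum (fun n => a n * c) (s * c) :=
  hs.map (LinearMap.mulRight K c)

/-- The Cauchy product. -/
theorem mul (hs : HasAdicSum a s) (ht : HasAdicSum b t) :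
    HasAdicSum (fun n => ∑ ij ∈ Finset.HasAntidiagonal.antidiagonal n, a ij.1 * b ij.2)
      (s * t) := fun n => by
  have key : ∀ m, (∑ i ∈ Finset.range m, ∑ ij ∈ Finset.HasAntidiagonal.antidiagonal i,
      a ij.1 * b ij.2) =
      ∑ i ∈ Finset.range m, a i * ∑ j ∈ Finset.range (m - i), b j := by
    intro m
    simp only [Finset.Nat.sum_antidiagonal_eq_sum_range_succ (fun i j => a i * b j)]
    simp only [Finset.mul_sum]
    rw [Finset.sum_sigma', Finset.sum_sigma']
    refine Finset.sum_bij' (fun x _ => ⟨x.2, x.1 - x.2⟩) (fun x _ => ⟨x.1 + x.2, x.1⟩)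
      ?_ ?_ ?_ ?_ ?_
    · rintro ⟨i, j⟩ hij
      simp only [Finset.mem_sigma, Finset.mem_range] at hij ⊢
      omega
    · rintro ⟨i, j⟩ hij
      simp only [Finset.mem_sigma, Finset.mem_range] at hij ⊢
      omega
    · rintro ⟨i, j⟩ hij
      simp only [Finset.mem_sigma, Finset.mem_range] at hij
      simp only [Sigma.mk.injEq, heq_eq_eq, and_true]
      omega
    · rintro ⟨i, j⟩ hij
      simp
    · rintro ⟨i, j⟩ hij
      rfl
  rw [key]
  have e : s * t - ∑ i ∈ Finset.range n, a i * ∑ j ∈ Finset.range (n - i), b j =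
      (s - ∑ i ∈ Finset.range n, a i) * t +
        ∑ i ∈ Finset.range n, a i * (t - ∑ j ∈ Finset.range (n - i), b j) := by
    simp only [mul_sub, Finset.sum_sub_distrib, sub_mul, Finset.sum_mul]
    abel
  rw [e]
  refine add_mem (Completion.mul_mem_hPow_left (hs n) t) (sum_mem fun i hi => ?_)
  have := mul_mem_hPow (hs.term_mem i) (ht (n - i))
  rwa [Nat.add_sub_cancel' (Finset.mem_range.1 hi).le] at this

end HasAdicSum

theorem hexp_hasAdicSum [IsAdicComplete hIdeal A] (a : A) :
    HasAdicSum (fun n => divPow n • a ^ n) (hexp a) :=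
  adicSum_hasAdicSum _ _

theorem bracket_hasAdicSum [IsAdicComplete hIdeal A] (a : A) :
    HasAdicSum (fun n => qDiffDivH⁻¹ • sinhCoeff n • a ^ (n + 1)) (bracket a) :=
  (adicSum_hasAdicSum (fun n => sinhCoeff n • a ^ (n + 1))
    (fun n => pow_smul_mem (sinhCoeff_mem n) _)).map (LinearMap.lsmul K A qDiffDivH⁻¹)

section Hom

variable [IsAdicComplete hIdeal A] [IsAdicComplete hIdeal B]

theorem map_hexp (f : A →ₐ[K] B) (a : A) : f (hexp a) = hexp (f a) := by
  refine (((hexp_hasAdicSum a).map f.toLinearMap).congr fun n => ?_).unique (hexp_hasAdicSum _)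
  simp

theorem map_bracket (f : A →ₐ[K] B) (a : A) : f (bracket a) = bracket (f a) := by
  refine (((bracket_hasAdicSum a).map f.toLinearMap).congr fun n => ?_).unique
    (bracket_hasAdicSum _)
  simp

theorem hexp_intertwine {a b x : A} (hx : a * x = x * b) : hexp a * x = x * hexp b := by
  have hn : ∀ n, a ^ n * x = x * b ^ n := fun n => (SemiconjBy.pow_right (a := x) hx.symm n).symm
  refine (((hexp_hasAdicSum a).mul_right x).congr fun n => ?_).unique
    ((hexp_hasAdicSum b).mul_left x)
  rw [smul_mul_assoc, hn, mul_smul_comm]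

theorem bracket_intertwine {a b x : A} (hx : a * x = x * b) : bracket a * x = x * bracket b := by
  have hn : ∀ n, a ^ n * x = x * b ^ n := fun n => (SemiconjBy.pow_right (a := x) hx.symm n).symm
  refine (((bracket_hasAdicSum a).mul_right x).congr fun n => ?_).unique
    ((bracket_hasAdicSum b).mul_left x)
  rw [smul_mul_assoc, smul_mul_assoc, hn, mul_smul_comm, mul_smul_comm]

theorem hexp_zero : hexp (0 : A) = 1 := by
  refine (hexp_hasAdicSum (0 : A)).unique (HasAdicSum.single.congr fun n => ?_)
  rcases n with _ | n <;> simp [divPow]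

theorem bracket_zero : bracket (0 : A) = 0 := by
  refine (bracket_hasAdicSum (0 : A)).unique (HasAdicSum.single.congr fun n => ?_)
  simp

theorem bracket_neg (a : A) : bracket (-a) = -bracket a := by
  refine (bracket_hasAdicSum (-a)).unique ((bracket_hasAdicSum a).neg.congr fun n => ?_)
  rw [neg_pow, ← smul_neg, ← smul_neg]
  congr 1
  rcases Nat.even_or_odd n with hn | hn
  · simp [hn.add_one.neg_one_pow]
  · have : sinhCoeff n = 0 := by
      simp [sinhCoeff, cst, neg_div, hn.add_one.neg_pow]
    simp [this]

end Hom

theorem isUnit_of_sub_one_mem [IsAdicComplete hIdeal A] {a : A} (ha : a - 1 ∈ hPow A 1) :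
    IsUnit a := by
  -- The inverse is the geometric series in `1 - a`.
  set d := 1 - a with hd
  have hd1 : d ∈ hPow A 1 := by rw [hd, ← neg_sub, neg_mem_iff]; exact ha
  have hdn : ∀ n, d ^ n ∈ hPow A n := by
    intro n
    induction n with
    | zero => exact mem_hPow.2 ⟨_, by rw [pow_zero, one_smul]⟩
    | succ n ih => rw [pow_succ]; exact mul_mem_hPow ih hd1
  have hs := adicSum_hasAdicSum _ hdn
  set s := adicSum _ hdn
  have hs' := hs.map (LinearMap.mulLeft K d)
  have h1 : s = 1 + d * s := by
    refine hs.unique ?_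
    have := HasAdicSum.of_succ (a := fun n => d ^ n) (s := d * s)
      (hs'.congr fun n => by simp [pow_succ']) hdn
    simpa using this
  have h2 : s = 1 + s * d := by
    refine hs.unique ?_
    have := HasAdicSum.of_succ (a := fun n => d ^ n) (s := s * d)
      ((hs.map (LinearMap.mulRight K d)).congr fun n => by simp [pow_succ]) hdn
    simpa using this
  have ea : a = 1 - d := by rw [hd]; abel
  refine ⟨⟨a, s, ?_, ?_⟩, rfl⟩
  · rw [ea, sub_mul, one_mul, sub_eq_iff_eq_add]; exact h1
  · rw [ea, mul_sub, mul_one, sub_eq_iff_eq_add]; exact h2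

end AdicAlgebra

/-! ### Density of an algebra in its completion -/

namespace Completion

section

variable {A : Type*} [Ring A] [Algebra K A]

theorem comp_eq_zero_iff {n : ℕ} {a : Completion A} : comp n a = 0 ↔ a ∈ hPow (Completion A) n := by
  have := AdicCompletion.pow_smul_top_eq_ker_eval (M := A) (I := hIdeal) (n := n)
    ⟨{PowerSeries.X}, by simp⟩
  change a ∈ (AdicCompletion.eval hIdeal A n).ker ↔ _
  rw [← this]
  rfl

theorem of_mem_hPow_iff {n : ℕ} {r : A} : of A r ∈ hPow (Completion A) n ↔ r ∈ hPow A n := by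
  rw [← comp_eq_zero_iff]
  exact Submodule.Quotient.mk_eq_zero _

theorem exists_sub_of_mem (a : Completion A) (n : ℕ) :
    ∃ r : A, a - of A r ∈ hPow (Completion A) n := by
  obtain ⟨r, hr⟩ := comp_surj n a
  refine ⟨r, comp_eq_zero_iff.1 ?_⟩
  rw [map_sub, hr]
  exact sub_self _

/-- Linear maps are continuous, so a linear map on a completion is determined by its restriction. -/
theorem linearMap_ext {N : Type*} [AddCommGroup N] [Module K N] [IsAdicComplete hIdeal N]
    {f g : Completion A →ₗ[K] N} (hfg : ∀ a, f (of A a) = g (of A a)) : f = g := by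
  ext z
  refine eq_of_sub_mem_hPow fun n => ?_
  obtain ⟨r, hr⟩ := exists_sub_of_mem z n
  have h1 := map_hPow f hr
  have h2 := map_hPow g hr
  rw [map_sub] at h1 h2
  have := sub_mem h1 h2
  rwa [hfg, sub_sub_sub_cancel_right] at this

/-- A linear map on a completion is multiplicative if its restriction is. -/
theorem map_mul_of_dense {B : Type*} [Ring B] [Algebra K B] [IsAdicComplete hIdeal B]
    (f : Completion A →ₗ[K] B)
    (hf : ∀ a b, f (of A a * of A b) = f (of A a) * f (of A b)) (z w : Completion A) :
    f (z * w) = f z * f w := by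
  have h1 : ∀ a w, f (of A a * w) = f (of A a) * f w := fun a w =>
    DFunLike.congr_fun (linearMap_ext (f := f ∘ₗ LinearMap.mulLeft K (of A a))
      (g := LinearMap.mulLeft K (f (of A a)) ∘ₗ f) (fun b => hf a b)) w
  exact DFunLike.congr_fun (linearMap_ext (f := f ∘ₗ LinearMap.mulRight K w)
      (g := LinearMap.mulRight K (f w) ∘ₗ f) (fun a => h1 a w)) z

/-- The continuous extension of an algebra homomorphism into an `h`-adically complete algebra. -/
def lift {B : Type*} [Ring B] [Algebra K B] [IsAdicComplete hIdeal B] (f : A →ₐ[K] B) :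
    Completion A →ₐ[K] B :=
  AlgHom.ofLinearMap (extend f.toLinearMap)
    (by rw [← map_one (of A), extend_of]; simp)
    (map_mul_of_dense _ fun a b => by
      rw [← map_mul, extend_of, extend_of, extend_of]; simp)

theorem lift_of {B : Type*} [Ring B] [Algebra K B] [IsAdicComplete hIdeal B] (f : A →ₐ[K] B)
    (a : A) : lift f (of A a) = f a :=
  extend_of _ a

end

section Tensor

variable {A B : Type*} [Ring A] [Algebra K A] [Ring B] [Algebra K B]

theorem linearMap_ext_tensor {N : Type*} [AddCommGroup N] [Module K N] [IsAdicComplete hIdeal N]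
    {f g : Completion (A ⊗[K] B) →ₗ[K] N}
    (hfg : ∀ a b, f (of _ (a ⊗ₜ b)) = g (of _ (a ⊗ₜ b))) : f = g := by
  refine linearMap_ext fun z => ?_
  induction z with
  | zero => simp
  | add z w hz hw => simp only [map_add, hz, hw]
  | tmul a b => exact hfg a b

end Tensor

end Completion

/-! ### Identities between functions of two commuting elements -/

/-- The `h`-adic completion of the polynomial ring `ℂ⟦h⟧[t][s]`, in which identities between
functions of two commuting elements can be checked pointwise. -/
abbrev TwoVar : Type := Completion (Polynomial (Polynomial K))

namespace TwoVar

/-- The first variable. -/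
def t : TwoVar := Completion.of _ (Polynomial.C Polynomial.X)

/-- The second variable. -/
def s : TwoVar := Completion.of _ Polynomial.X

section Eval

variable {B : Type*} [Ring B] [Algebra K B] [IsAdicComplete hIdeal B]

/-- Substitution of two commuting elements in a polynomial. -/
def polyEval {a b : B} (hab : Commute a b) : Polynomial (Polynomial K) →ₐ[K] B :=
  Polynomial.eval₂AlgHom (Polynomial.aeval a) b fun p => by
    induction p using Polynomial.induction_on' with
    | add p q hp hq => rw [map_add]; exact hp.add_left hq
    | monomial n c =>
      rw [Polynomial.aeval_monomial]
      exact (Algebra.commute_algebraMap_left c b).mul_left (hab.pow_left n)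

/-- Substitution of two commuting elements `a, b` of a complete algebra for `t, s`. -/
def subst {a b : B} (hab : Commute a b) : TwoVar →ₐ[K] B := Completion.lift (polyEval hab)

@[simp]
theorem subst_t {a b : B} (hab : Commute a b) : subst hab t = a := by
  simp [subst, t, Completion.lift_of, polyEval, Polynomial.eval₂AlgHom, Polynomial.eval₂RingHom']

@[simp]
theorem subst_s {a b : B} (hab : Commute a b) : subst hab s = b := by
  simp [subst, s, Completion.lift_of, polyEval, Polynomial.eval₂AlgHom, Polynomial.eval₂RingHom']

end Eval

/-- The value at the point `(c, d)`. -/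
def ev (c d : K) : TwoVar →ₐ[K] K := subst (Commute.all c d)

@[simp]
theorem ev_t (c d : K) : ev c d t = c := subst_t _

@[simp]
theorem ev_s (c d : K) : ev c d s = d := subst_s _

theorem constantCoeff_polyEval (c : ℂ) (d : K) (r : Polynomial (Polynomial K)) :
    PowerSeries.constantCoeff (polyEval (Commute.all (cst c) d) r) =
      (((r.map (Polynomial.mapRingHom PowerSeries.constantCoeff)).map
        (Polynomial.evalRingHom c)).eval (PowerSeries.constantCoeff d)) := by
  have : (PowerSeries.constantCoeff (R := ℂ)).comp
      (polyEval (Commute.all (cst c) d)).toRingHom =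
      (Polynomial.evalRingHom (PowerSeries.constantCoeff d)).comp
        ((Polynomial.mapRingHom (Polynomial.evalRingHom c)).comp
          (Polynomial.mapRingHom (Polynomial.mapRingHom PowerSeries.constantCoeff))) := by
    refine Polynomial.ringHom_ext' (Polynomial.ringHom_ext' ?_ ?_) ?_
    · ext z
      simp [polyEval, Polynomial.eval₂AlgHom, Polynomial.eval₂RingHom']
    · simp [polyEval, Polynomial.eval₂AlgHom, Polynomial.eval₂RingHom']
    · simp [polyEval, Polynomial.eval₂AlgHom, Polynomial.eval₂RingHom']
  exact DFunLike.congr_fun this r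

variable {d : ℂ → ℕ → K}

/-- Modulo `h`, this is the vanishing of a polynomial over `ℂ` in two variables with infinitely many
zeros on each vertical line. -/
theorem mem_hPow_one_of_eval
    (hd : ∀ c, (Set.range fun j => PowerSeries.constantCoeff (d c j)).Infinite)
    (r : Polynomial (Polynomial K))
    (hr : ∀ c j, PowerSeries.constantCoeff (polyEval (Commute.all (cst c) (d c j)) r) = 0) :
    r ∈ hPow (Polynomial (Polynomial K)) 1 := by
  set r0 := r.map (Polynomial.mapRingHom (PowerSeries.constantCoeff (R := ℂ))) with hr0
  have h1 : ∀ c : ℂ, r0.map (Polynomial.evalRingHom c) = 0 := fun c => by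
    refine Polynomial.eq_zero_of_infinite_isRoot _ ((hd c).mono ?_)
    rintro _ ⟨j, rfl⟩
    have := hr c j
    rwa [constantCoeff_polyEval] at this
  have h2 : ∀ i, r0.coeff i = 0 := fun i => Polynomial.funext fun c => by
    have := congrArg (fun f => Polynomial.coeff f i) (h1 c)
    simpa using this
  have h3 : ∀ i k, PowerSeries.X ∣ (r.coeff i).coeff k := fun i k => by
    rw [PowerSeries.X_dvd_iff]
    have := congrArg (fun f => Polynomial.coeff f k) (h2 i)
    simpa [hr0] using this
  have h4 : Polynomial.C (Polynomial.C h) ∣ r := by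
    rw [Polynomial.C_dvd_iff_dvd_coeff]
    intro i
    rw [Polynomial.C_dvd_iff_dvd_coeff]
    exact h3 i
  obtain ⟨m, rfl⟩ := h4
  refine mem_hPow.2 ⟨m, ?_⟩
  rw [pow_one, Algebra.smul_def]
  rfl

theorem mem_hPow_of_eval
    (hd : ∀ c, (Set.range fun j => PowerSeries.constantCoeff (d c j)).Infinite)
    (r : Polynomial (Polynomial K)) (n : ℕ)
    (hr : ∀ c j, polyEval (Commute.all (cst c) (d c j)) r ∈ hPow K n) :
    r ∈ hPow (Polynomial (Polynomial K)) n := by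
  induction n with
  | zero => exact mem_hPow.2 ⟨r, by rw [pow_zero, one_smul]⟩
  | succ n ih =>
    obtain ⟨r', rfl⟩ := mem_hPow.1 (ih fun c j => hPow_anti n.le_succ (hr c j))
    obtain ⟨m, rfl⟩ := mem_hPow.1 (mem_hPow_one_of_eval hd r' fun c j => by
      obtain ⟨m, hm⟩ := mem_hPow.1 (hr c j)
      rw [map_smul, smul_eq_mul, smul_eq_mul, pow_succ, mul_assoc] at hm
      rw [← mul_left_cancel₀ (pow_ne_zero n PowerSeries.X_ne_zero) hm]
      simp)
    exact mem_hPow.2 ⟨m, by rw [smul_smul, ← pow_add]⟩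

/-- Two elements of `TwoVar` agree if they take the same values at all points `(c, d c j)`, where
for each constant `c` the constant terms of the `d c j` form an infinite set. -/
theorem ext_of_eval
    (hd : ∀ c, (Set.range fun j => PowerSeries.constantCoeff (d c j)).Infinite)
    {F G : TwoVar} (hFG : ∀ c j, ev (cst c) (d c j) F = ev (cst c) (d c j) G) : F = G := by
  refine eq_of_sub_mem_hPow fun n => ?_
  obtain ⟨r, hr⟩ := Completion.exists_sub_of_mem (F - G) n
  have hrn : r ∈ hPow (Polynomial (Polynomial K)) n := mem_hPow_of_eval hd r n fun c j => by
    have := Completion.map_hPow (ev (cst c) (d c j)).toLinearMap hr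
    rw [map_sub, map_sub, AlgHom.toLinearMap_apply, AlgHom.toLinearMap_apply, hFG, sub_self,
      zero_sub, neg_mem_iff] at this
    simpa [ev, subst, Completion.lift_of] using this
  have := add_mem hr (Completion.of_mem_hPow_iff.2 hrn)
  rwa [sub_add_cancel] at this

theorem ext_cst {F G : TwoVar} (hFG : ∀ c d : ℂ, ev (cst c) (cst d) F = ev (cst c) (cst d) G) :
    F = G :=
  ext_of_eval (d := fun _ j => cst j)
    (fun _ => Set.infinite_range_of_injective fun i j hij => by simpa using hij)
    fun c j => hFG c j

end TwoVar

/-! ### Exponentials and quantum numbers of scalars -/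

theorem hasAdicSum_mk (a : ℕ → ℂ) :
    HasAdicSum (fun n => PowerSeries.C (a n) * h ^ n) (PowerSeries.mk a) := fun n => by
  refine mem_hPow_ground.2 fun m hm => ?_
  rw [map_sub, PowerSeries.coeff_mk, map_sum,
    Finset.sum_eq_single_of_mem m (Finset.mem_range.2 hm)]
  · simp
  · intro i _ hi
    simp [PowerSeries.coeff_X_pow, hi.symm]

theorem hexp_cst (c : ℂ) : hexp (cst c) = qpow (2 * c) := by
  refine (hexp_hasAdicSum _).unique ((hasAdicSum_mk _).congr fun n => ?_)
  rw [divPow, smul_eq_mul, ← map_pow, mul_right_comm, ← map_mul]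
  congr 2
  ring

theorem q_sub_qi_ne_zero : q - qi ≠ 0 := by
  rw [← h_mul_qDiffDivH]
  exact mul_ne_zero PowerSeries.X_ne_zero (left_ne_zero_of_mul_eq_one qDiffDivH_mul_inv)

theorem bracket_cst_mul (c : ℂ) : bracket (cst c) * (q - qi) = qpow c - qpow (-c) := by
  have := bracket_spec (cst c)
  rw [smul_eq_mul, smul_eq_mul, smul_eq_mul, ← map_mul, ← map_mul, hexp_cst, hexp_cst] at this
  rw [mul_comm, this]
  congr 2 <;> ring

theorem bracket_natCast (n : ℕ) : bracket (cst n) = qInt n :=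
  mul_right_cancel₀ q_sub_qi_ne_zero (by rw [bracket_cst_mul, qInt_mul])

theorem qpow_mul_neg (c : ℂ) : qpow c * qpow (-c) = 1 := by
  rw [← qpow_add, add_neg_cancel, qpow_zero]

theorem qpow_nsmul (c : ℂ) (n : ℕ) : qpow (n * c) = qpow c ^ n := by
  induction n with
  | zero => simp [qpow_zero]
  | succ n ih => rw [pow_succ, ← ih, ← qpow_add]; congr 1; push_cast; ring

section Commuting

variable {A : Type*} [Ring A] [Algebra K A] [IsAdicComplete hIdeal A] {a b : A}

theorem hexp_add (hab : Commute a b) : hexp (a + b) = hexp a * hexp b := by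
  have : hexp (TwoVar.t + TwoVar.s) = hexp TwoVar.t * hexp TwoVar.s := TwoVar.ext_cst fun c d => by
    simp only [map_mul, map_hexp, map_add, TwoVar.ev_t, TwoVar.ev_s]
    rw [← map_add, hexp_cst, hexp_cst, hexp_cst, ← qpow_add, mul_add]
  have := congrArg (TwoVar.subst hab) this
  simpa only [map_mul, map_hexp, map_add, TwoVar.subst_t, TwoVar.subst_s] using this

theorem hexp_mul_hexp_neg (a : A) : hexp a * hexp (-a) = 1 := by
  rw [← hexp_add (Commute.refl a).neg_right, add_neg_cancel, hexp_zero]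

theorem hexp_neg_mul_hexp (a : A) : hexp (-a) * hexp a = 1 := by
  simpa using hexp_mul_hexp_neg (-a)

theorem hexp_smul_one (c : ℂ) : hexp (cst c • (1 : A)) = qpow (2 * c) • (1 : A) := by
  have := map_hexp (Algebra.ofId K A) (cst c)
  rw [hexp_cst, Algebra.ofId_apply, Algebra.ofId_apply, Algebra.algebraMap_eq_smul_one,
    Algebra.algebraMap_eq_smul_one] at this
  exact this.symm

theorem bracket_add (hab : Commute a b) :
    bracket (a + b) = bracket a * hexp (cst (1 / 2) • b) + hexp (cst (-1 / 2) • a) * bracket b := by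
  have : bracket (TwoVar.t + TwoVar.s) = bracket TwoVar.t * hexp (cst (1 / 2) • TwoVar.s) +
      hexp (cst (-1 / 2) • TwoVar.t) * bracket TwoVar.s := TwoVar.ext_cst fun c d => by
    simp only [map_mul, map_hexp, map_bracket, map_add, TwoVar.ev_t, TwoVar.ev_s, map_smul,
      smul_eq_mul]
    rw [← map_add, ← map_mul, ← map_mul, hexp_cst, hexp_cst]
    refine mul_right_cancel₀ q_sub_qi_ne_zero ?_
    rw [add_mul, mul_right_comm, mul_assoc (qpow _), bracket_cst_mul, bracket_cst_mul,
      bracket_cst_mul, sub_mul, mul_sub, ← qpow_add, ← qpow_add, ← qpow_add, ← qpow_add]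
    ring_nf
  have := congrArg (TwoVar.subst hab) this
  simpa only [map_mul, map_hexp, map_bracket, map_add, map_smul, TwoVar.subst_t, TwoVar.subst_s]
    using this

end Commuting

/-! ### Commutators with powers -/

section Powers

variable {S A : Type*} [CommRing S] [Ring A] [Algebra S A] {p c d : S} {a b m m' : A}

/-- In an algebra with `d [a, b] = c (m - m')`, where `m` and `m'` commute with `b` up to
a factor `p`, the commutator of `a` with a power of `b` involves a `p`-integer. -/
theorem smul_mul_pow_sub_pow_mul (hab : d • (a * b - b * a) = c • (m - m'))
    (hm : m * b = p • (b * m)) (hm' : b * m' = p • (m' * b)) (n : ℕ) :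
    d • (a * b ^ (n + 1) - b ^ (n + 1) * a) =
      (c * ∑ i ∈ Finset.range (n + 1), p ^ i) • (b ^ n * m - m' * b ^ n) := by
  have hpow : ∀ n, b ^ n * m' = p ^ n • (m' * b ^ n) := by
    intro n
    induction n with
    | zero => simp
    | succ n ih =>
      rw [pow_succ, mul_assoc, hm', mul_smul_comm, ← mul_assoc, ih, smul_mul_assoc, smul_smul,
        pow_succ', mul_assoc]
  induction n with
  | zero => simpa using hab
  | succ n ih =>
    have e1 : a * b ^ (n + 1 + 1) - b ^ (n + 1 + 1) * a =
        (a * b ^ (n + 1) - b ^ (n + 1) * a) * b + b ^ (n + 1) * (a * b - b * a) := by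
      rw [pow_succ b (n + 1)]; noncomm_ring
    have e2 : b ^ n * m * b = p • (b ^ (n + 1) * m) := by
      rw [mul_assoc, hm, mul_smul_comm, pow_succ, mul_assoc]
    rw [e1, smul_add, ← smul_mul_assoc, ih, ← mul_smul_comm, hab, smul_mul_assoc, sub_mul,
      mul_smul_comm, mul_sub, e2, hpow, mul_assoc, ← pow_succ]
    have h1 := Finset.sum_range_succ (fun i => p ^ i) (n + 1)
    have h2 := geom_sum_succ (x := p) (n := n + 1)
    clear ih e1 e2
    match_scalars
    · linear_combination -c * h2
    · linear_combination c * h1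

/-- The analogue of `smul_mul_pow_sub_pow_mul` for the powers of the other element. -/
theorem smul_pow_mul_sub_mul_pow (hab : d • (a * b - b * a) = c • (m - m'))
    (hm : a * m = p • (m * a)) (hm' : m' * a = p • (a * m')) (n : ℕ) :
    d • (a ^ (n + 1) * b - b * a ^ (n + 1)) =
      (c * ∑ i ∈ Finset.range (n + 1), p ^ i) • (m * a ^ n - a ^ n * m') := by
  have := smul_mul_pow_sub_pow_mul (A := Aᵐᵒᵖ) (p := p) (c := c) (d := d) (a := .op b) (b := .op a)
    (m := .op m) (m' := .op m') (congrArg MulOpposite.op hab) (congrArg MulOpposite.op hm)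
    (congrArg MulOpposite.op hm') n
  exact congrArg MulOpposite.unop this

end Powers

namespace Uh

/-! ### The universal property of `U_h(sl₂)` -/

section Universal

variable {B : Type*} [Ring B] [Algebra K B] [IsAdicComplete hIdeal B]

/-- The homomorphism from the completed free algebra with prescribed values on the generators. -/
def freeLift (f : Gen → B) : Free →ₐ[K] B :=
  Completion.lift (A := FreeAlgebra K Gen) (FreeAlgebra.lift K f)

theorem freeLift_gen (f : Gen → B) (g : Gen) : freeLift f (gen g) = f g := by
  have := Completion.lift_of (FreeAlgebra.lift K f) (FreeAlgebra.ι K g)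
  rw [FreeAlgebra.lift_ι_apply] at this
  exact this

/-- The values on the generators of a homomorphism with given images of `H, x, y`. -/
def genVal (a b c : B) : Gen → B
  | .H => a
  | .x => b
  | .y => c

/-- The homomorphism `U_h(sl₂) → B` given by elements of a complete algebra `B` which satisfy the
defining relations. -/
def lift (a b c : B) (hb : a * b - b * a = 2 * b) (hc : a * c - c * a = -(2 * c))
    (hbc : b * c - c * b = bracket a) : Uh →ₐ[K] B :=
  Completion.lift (A := RingQuot Rel) (RingQuot.liftAlgHom K ⟨freeLift (genVal a b c), by
    rintro u v (_ | _ | _)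
    · simpa only [map_sub, map_mul, map_ofNat, freeLift_gen, genVal] using hb
    · simpa only [map_sub, map_mul, map_neg, map_ofNat, freeLift_gen, genVal] using hc
    · simpa only [map_sub, map_mul, freeLift_gen, map_bracket, genVal] using hbc⟩)

section

variable {a b c : B} (hb : a * b - b * a = 2 * b) (hc : a * c - c * a = -(2 * c))
  (hbc : b * c - c * b = bracket a)

theorem lift_proj (z : Free) : lift a b c hb hc hbc (proj z) = freeLift (genVal a b c) z := by
  have := Completion.lift_of (RingQuot.liftAlgHom K (⟨freeLift (genVal a b c), by
    rintro u v (_ | _ | _)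
    · simpa only [map_sub, map_mul, map_ofNat, freeLift_gen, genVal] using hb
    · simpa only [map_sub, map_mul, map_neg, map_ofNat, freeLift_gen, genVal] using hc
    · simpa only [map_sub, map_mul, freeLift_gen, map_bracket, genVal] using hbc⟩ :
      { f : Free →ₐ[K] B // ∀ ⦃x y⦄, Rel x y → f x = f y })) (RingQuot.mkAlgHom K Rel z)
  rw [RingQuot.liftAlgHom_mkAlgHom_apply] at this
  exact this

theorem lift_H : lift a b c hb hc hbc H = a := by rw [H, lift_proj, freeLift_gen]; rfl

theorem lift_x : lift a b c hb hc hbc x = b := by rw [x, lift_proj, freeLift_gen]; rfl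

theorem lift_y : lift a b c hb hc hbc y = c := by rw [y, lift_proj, freeLift_gen]; rfl

end

/-- Linear maps on `U_h(sl₂)` agree if they agree on `1` and on the generators, and if the set
where they agree is closed under multiplication. -/
theorem linearMap_ext_of_mul {N : Type*} [AddCommGroup N] [Module K N] [IsAdicComplete hIdeal N]
    {f g : Uh →ₗ[K] N} (h1 : f 1 = g 1)
    (hmul : ∀ a b, f a = g a → f b = g b → f (a * b) = g (a * b))
    (hH : f H = g H) (hx : f x = g x) (hy : f y = g y) : f = g := by
  have hfree : f ∘ₗ proj.toLinearMap = g ∘ₗ proj.toLinearMap := by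
    refine Completion.linearMap_ext (A := FreeAlgebra K Gen) fun a => ?_
    change f (proj (Completion.of (FreeAlgebra K Gen) a)) =
      g (proj (Completion.of (FreeAlgebra K Gen) a))
    induction a using FreeAlgebra.induction with
    | grade0 c =>
      have e : proj (Completion.of (FreeAlgebra K Gen) (algebraMap K _ c)) = c • (1 : Uh) := by
        rw [← Algebra.algebraMap_eq_smul_one]
        exact (proj.comp (Completion.of (FreeAlgebra K Gen))).commutes c
      rw [e, map_smul, map_smul, h1]
    | grade1 i =>
      cases i
      · exact hH
      · exact hx
      · exact hy
    | mul a b ha hb =>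
      have e : proj (Completion.of (FreeAlgebra K Gen) (a * b)) =
          proj (Completion.of (FreeAlgebra K Gen) a) *
            proj (Completion.of (FreeAlgebra K Gen) b) :=
        (proj.comp (Completion.of (FreeAlgebra K Gen))).map_mul a b
      rw [e]
      exact hmul _ _ ha hb
    | add a b ha hb =>
      have e : proj (Completion.of (FreeAlgebra K Gen) (a + b)) =
          proj (Completion.of (FreeAlgebra K Gen) a) +
            proj (Completion.of (FreeAlgebra K Gen) b) :=
        (proj.comp (Completion.of (FreeAlgebra K Gen))).map_add a b
      rw [e, map_add, map_add, ha, hb]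
  refine Completion.linearMap_ext (A := RingQuot Rel) fun r => ?_
  obtain ⟨z, rfl⟩ := RingQuot.mkAlgHom_surjective K Rel r
  exact DFunLike.congr_fun hfree z

theorem algHom_ext {f g : Uh →ₐ[K] B} (hH : f H = g H) (hx : f x = g x) (hy : f y = g y) :
    f = g := by
  have := linearMap_ext_of_mul (f := f.toLinearMap) (g := g.toLinearMap) (by simp)
    (fun a b ha hb => by
      simp only [AlgHom.toLinearMap_apply] at ha hb ⊢
      rw [map_mul, map_mul, ha, hb]) hH hx hy
  ext z
  exact DFunLike.congr_fun this z

end Universal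

/-! ### Commutation relations -/

theorem proj_rel {a b : Free} (hab : Rel a b) : proj a = proj b :=
  congrArg (Completion.of (RingQuot Rel)) (RingQuot.mkAlgHom_rel K hab)

theorem H_mul_x : H * x = x * (H + 2) := by
  have := proj_rel Rel.Hx
  simp only [map_sub, map_mul, map_ofNat] at this
  change H * x - x * H = 2 * x at this
  rw [sub_eq_iff_eq_add] at this
  rw [this, mul_add, mul_two, two_mul, add_comm]

theorem H_mul_y : H * y = y * (H - 2) := by
  have := proj_rel Rel.Hy
  simp only [map_sub, map_mul, map_neg, map_ofNat] at this
  change H * y - y * H = -(2 * y) at this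
  rw [sub_eq_iff_eq_add] at this
  rw [this, mul_sub, mul_two, two_mul, neg_add_eq_sub]

theorem x_mul_y : x * y - y * x = bracket H := by
  have := proj_rel Rel.xy
  simp only [map_sub, map_mul, map_bracket] at this
  exact this

/-- The power `kᶜ = e^{chH/4}`, for a complex number `c`. -/
def kpow (c : ℂ) : Uh := hexp (cst (c / 4) • H)

theorem k_eq : k = kpow 1 := rfl

theorem ki_eq : ki = kpow (-1) := rfl

theorem kpow_add (a b : ℂ) : kpow (a + b) = kpow a * kpow b := by
  rw [kpow, kpow, kpow, ← hexp_add ((Commute.refl H).smul_left _ |>.smul_right _), ← add_smul,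
    ← map_add, add_div]

theorem kpow_zero : kpow 0 = 1 := by simp [kpow, hexp_zero]

theorem kpow_mul_neg (a : ℂ) : kpow a * kpow (-a) = 1 := by
  rw [← kpow_add, add_neg_cancel, kpow_zero]

theorem kpow_neg_mul (a : ℂ) : kpow (-a) * kpow a = 1 := by
  rw [← kpow_add, neg_add_cancel, kpow_zero]

theorem kpow_nsmul (c : ℂ) (n : ℕ) : kpow c ^ n = kpow (n * c) := by
  induction n with
  | zero => simp [kpow_zero]
  | succ n ih => rw [pow_succ, ih, ← kpow_add]; congr 1; push_cast; ring

theorem ki_pow (n : ℕ) : ki ^ n = kpow (-n) := by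
  rw [ki_eq, kpow_nsmul, mul_neg_one]

theorem H_commute_kpow (c : ℂ) : Commute H (kpow c) :=
  (hexp_intertwine (a := cst (c / 4) • H) (b := cst (c / 4) • H) (x := H)
    (by rw [smul_mul_assoc, mul_smul_comm])).symm

theorem hexp_weight {A : Type*} [Ring A] [Algebra K A] [IsAdicComplete hIdeal A] {a z : A} {w : ℂ}
    (hz : a * z = z * (a + cst w • 1)) (c : ℂ) :
    hexp (cst c • a) * z = qpow (2 * c * w) • (z * hexp (cst c • a)) := by
  rw [hexp_intertwine (b := cst c • a + cst (c * w) • 1), hexp_add, hexp_smul_one,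
    mul_smul_comm, mul_one, mul_smul_comm, mul_assoc]
  · exact (Commute.one_right _).smul_right _
  · rw [smul_mul_assoc, hz, show cst (c * w) = cst c * cst w from map_mul _ _ _, mul_smul,
      ← smul_add, mul_smul_comm]

/-- Commutation of `k^c` with an element of weight `w`: the relation `H z - z H = w z` is written
as `H z = z (H + w)`. -/
theorem kpow_weight {z : Uh} {w : ℂ} (hz : H * z = z * (H + cst w • 1)) (c : ℂ) :
    kpow c * z = qpow (c * w / 2) • (z * kpow c) := by
  rw [kpow, hexp_weight hz]
  congr 2
  ring

theorem cst_two_smul : cst 2 • (1 : Uh) = 2 := by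
  rw [← Algebra.algebraMap_eq_smul_one, cst, map_ofNat, map_ofNat]

theorem H_weight_x : H * x = x * (H + cst 2 • 1) := by rw [cst_two_smul, H_mul_x]

theorem H_weight_y : H * y = y * (H + cst (-2) • 1) := by
  rw [cst, map_neg, neg_smul, cst_two_smul, H_mul_y, sub_eq_add_neg]

theorem kpow_mul_x (c : ℂ) : kpow c * x = qpow c • (x * kpow c) := by
  rw [kpow_weight H_weight_x]; congr 2; ring

theorem kpow_mul_y (c : ℂ) : kpow c * y = qpow (-c) • (y * kpow c) := by
  rw [kpow_weight H_weight_y]; congr 2; ring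

/-- The element `e = k x`. -/
def e : Uh := k * x

/-- The element `f = k⁻¹ y`. -/
def f : Uh := ki * y

theorem H_weight_e : H * e = e * (H + cst 2 • 1) := by
  rw [e, ← mul_assoc, k_eq, (H_commute_kpow 1).eq, mul_assoc, H_weight_x, mul_assoc]

theorem H_weight_f : H * f = f * (H + cst (-2) • 1) := by
  rw [f, ← mul_assoc, ki_eq, (H_commute_kpow _).eq, mul_assoc, H_weight_y, mul_assoc]

theorem kpow_mul_e (c : ℂ) : kpow c * e = qpow c • (e * kpow c) := by
  rw [kpow_weight H_weight_e]; congr 2; ring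

theorem kpow_mul_f (c : ℂ) : kpow c * f = qpow (-c) • (f * kpow c) := by
  rw [kpow_weight H_weight_f]; congr 2; ring

theorem mul_kpow {z : Uh} {w : ℂ} {c : ℂ} (hz : kpow c * z = qpow w • (z * kpow c)) :
    z * kpow c = qpow (-w) • (kpow c * z) := by
  rw [hz, smul_smul, mul_comm, qpow_mul_neg, one_smul]

theorem e_mul_kpow (c : ℂ) : e * kpow c = qpow (-c) • (kpow c * e) := mul_kpow (kpow_mul_e c)

theorem f_mul_kpow (c : ℂ) : f * kpow c = qpow c • (kpow c * f) := by
  have := mul_kpow (kpow_mul_f c)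
  rwa [neg_neg] at this

theorem x_eq : x = kpow (-1) * e := by
  rw [e, k_eq, ← mul_assoc, kpow_neg_mul, one_mul]

theorem y_eq : y = kpow 1 * f := by
  rw [f, ki_eq, ← mul_assoc, kpow_mul_neg, one_mul]

theorem e_mul_f : e * f - f * e = q • bracket H := by
  rw [← x_mul_y, e, f, k_eq, ki_eq]
  have h1 : kpow 1 * x * (kpow (-1) * y) = q • (x * y) := by
    rw [kpow_mul_x, smul_mul_assoc, mul_assoc, ← mul_assoc (kpow 1), kpow_mul_neg, one_mul]; rfl
  have h2 : kpow (-1) * y * (kpow 1 * x) = q • (y * x) := by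
    rw [kpow_mul_y, smul_mul_assoc, mul_assoc, ← mul_assoc (kpow (-1)), kpow_neg_mul, one_mul,
      neg_neg]; rfl
  rw [h1, h2, smul_sub]

theorem bracket_H_spec : (q - qi) • bracket H = kpow 2 - kpow (-2) := by
  rw [bracket_spec, kpow, kpow]
  norm_num

theorem e_mul_f_spec : (q - qi) • (e * f - f * e) = q • (kpow 2 - kpow (-2)) := by
  rw [e_mul_f, smul_comm, bracket_H_spec]

/-- The scalar `1 + p + ⋯ + pⁿ⁻¹`, for `p = q⁻²`. -/
def pInt (n : ℕ) : K := ∑ i ∈ Finset.range n, qpow (-2) ^ i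

theorem qInt_succ (n : ℕ) : qInt (n + 1) = qpow n * pInt (n + 1) := by
  rw [qInt, pInt, Finset.mul_sum]
  refine Finset.sum_congr rfl fun i _ => ?_
  rw [← qpow_nsmul, ← qpow_add]
  congr 1
  push_cast
  ring

theorem qInt_succ_mul_inv (n : ℕ) : qInt (n + 1) * (qFact (n + 1))⁻¹ = (qFact n)⁻¹ := by
  have h1 := qFact_mul_inv n
  have h2 := qFact_mul_inv (n + 1)
  have h3 : qFact (n + 1) = qFact n * qInt (n + 1) := Finset.prod_range_succ _ _
  refine mul_left_cancel₀ (left_ne_zero_of_mul_eq_one h1) ?_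
  rw [h1, ← mul_assoc, ← h3, h2]

theorem coeffR_succ (n : ℕ) : coeffR (n + 1) * pInt (n + 1) = coeffR n * ((q - qi) * qi) := by
  have h1 := qInt_succ_mul_inv n
  rw [qInt_succ] at h1
  rw [coeffR, coeffR, ← h1]
  have h2 : qpow (((n + 1 : ℕ) : ℂ) * ((n + 1 : ℕ) - 3) / 2) =
      qpow n * qpow ((n : ℂ) * (n - 3) / 2) * qi := by
    rw [qi, ← qpow_add, ← qpow_add]
    congr 1
    push_cast
    ring
  rw [h2]
  ring

theorem e_mul_f_pow (n : ℕ) : (q - qi) • (e * f ^ (n + 1) - f ^ (n + 1) * e) =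
    (q * pInt (n + 1)) • (f ^ n * kpow 2 - kpow (-2) * f ^ n) :=
  smul_mul_pow_sub_pow_mul e_mul_f_spec (kpow_mul_f 2) (f_mul_kpow (-2)) n

theorem e_pow_mul_f (n : ℕ) : (q - qi) • (e ^ (n + 1) * f - f * e ^ (n + 1)) =
    (q * pInt (n + 1)) • (kpow 2 * e ^ n - e ^ n * kpow (-2)) :=
  smul_pow_mul_sub_mul_pow e_mul_f_spec (e_mul_kpow 2) (kpow_mul_e (-2)) n

theorem smul_of_q_sub_qi_smul {M : Type*} [AddCommGroup M] [Module K M] {a b : M} {n : ℕ}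
    (hab : (q - qi) • a = (q * pInt (n + 1)) • b) : coeffR (n + 1) • a = coeffR n • b := by
  obtain ⟨g, hg⟩ : ∃ g, coeffR (n + 1) = g * (q - qi) :=
    ⟨(q - qi) ^ n * (qFact (n + 1))⁻¹ * qpow (((n + 1 : ℕ) : ℂ) * ((n + 1 : ℕ) - 3) / 2), by
      rw [coeffR, pow_succ]; ring⟩
  have h1 := coeffR_succ n
  have h2 : g * (q * pInt (n + 1)) = coeffR n := by
    refine mul_left_cancel₀ q_sub_qi_ne_zero ?_
    rw [hg] at h1
    linear_combination q * h1 + coeffR n * (q - qi) * q_mul_qi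
  rw [hg, mul_smul, hab, smul_smul, h2]

/-- The recursion for the coefficients of `R` which makes the commutator of `1 ⊗ e` with
`∑ cₙ eⁿ ⊗ fⁿ` telescope. -/
theorem coeffR_smul_e_mul_f_pow (n : ℕ) : coeffR (n + 1) • (e * f ^ (n + 1) - f ^ (n + 1) * e) =
    coeffR n • (f ^ n * kpow 2 - kpow (-2) * f ^ n) :=
  smul_of_q_sub_qi_smul (e_mul_f_pow n)

theorem coeffR_smul_e_pow_mul_f (n : ℕ) : coeffR (n + 1) • (e ^ (n + 1) * f - f * e ^ (n + 1)) =
    coeffR n • (kpow 2 * e ^ n - e ^ n * kpow (-2)) :=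
  smul_of_q_sub_qi_smul (e_pow_mul_f n)

end Uh

/-! ### Maps on completed tensor powers -/

section Tensor

variable {A : Type*} [Ring A] [Algebra K A]

theorem ten_mul (a b c d : A) : ten a b * ten c d = ten (a * c) (b * d) := by
  rw [ten, ten, ten, ← map_mul, Algebra.TensorProduct.tmul_mul_tmul]

theorem ten_one : ten (1 : A) 1 = 1 := map_one (Completion.of (A ⊗[K] A))

theorem ten_add_left (a b c : A) : ten (a + b) c = ten a c + ten b c := by
  rw [ten, TensorProduct.add_tmul, map_add]; rfl

theorem ten_add_right (a b c : A) : ten a (b + c) = ten a b + ten a c := by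
  rw [ten, TensorProduct.tmul_add, map_add]; rfl

theorem ten_smul_left (c : K) (a b : A) : ten (c • a) b = c • ten a b := by
  rw [ten, ← TensorProduct.smul_tmul', map_smul]; rfl

theorem ten_smul_right (c : K) (a b : A) : ten a (c • b) = c • ten a b := by
  rw [ten, TensorProduct.tmul_smul, map_smul]; rfl

theorem ten_neg_left (a b : A) : ten (-a) b = -ten a b := by
  rw [ten, TensorProduct.neg_tmul, map_neg]; rfl

theorem ten_neg_right (a b : A) : ten a (-b) = -ten a b := by
  rw [ten, TensorProduct.tmul_neg, map_neg]; rfl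

theorem ten_sub_left (a b c : A) : ten (a - b) c = ten a c - ten b c := by
  rw [sub_eq_add_neg, ten_add_left, ten_neg_left, sub_eq_add_neg]

theorem ten_sub_right (a b c : A) : ten a (b - c) = ten a b - ten a c := by
  rw [sub_eq_add_neg, ten_add_right, ten_neg_right, sub_eq_add_neg]

theorem ten_pow (a b : A) (n : ℕ) : ten a b ^ n = ten (a ^ n) (b ^ n) := by
  rw [ten, ten, ← map_pow, Algebra.TensorProduct.tmul_pow]

/-- The homomorphism `a ↦ a ⊗ 1` into the completed tensor square. -/
def inl : A →ₐ[K] CT2 A := (Completion.of (A ⊗[K] A)).comp Algebra.TensorProduct.includeLeft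

/-- The homomorphism `a ↦ 1 ⊗ a` into the completed tensor square. -/
def inr : A →ₐ[K] CT2 A := (Completion.of (A ⊗[K] A)).comp Algebra.TensorProduct.includeRight

theorem inl_apply (a : A) : inl a = ten a 1 := rfl

theorem inr_apply (a : A) : inr a = ten 1 a := rfl

theorem ten_linearMap_ext {N : Type*} [AddCommGroup N] [Module K N] [IsAdicComplete hIdeal N]
    {f g : CT2 A →ₗ[K] N} (hfg : ∀ a b, f (ten a b) = g (ten a b)) (z : CT2 A) : f z = g z :=
  DFunLike.congr_fun (Completion.linearMap_ext_tensor hfg) z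

/-- The element `a ⊗ b ⊗ c` of the completed tensor cube. -/
def ten3 (a b c : A) : CT3 A := Completion.of _ ((a ⊗ₜ[K] b) ⊗ₜ[K] c)

theorem ten3_mul (a b c a' b' c' : A) :
    ten3 a b c * ten3 a' b' c' = ten3 (a * a') (b * b') (c * c') := by
  rw [ten3, ten3, ten3, ← map_mul, Algebra.TensorProduct.tmul_mul_tmul,
    Algebra.TensorProduct.tmul_mul_tmul]

theorem ten3_one : ten3 (1 : A) 1 1 = 1 := map_one (Completion.of ((A ⊗[K] A) ⊗[K] A))

theorem leg12_ten (a b : A) : leg12 (ten a b) = ten3 a b 1 := Completion.map_of _ _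

theorem leg13_ten (a b : A) : leg13 (ten a b) = ten3 a 1 b := Completion.map_of _ _

theorem leg23_ten (a b : A) : leg23 (ten a b) = ten3 1 a b := Completion.map_of _ _

theorem twist_ten (a b : A) : twist (ten a b) = ten b a := Completion.map_of _ _

section Lift

variable {B : Type*} [Ring B] [Algebra K B] [IsAdicComplete hIdeal B]

/-- The homomorphism `a ⊗ b ↦ f(a) g(b)` on the completed tensor square, for homomorphisms `f, g`
with commuting values. -/
def tenLift (f g : A →ₐ[K] B) (hfg : ∀ a b, Commute (f a) (g b)) : CT2 A →ₐ[K] B :=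
  Completion.lift (Algebra.TensorProduct.lift f g hfg)

theorem tenLift_ten (f g : A →ₐ[K] B) (hfg : ∀ a b, Commute (f a) (g b)) (a b : A) :
    tenLift f g hfg (ten a b) = f a * g b := by
  rw [tenLift, ten, Completion.lift_of, Algebra.TensorProduct.lift_tmul]

end Lift

theorem leg12_commute (z : CT2 A) (c : A) : Commute (leg12 z) (ten3 1 1 c) :=
  ten_linearMap_ext (f := LinearMap.mulRight K (ten3 1 1 c) ∘ₗ leg12.toLinearMap)
    (g := LinearMap.mulLeft K (ten3 1 1 c) ∘ₗ leg12.toLinearMap)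
    (fun a b => by simp [leg12_ten, ten3_mul]) z

theorem leg23_commute (a : A) (z : CT2 A) : Commute (ten3 a 1 1) (leg23 z) :=
  ten_linearMap_ext (f := LinearMap.mulLeft K (ten3 a 1 1) ∘ₗ leg23.toLinearMap)
    (g := LinearMap.mulRight K (ten3 a 1 1) ∘ₗ leg23.toLinearMap)
    (fun a b => by simp [leg23_ten, ten3_mul]) z

theorem tensorId_ten (Δ : A →ₗ[K] CT2 A) (a b : A) :
    tensorId Δ (ten a b) = leg12 (Δ a) * ten3 1 1 b := by
  rw [tensorId, ten, Completion.extend_of]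
  rfl

theorem idTensor_ten (Δ : A →ₗ[K] CT2 A) (a b : A) :
    idTensor Δ (ten a b) = ten3 a 1 1 * leg23 (Δ b) := by
  rw [idTensor, ten, Completion.extend_of]
  rfl

/-- The homomorphism `Δ ⊗ id`. -/
def tensorIdHom (Δ : A →ₐ[K] CT2 A) : CT2 A →ₐ[K] CT3 A :=
  tenLift (leg12.comp Δ) ((Completion.of _).comp leg3) fun a b => leg12_commute (Δ a) b

/-- The homomorphism `id ⊗ Δ`. -/
def idTensorHom (Δ : A →ₐ[K] CT2 A) : CT2 A →ₐ[K] CT3 A :=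
  tenLift ((Completion.of _).comp leg1) (leg23.comp Δ) fun a b => leg23_commute a (Δ b)

theorem tensorIdHom_ten (Δ : A →ₐ[K] CT2 A) (a b : A) :
    tensorIdHom Δ (ten a b) = leg12 (Δ a) * ten3 1 1 b :=
  tenLift_ten _ _ _ a b

theorem idTensorHom_ten (Δ : A →ₐ[K] CT2 A) (a b : A) :
    idTensorHom Δ (ten a b) = ten3 a 1 1 * leg23 (Δ b) :=
  tenLift_ten _ _ _ a b

theorem tensorId_apply (Δ : A →ₐ[K] CT2 A) (z : CT2 A) :
    tensorId Δ.toLinearMap z = tensorIdHom Δ z :=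
  ten_linearMap_ext (f := tensorId Δ.toLinearMap) (g := (tensorIdHom Δ).toLinearMap)
    (fun a b => (tensorId_ten _ a b).trans (tensorIdHom_ten Δ a b).symm) z

theorem idTensor_apply (Δ : A →ₐ[K] CT2 A) (z : CT2 A) :
    idTensor Δ.toLinearMap z = idTensorHom Δ z :=
  ten_linearMap_ext (f := idTensor Δ.toLinearMap) (g := (idTensorHom Δ).toLinearMap)
    (fun a b => (idTensor_ten _ a b).trans (idTensorHom_ten Δ a b).symm) z

/-- The linear map underlying an algebra anti-homomorphism. -/
def unopLin (S : A →ₐ[K] Aᵐᵒᵖ) : A →ₗ[K] A :=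
  (MulOpposite.opLinearEquiv K).symm.toLinearMap ∘ₗ S.toLinearMap

theorem unopLin_apply (S : A →ₐ[K] Aᵐᵒᵖ) (a : A) : unopLin S a = (S a).unop := rfl

theorem unopLin_mul (S : A →ₐ[K] Aᵐᵒᵖ) (a b : A) :
    unopLin S (a * b) = unopLin S b * unopLin S a := by
  simp [unopLin_apply]

theorem unopLin_one (S : A →ₐ[K] Aᵐᵒᵖ) : unopLin S 1 = 1 := by
  simp [unopLin_apply]

section MulMap

variable [IsAdicComplete hIdeal A]

theorem mulMap_ten (f g : A →ₗ[K] A) (a b : A) : mulMap f g (ten a b) = f a * g b := by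
  rw [mulMap, ten, Completion.extend_of]
  rfl

/-- For a character `ε`, the homomorphism `ε ⊗ id`. -/
def characterLeft (ε : A →ₐ[K] K) : CT2 A →ₐ[K] A :=
  tenLift ((Algebra.ofId K A).comp ε) (AlgHom.id K A)
    fun _ _ => Algebra.commute_algebraMap_left _ _

/-- For a character `ε`, the homomorphism `id ⊗ ε`. -/
def characterRight (ε : A →ₐ[K] K) : CT2 A →ₐ[K] A :=
  tenLift (AlgHom.id K A) ((Algebra.ofId K A).comp ε)
    fun _ _ => Algebra.commute_algebraMap_right _ _

theorem characterLeft_ten (ε : A →ₐ[K] K) (a b : A) : characterLeft ε (ten a b) = ε a • b := by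
  rw [Algebra.smul_def]
  exact tenLift_ten _ _ _ a b

theorem characterRight_ten (ε : A →ₐ[K] K) (a b : A) : characterRight ε (ten a b) = ε b • a := by
  rw [Algebra.smul_def, Algebra.commutes]
  exact tenLift_ten _ _ _ a b

theorem mulMap_character_left (ε : A →ₐ[K] K) (z : CT2 A) :
    mulMap ((Algebra.linearMap K A) ∘ₗ ε.toLinearMap) LinearMap.id z = characterLeft ε z :=
  ten_linearMap_ext (f := mulMap _ _) (g := (characterLeft ε).toLinearMap) (fun a b => by
    rw [mulMap_ten, AlgHom.toLinearMap_apply, characterLeft_ten, Algebra.smul_def]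
    rfl) z

theorem mulMap_character_right (ε : A →ₐ[K] K) (z : CT2 A) :
    mulMap LinearMap.id ((Algebra.linearMap K A) ∘ₗ ε.toLinearMap) z = characterRight ε z :=
  ten_linearMap_ext (f := mulMap _ _) (g := (characterRight ε).toLinearMap) (fun a b => by
    rw [mulMap_ten, AlgHom.toLinearMap_apply, characterRight_ten, Algebra.smul_def,
      Algebra.commutes]
    rfl) z

theorem mulMap_left_mul_ten (S : A →ₐ[K] Aᵐᵒᵖ) (z : CT2 A) (a b : A) :
    mulMap (unopLin S) LinearMap.id (z * ten a b) =
      unopLin S a * mulMap (unopLin S) LinearMap.id z * b :=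
  ten_linearMap_ext (f := mulMap (unopLin S) LinearMap.id ∘ₗ LinearMap.mulRight K (ten a b))
    (g := LinearMap.mulRight K b ∘ₗ LinearMap.mulLeft K (unopLin S a) ∘ₗ
      mulMap (unopLin S) LinearMap.id)
    (fun c d => by simp [ten_mul, mulMap_ten, unopLin_mul, mul_assoc]) z

theorem mulMap_right_ten_mul (S : A →ₐ[K] Aᵐᵒᵖ) (z : CT2 A) (a b : A) :
    mulMap LinearMap.id (unopLin S) (ten a b * z) =
      a * mulMap LinearMap.id (unopLin S) z * unopLin S b :=
  ten_linearMap_ext (f := mulMap LinearMap.id (unopLin S) ∘ₗ LinearMap.mulLeft K (ten a b))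
    (g := LinearMap.mulRight K (unopLin S b) ∘ₗ LinearMap.mulLeft K a ∘ₗ
      mulMap LinearMap.id (unopLin S))
    (fun c d => by simp [ten_mul, mulMap_ten, unopLin_mul, mul_assoc]) z

/-- If `m (S ⊗ id)` takes a scalar value `c` at `z`, then it takes the value at `z w` which is `c`
times that at `w`: the factor arising from `z` stands in the middle of the product and can be
moved out. This makes the antipode axiom multiplicative. -/
theorem mulMap_left_mul (S : A →ₐ[K] Aᵐᵒᵖ) {z : CT2 A} {c : K}
    (hz : mulMap (unopLin S) LinearMap.id z = algebraMap K A c) (w : CT2 A) :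
    mulMap (unopLin S) LinearMap.id (z * w) = c • mulMap (unopLin S) LinearMap.id w :=
  ten_linearMap_ext (f := mulMap (unopLin S) LinearMap.id ∘ₗ LinearMap.mulLeft K z)
    (g := c • mulMap (unopLin S) LinearMap.id)
    (fun a b => by
      simp [mulMap_left_mul_ten, hz, mulMap_ten, Algebra.algebraMap_eq_smul_one]) w

theorem mulMap_right_mul (S : A →ₐ[K] Aᵐᵒᵖ) {w : CT2 A} {c : K}
    (hw : mulMap LinearMap.id (unopLin S) w = algebraMap K A c) (z : CT2 A) :
    mulMap LinearMap.id (unopLin S) (z * w) = c • mulMap LinearMap.id (unopLin S) z :=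
  ten_linearMap_ext (f := mulMap LinearMap.id (unopLin S) ∘ₗ LinearMap.mulRight K w)
    (g := c • mulMap LinearMap.id (unopLin S))
    (fun a b => by
      simp [mulMap_right_ten_mul, hw, mulMap_ten, Algebra.algebraMap_eq_smul_one]) z

end MulMap

end Tensor

namespace Uh

/-! ### The Hopf algebra structure -/

theorem inl_kpow (c : ℂ) : hexp (cst (c / 4) • ten H 1) = ten (kpow c) 1 := by
  rw [← inl_apply, ← inl_apply, kpow, map_hexp, map_smul]

theorem inr_kpow (c : ℂ) : hexp (cst (c / 4) • ten 1 H) = ten 1 (kpow c) := by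
  rw [← inr_apply, ← inr_apply, kpow, map_hexp, map_smul]

theorem commute_H_H : Commute (ten H 1) (ten 1 H) := by
  rw [Commute, SemiconjBy, ten_mul, ten_mul, one_mul, mul_one]

theorem comul_bracket : bracket (ten H 1 + ten 1 H) =
    ten (bracket H) (kpow 2) + ten (kpow (-2)) (bracket H) := by
  rw [bracket_add commute_H_H, ← inl_apply H, ← map_bracket, ← inr_apply H, ← map_bracket,
    inl_apply, inl_apply, inr_apply, inr_apply]
  have h1 := inr_kpow 2
  have h2 := inl_kpow (-2)
  norm_num at h1 h2 ⊢
  rw [h1, h2, ten_mul, ten_mul, one_mul, mul_one, mul_one, one_mul]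

/-- If `H z - z H = w z`, then `z ⊗ kᶜ + kᵈ ⊗ z` has weight `w` for the coproduct of `H`. -/
theorem comul_weight {z : Uh} {w : K} (hz : H * z - z * H = w • z) (c d : ℂ) :
    (ten H 1 + ten 1 H) * (ten z (kpow c) + ten (kpow d) z) -
      (ten z (kpow c) + ten (kpow d) z) * (ten H 1 + ten 1 H) =
      w • (ten z (kpow c) + ten (kpow d) z) := by
  simp only [add_mul, mul_add, ten_mul, one_mul, mul_one, (H_commute_kpow _).eq]
  rw [smul_add, ← ten_smul_left, ← ten_smul_right, ← hz, ten_sub_left, ten_sub_right]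
  abel

theorem H_comm_x : H * x - x * H = (2 : K) • x := by
  rw [H_mul_x, mul_add, add_sub_cancel_left, mul_two, two_smul]

theorem H_comm_y : H * y - y * H = (-2 : K) • y := by
  rw [H_mul_y, mul_sub, sub_sub_cancel_left, mul_two, neg_smul, two_smul]

/-- The coproduct of `U_h(sl₂)`. -/
def comulHom : Uh →ₐ[K] CT2 Uh :=
  lift (ten H 1 + ten 1 H) (ten x (kpow 1) + ten (kpow (-1)) x) (ten y (kpow 1) + ten (kpow (-1)) y)
    (by rw [comul_weight H_comm_x, two_smul, two_mul])
    (by rw [comul_weight H_comm_y, neg_smul, two_smul, two_mul])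
    (by
      rw [comul_bracket, ← x_mul_y, ten_sub_left, ten_sub_right]
      simp only [add_mul, mul_add, ten_mul, kpow_mul_x, kpow_mul_y, ← kpow_add, ten_smul_left,
        ten_smul_right]
      norm_num [qpow_zero]
      abel)

theorem comulHom_H : comulHom H = ten H 1 + ten 1 H := lift_H _ _ _

theorem comulHom_x : comulHom x = ten x (kpow 1) + ten (kpow (-1)) x := lift_x _ _ _

theorem comulHom_y : comulHom y = ten y (kpow 1) + ten (kpow (-1)) y := lift_y _ _ _

/-- The counit of `U_h(sl₂)`. -/
def counitHom : Uh →ₐ[K] K :=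
  lift 0 0 0 (by simp) (by simp) (by simp [bracket_zero])

theorem counitHom_H : counitHom H = 0 := lift_H _ _ _

theorem counitHom_x : counitHom x = 0 := lift_x _ _ _

theorem counitHom_y : counitHom y = 0 := lift_y _ _ _

theorem op_bracket {A : Type*} [Ring A] [Algebra K A] [IsAdicComplete hIdeal A] (a : A) :
    MulOpposite.op (bracket a) = bracket (MulOpposite.op a) :=
  (((bracket_hasAdicSum a).map (MulOpposite.opLinearEquiv K).toLinearMap).congr
    fun n => by simp).unique (bracket_hasAdicSum _)

theorem op_hexp {A : Type*} [Ring A] [Algebra K A] [IsAdicComplete hIdeal A] (a : A) :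
    MulOpposite.op (hexp a) = hexp (MulOpposite.op a) :=
  (((hexp_hasAdicSum a).map (MulOpposite.opLinearEquiv K).toLinearMap).congr
    fun n => by simp).unique (hexp_hasAdicSum _)

/-- The antipode of `U_h(sl₂)`. -/
def antipodeHom : Uh →ₐ[K] Uhᵐᵒᵖ :=
  lift (.op (-H)) (.op (-(q • x))) (.op (-(qi • y)))
    (by
      apply MulOpposite.unop_injective
      have := H_comm_x
      rw [sub_eq_iff_eq_add] at this
      simp [this, two_mul, two_smul])
    (by
      apply MulOpposite.unop_injective
      have := H_comm_y
      rw [sub_eq_iff_eq_add] at this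
      simp [this, two_mul, two_smul])
    (by
      rw [← op_bracket, bracket_neg, ← x_mul_y]
      apply MulOpposite.unop_injective
      simp [smul_smul, q_mul_qi, mul_comm qi q])

theorem antipodeHom_H : unopLin antipodeHom H = -H :=
  congrArg MulOpposite.unop (show antipodeHom H = .op (-H) from lift_H _ _ _)

theorem antipodeHom_x : unopLin antipodeHom x = -(q • x) :=
  congrArg MulOpposite.unop (show antipodeHom x = .op (-(q • x)) from lift_x _ _ _)

theorem antipodeHom_y : unopLin antipodeHom y = -(qi • y) :=
  congrArg MulOpposite.unop (show antipodeHom y = .op (-(qi • y)) from lift_y _ _ _)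

theorem map_kpow_of_map_H {Δ : Uh →ₐ[K] CT2 Uh} (hΔ : Δ H = ten H 1 + ten 1 H) (c : ℂ) :
    Δ (kpow c) = ten (kpow c) (kpow c) := by
  rw [kpow, map_hexp, map_smul, hΔ, smul_add,
    hexp_add ((commute_H_H.smul_left _).smul_right _), inl_kpow, inr_kpow, ten_mul, mul_one,
    one_mul]
  rfl

theorem character_kpow {ε : Uh →ₐ[K] K} (hε : ε H = 0) (c : ℂ) : ε (kpow c) = 1 := by
  rw [kpow, map_hexp, map_smul, hε, smul_zero, hexp_zero]

theorem anti_kpow {S : Uh →ₐ[K] Uhᵐᵒᵖ} (hS : unopLin S H = -H) (c : ℂ) :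
    unopLin S (kpow c) = kpow (-c) := by
  have h1 : S H = .op (-H) := MulOpposite.unop_injective hS
  rw [unopLin_apply, kpow, map_hexp, map_smul, h1, ← MulOpposite.op_smul, ← op_hexp,
    MulOpposite.unop_op, kpow, smul_neg, neg_div, cst, cst, map_neg, neg_smul]

theorem comulHom_coassoc (a : Uh) :
    tensorIdHom comulHom (comulHom a) = idTensorHom comulHom (comulHom a) := by
  have : (tensorIdHom comulHom).comp comulHom = (idTensorHom comulHom).comp comulHom := by
    apply algHom_ext <;>
    simp only [AlgHom.comp_apply, comulHom_H, comulHom_x, comulHom_y, map_add, tensorIdHom_ten,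
      idTensorHom_ten, map_one, leg12_ten, leg23_ten, map_kpow_of_map_H comulHom_H, ten3_mul,
      add_mul, mul_add, one_mul, mul_one, ten3_one] <;>
    abel
  exact DFunLike.congr_fun this a

theorem comulHom_counit_left (a : Uh) : characterLeft counitHom (comulHom a) = a := by
  have : (characterLeft counitHom).comp comulHom = AlgHom.id K Uh := by
    apply algHom_ext <;>
    simp [comulHom_H, comulHom_x, comulHom_y, characterLeft_ten, counitHom_H, counitHom_x,
      counitHom_y, character_kpow counitHom_H]
  exact DFunLike.congr_fun this a

theorem comulHom_counit_right (a : Uh) : characterRight counitHom (comulHom a) = a := by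
  have : (characterRight counitHom).comp comulHom = AlgHom.id K Uh := by
    apply algHom_ext <;>
    simp [comulHom_H, comulHom_x, comulHom_y, characterRight_ten, counitHom_H, counitHom_x,
      counitHom_y, character_kpow counitHom_H]
  exact DFunLike.congr_fun this a

theorem x_mul_kpow (c : ℂ) : x * kpow c = qpow (-c) • (kpow c * x) := mul_kpow (kpow_mul_x c)

theorem y_mul_kpow (c : ℂ) : y * kpow c = qpow c • (kpow c * y) := by
  have := mul_kpow (kpow_mul_y c)
  rwa [neg_neg] at this

theorem comulHom_antipode_left (a : Uh) :
    mulMap (unopLin antipodeHom) LinearMap.id (comulHom a) = algebraMap K Uh (counitHom a) := by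
  refine DFunLike.congr_fun (linearMap_ext_of_mul
    (f := mulMap (unopLin antipodeHom) LinearMap.id ∘ₗ comulHom.toLinearMap)
    (g := Algebra.linearMap K Uh ∘ₗ counitHom.toLinearMap) ?_ (fun a b ha hb => ?_) ?_ ?_ ?_) a
  · simp [← ten_one, mulMap_ten, unopLin_one]
  · simp only [LinearMap.comp_apply, AlgHom.toLinearMap_apply, Algebra.linearMap_apply, map_mul]
      at ha hb ⊢
    rw [mulMap_left_mul _ ha, hb, Algebra.smul_def]
  · simp [comulHom_H, mulMap_ten, unopLin_one, antipodeHom_H, counitHom_H]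
  · simp [comulHom_x, mulMap_ten, antipodeHom_x, counitHom_x, anti_kpow antipodeHom_H, kpow_mul_x]
    simp [q]
  · simp [comulHom_y, mulMap_ten, antipodeHom_y, counitHom_y, anti_kpow antipodeHom_H, kpow_mul_y]
    simp [qi]

theorem comulHom_antipode_right (a : Uh) :
    mulMap LinearMap.id (unopLin antipodeHom) (comulHom a) = algebraMap K Uh (counitHom a) := by
  refine DFunLike.congr_fun (linearMap_ext_of_mul
    (f := mulMap LinearMap.id (unopLin antipodeHom) ∘ₗ comulHom.toLinearMap)
    (g := Algebra.linearMap K Uh ∘ₗ counitHom.toLinearMap) ?_ (fun a b ha hb => ?_) ?_ ?_ ?_) a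
  · simp [← ten_one, mulMap_ten, unopLin_one]
  · simp only [LinearMap.comp_apply, AlgHom.toLinearMap_apply, Algebra.linearMap_apply, map_mul]
      at ha hb ⊢
    rw [mulMap_right_mul _ hb, ha, Algebra.smul_def, Algebra.commutes]
  · simp [comulHom_H, mulMap_ten, unopLin_one, antipodeHom_H, counitHom_H]
  · simp [comulHom_x, mulMap_ten, antipodeHom_x, counitHom_x, anti_kpow antipodeHom_H, kpow_mul_x]
    simp [q, smul_smul, ← qpow_add, qpow_zero]
  · simp [comulHom_y, mulMap_ten, antipodeHom_y, counitHom_y, anti_kpow antipodeHom_H, kpow_mul_y]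
    simp [qi, smul_smul, ← qpow_add, qpow_zero]

/-- The standard Hopf algebra structure on `U_h(sl₂)`. -/
def hopf : HopfStructure Uh where
  comul := comulHom
  counit := counitHom
  antipodeOp := antipodeHom
  coassoc a := by rw [tensorId_apply, idTensor_apply]; exact comulHom_coassoc a
  counit_left a := by rw [mulMap_character_left]; exact comulHom_counit_left a
  counit_right a := by rw [mulMap_character_right]; exact comulHom_counit_right a
  antipode_left := comulHom_antipode_left
  antipode_right := comulHom_antipode_right

theorem hopf_isStandard : IsStandard hopf where
  comul_x := comulHom_x
  comul_y := comulHom_y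
  comul_H := comulHom_H
  counit_x := counitHom_x
  counit_y := counitHom_y
  counit_H := counitHom_H
  antipode_x := antipodeHom_x
  antipode_y := antipodeHom_y
  antipode_H := antipodeHom_H

theorem IsStandard.eq_hopf {𝓗 : HopfStructure Uh} (h𝓗 : IsStandard 𝓗) : 𝓗 = hopf := by
  refine HopfStructure.ext (algHom_ext ?_ ?_ ?_) (algHom_ext ?_ ?_ ?_) (algHom_ext ?_ ?_ ?_)
  · exact h𝓗.comul_H.trans comulHom_H.symm
  · exact h𝓗.comul_x.trans comulHom_x.symm
  · exact h𝓗.comul_y.trans comulHom_y.symm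
  · exact h𝓗.counit_H.trans counitHom_H.symm
  · exact h𝓗.counit_x.trans counitHom_x.symm
  · exact h𝓗.counit_y.trans counitHom_y.symm
  · exact MulOpposite.unop_injective (h𝓗.antipode_H.trans antipodeHom_H.symm)
  · exact MulOpposite.unop_injective (h𝓗.antipode_x.trans antipodeHom_x.symm)
  · exact MulOpposite.unop_injective (h𝓗.antipode_y.trans antipodeHom_y.symm)

/-! ### The `q`-exponential series -/

theorem pInt_add (i j : ℕ) : pInt (i + j) = qpow (-2) ^ j * pInt i + pInt j := by
  simp only [pInt]
  rw [add_comm, Finset.sum_range_add, Finset.mul_sum, add_comm]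
  simp only [pow_add]

theorem isUnit_pInt (n : ℕ) : IsUnit (pInt (n + 1)) := by
  have h1 : qFact (n + 1) = qFact n * qInt (n + 1) := Finset.prod_range_succ _ _
  have h2 := qFact_mul_inv (n + 1)
  rw [h1, qInt_succ] at h2
  exact IsUnit.of_mul_eq_one (qFact n * qpow n * (qFact n * (qpow n * pInt (n + 1)))⁻¹)
    (by rw [← h2]; ring)

section QExp

variable {A : Type*} [Ring A] [Algebra K A] {a b : A}

theorem coeffR_smul_add_pow (hab : a * b = qpow 2 • (b * a)) (n : ℕ) :
    coeffR n • (a + b) ^ n = ∑ ij ∈ Finset.HasAntidiagonal.antidiagonal n,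
      (coeffR ij.1 • a ^ ij.1) * (coeffR ij.2 • b ^ ij.2) := by
  have hba : ∀ j, b ^ j * a = qpow (-2) ^ j • (a * b ^ j) := by
    intro j
    have h1 : b * a = qpow (-2) • (a * b) := by
      rw [hab, smul_smul, mul_comm, qpow_mul_neg, one_smul]
    induction j with
    | zero => simp
    | succ j ih =>
      rw [pow_succ', mul_assoc, ih, mul_smul_comm, ← mul_assoc, h1, smul_mul_assoc, smul_smul,
        mul_assoc, pow_succ]
  induction n with
  | zero => simp [coeffR, qFact, qpow_zero]
  | succ n ih =>
    have h1 : ∀ i j, (coeffR i • a ^ i) * (coeffR j • b ^ j) * a * algebraMap K A ((q - qi) * qi) =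
        (qpow (-2) ^ j * pInt (i + 1)) • ((coeffR (i + 1) • a ^ (i + 1)) * (coeffR j • b ^ j)) := by
      intro i j
      simp only [Algebra.algebraMap_eq_smul_one, mul_smul_comm, smul_mul_assoc, mul_one, smul_smul,
        mul_assoc, hba]
      rw [← mul_assoc (a ^ i), ← pow_succ]
      congr 1
      linear_combination -coeffR j * qpow (-2) ^ j * coeffR_succ i
    have h2 : ∀ i j, (coeffR i • a ^ i) * (coeffR j • b ^ j) * b * algebraMap K A ((q - qi) * qi) =
        pInt (j + 1) • ((coeffR i • a ^ i) * (coeffR (j + 1) • b ^ (j + 1))) := by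
      intro i j
      simp only [Algebra.algebraMap_eq_smul_one, mul_smul_comm, smul_mul_assoc, mul_one, smul_smul,
        mul_assoc, ← pow_succ]
      congr 1
      linear_combination -coeffR i * coeffR_succ j
    have key : pInt (n + 1) • coeffR (n + 1) • (a + b) ^ (n + 1) =
        pInt (n + 1) • ∑ ij ∈ Finset.HasAntidiagonal.antidiagonal (n + 1),
          (coeffR ij.1 • a ^ ij.1) * (coeffR ij.2 • b ^ ij.2) := by
      have e1 : pInt (n + 1) • coeffR (n + 1) • (a + b) ^ (n + 1) =
          coeffR n • (a + b) ^ n * (a + b) * algebraMap K A ((q - qi) * qi) := by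
        rw [smul_smul, mul_comm, coeffR_succ, pow_succ, Algebra.algebraMap_eq_smul_one,
          mul_smul_comm, mul_one, smul_mul_assoc, smul_smul, mul_comm]
      rw [e1, ih, Finset.sum_mul, Finset.sum_mul, Finset.smul_sum]
      simp only [mul_add, add_mul, h1, h2, Finset.sum_add_distrib]
      have s1 := Finset.Nat.sum_antidiagonal_succ (n := n) (f := fun ij : ℕ × ℕ =>
        (qpow (-2) ^ ij.2 * pInt ij.1) • ((coeffR ij.1 • a ^ ij.1) * (coeffR ij.2 • b ^ ij.2)))
      have s2 := Finset.Nat.sum_antidiagonal_succ' (n := n) (f := fun ij : ℕ × ℕ =>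
        pInt ij.2 • ((coeffR ij.1 • a ^ ij.1) * (coeffR ij.2 • b ^ ij.2)))
      have p0 : pInt 0 = 0 := rfl
      simp only [p0, mul_zero, zero_smul, zero_add] at s1 s2
      rw [← s1, ← s2, ← Finset.sum_add_distrib]
      refine Finset.sum_congr rfl fun ij hij => ?_
      rw [← add_smul, ← pInt_add, Finset.HasAntidiagonal.mem_antidiagonal.1 hij]
    obtain ⟨u, hu⟩ := isUnit_pInt n
    rw [← hu] at key
    have := congrArg (fun z => (↑u⁻¹ : K) • z) key
    simpa only [smul_smul, ← mul_assoc, Units.inv_mul, one_smul, one_mul] using this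

/-- The addition formula `Exp(a + b) = Exp(a) Exp(b)` for the `q`-exponential series
`Exp(a) = ∑ cₙ aⁿ`, where `a b = q² b a`. -/
theorem hasAdicSum_coeffR_add (hab : a * b = qpow 2 • (b * a)) {s t : A}
    (hs : HasAdicSum (fun n => coeffR n • a ^ n) s)
    (ht : HasAdicSum (fun n => coeffR n • b ^ n) t) :
    HasAdicSum (fun n => coeffR n • (a + b) ^ n) (s * t) :=
  (hs.mul ht).congr fun n => (coeffR_smul_add_pow hab n).symm

end QExp

/-! ### The two factors of the R-matrix -/

/-- The Cartan part `e^{(h/4) H ⊗ H}` of `R`. -/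
def cartan : CT2 Uh := hexp (cst (1 / 4) • ten H H)

/-- The second factor `∑ cₙ eⁿ ⊗ fⁿ` of `R`. -/
def quasiR : CT2 Uh :=
  adicSum (fun n => coeffR n • ten ((k * x) ^ n) ((ki * y) ^ n))
    (fun n => pow_smul_mem (coeffR_mem n) _)

theorem R_eq : R = cartan * quasiR := rfl

theorem quasiR_hasAdicSum : HasAdicSum (fun n => coeffR n • ten e f ^ n) quasiR :=
  (adicSum_hasAdicSum (fun n => coeffR n • ten ((k * x) ^ n) ((ki * y) ^ n))
    (fun n => pow_smul_mem (coeffR_mem n) _)).congr fun n => by rw [ten_pow, e, f]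

theorem comul_e : comulHom e = ten e (kpow 2) + ten 1 e := by
  rw [e, map_mul, k_eq, map_kpow_of_map_H comulHom_H, comulHom_x, mul_add, ten_mul, ten_mul,
    ← kpow_add, kpow_mul_neg]
  norm_num

theorem comul_f : comulHom f = ten f 1 + ten (kpow (-2)) f := by
  rw [f, map_mul, ki_eq, map_kpow_of_map_H comulHom_H, comulHom_y, mul_add, ten_mul, ten_mul,
    kpow_neg_mul, ← kpow_add]
  norm_num

/-- Conjugation by `e^{(h/4) H ⊗ H}` multiplies an element `z ⊗ 1` of weight `w` by `1 ⊗ k^w`. -/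
theorem cartan_mul_left {z : Uh} {w : ℂ} (hz : H * z = z * (H + cst w • 1)) :
    cartan * ten z 1 = ten z (kpow w) * cartan := by
  have h1 : cst (1 / 4) • ten H H * ten z 1 =
      ten z 1 * (cst (w / 4) • ten 1 H + cst (1 / 4) • ten H H) := by
    rw [smul_mul_assoc, ten_mul, hz, mul_one, mul_add (ten z 1), mul_smul_comm, mul_smul_comm,
      ten_mul, ten_mul, mul_add, ten_add_left, mul_one, one_mul, smul_add, mul_smul_comm, mul_one,
      ten_smul_left, smul_smul, add_comm]
    congr 2
    rw [← map_mul]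
    congr 1
    ring
  have h2 : Commute (cst (w / 4) • ten 1 H) (cst (1 / 4) • ten H H) := by
    refine (Commute.smul_left ?_ _).smul_right _
    rw [Commute, SemiconjBy, ten_mul, ten_mul, one_mul, mul_one]
  rw [cartan, hexp_intertwine h1, hexp_add h2, inr_kpow, ← mul_assoc, ten_mul, mul_one, one_mul]

theorem cartan_mul_right {z : Uh} {w : ℂ} (hz : H * z = z * (H + cst w • 1)) :
    cartan * ten 1 z = ten (kpow w) z * cartan := by
  have h1 : cst (1 / 4) • ten H H * ten 1 z =
      ten 1 z * (cst (w / 4) • ten H 1 + cst (1 / 4) • ten H H) := by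
    rw [smul_mul_assoc, ten_mul, hz, mul_one, mul_add (ten 1 z), mul_smul_comm, mul_smul_comm,
      ten_mul, ten_mul, mul_add, ten_add_right, mul_one, one_mul, smul_add, mul_smul_comm, mul_one,
      ten_smul_right, smul_smul, add_comm]
    congr 2
    rw [← map_mul]
    congr 1
    ring
  have h2 : Commute (cst (w / 4) • ten H 1) (cst (1 / 4) • ten H H) := by
    refine (Commute.smul_left ?_ _).smul_right _
    rw [Commute, SemiconjBy, ten_mul, ten_mul, one_mul, mul_one]
  rw [cartan, hexp_intertwine h1, hexp_add h2, inl_kpow, ← mul_assoc, ten_mul, mul_one, one_mul]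

theorem cartan_commute {a b : Uh} (ha : Commute H a) (hb : Commute H b) :
    Commute cartan (ten a b) := by
  refine hexp_intertwine ?_
  rw [smul_mul_assoc, mul_smul_comm, ten_mul, ten_mul, ha.eq, hb.eq]

theorem isUnit_hexp {A : Type*} [Ring A] [Algebra K A] [IsAdicComplete hIdeal A] (a : A) :
    IsUnit (hexp a) :=
  ⟨⟨hexp a, hexp (-a), hexp_mul_hexp_neg a, hexp_neg_mul_hexp a⟩, rfl⟩

theorem coeffR_zero : coeffR 0 = 1 := by simp [coeffR, qFact, qpow_zero]

theorem R_isUnit : IsUnit R := by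
  refine (isUnit_hexp _).mul (isUnit_of_sub_one_mem ?_)
  have := quasiR_hasAdicSum 1
  simp only [Finset.range_one, Finset.sum_singleton, coeffR_zero, pow_zero, one_smul] at this
  exact this

/-! ### The coproduct of the R-matrix -/

theorem leg13_quasiR : HasAdicSum (fun n => coeffR n • ten3 e 1 f ^ n) (leg13 quasiR) :=
  (quasiR_hasAdicSum.map leg13.toLinearMap).congr fun n => by
    rw [map_smul, AlgHom.toLinearMap_apply, map_pow, leg13_ten]

theorem leg23_quasiR : HasAdicSum (fun n => coeffR n • ten3 1 e f ^ n) (leg23 quasiR) :=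
  (quasiR_hasAdicSum.map leg23.toLinearMap).congr fun n => by
    rw [map_smul, AlgHom.toLinearMap_apply, map_pow, leg23_ten]

theorem leg12_quasiR : HasAdicSum (fun n => coeffR n • ten3 e f 1 ^ n) (leg12 quasiR) :=
  (quasiR_hasAdicSum.map leg12.toLinearMap).congr fun n => by
    rw [map_smul, AlgHom.toLinearMap_apply, map_pow, leg12_ten]

theorem ten3_commute (a b c a' b' c' : Uh) (ha : Commute a a') (hb : Commute b b')
    (hc : Commute c c') : Commute (ten3 a b c) (ten3 a' b' c') := by
  rw [Commute, SemiconjBy, ten3_mul, ten3_mul, ha.eq, hb.eq, hc.eq]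

theorem tensorIdHom_cartan :
    tensorIdHom comulHom cartan = leg13 cartan * leg23 cartan := by
  rw [cartan, map_hexp, map_hexp, map_hexp, map_smul, map_smul, map_smul, tensorIdHom_ten,
    comulHom_H, map_add, leg12_ten, leg12_ten, leg13_ten, leg23_ten, add_mul, ten3_mul, ten3_mul,
    ← hexp_add, smul_add]
  · simp only [one_mul, mul_one]
  · exact ((ten3_commute _ _ _ _ _ _ (.one_right _) (.one_left _) (.refl _)).smul_left
      _).smul_right _

theorem idTensorHom_cartan :
    idTensorHom comulHom cartan = leg13 cartan * leg12 cartan := by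
  rw [cartan, map_hexp, map_hexp, map_hexp, map_smul, map_smul, map_smul, idTensorHom_ten,
    comulHom_H, map_add, leg23_ten, leg12_ten, leg13_ten, leg23_ten, mul_add, ten3_mul, ten3_mul,
    ← hexp_add, ← smul_add, add_comm]
  · simp only [one_mul, mul_one]
  · exact ((ten3_commute _ _ _ _ _ _ (.refl _) (.one_left _) (.one_right _)).smul_left
      _).smul_right _

theorem HasAdicSum_semiconj {A : Type*} [Ring A] [Algebra K A] [IsAdicComplete hIdeal A]
    {c : ℕ → K} {d a b s t : A} (hd : d * a = b * d)
    (hs : HasAdicSum (fun n => c n • a ^ n) s) (ht : HasAdicSum (fun n => c n • b ^ n) t) :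
    d * s = t * d :=
  ((hs.mul_left d).congr fun n => by
    rw [mul_smul_comm, (SemiconjBy.pow_right (show SemiconjBy d a b from hd) n).eq,
      smul_mul_assoc]).unique (ht.mul_right d)

theorem exists_coeffR_sum {A : Type*} [Ring A] [Algebra K A] [IsAdicComplete hIdeal A] (a : A) :
    ∃ s, HasAdicSum (fun n => coeffR n • a ^ n) s :=
  ⟨_, adicSum_hasAdicSum _ fun n => pow_smul_mem (coeffR_mem n) _⟩

/-- The identity `(Δ ⊗ id)(R) = R₁₃ R₂₃`: as `Δ(e) = e ⊗ k² + 1 ⊗ e`, the coproduct of the second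
factor of `R` is a product of two `q`-exponential series, and conjugation by `e^{(h/4) H ⊗ H}`
absorbs the powers of `k`. -/
theorem tensorIdHom_R : tensorIdHom comulHom R = leg13 R * leg23 R := by
  obtain ⟨s, hs⟩ := exists_coeffR_sum (ten3 e (kpow 2) f)
  have h1 : leg23 cartan * ten3 e (kpow 2) f = ten3 e 1 f * leg23 cartan := by
    have a1 : ten3 e (kpow 2) f = ten3 e 1 1 * leg23 (ten 1 f * ten (kpow 2) 1) := by
      rw [ten_mul, leg23_ten, ten3_mul]; simp
    rw [a1, ← mul_assoc, ← (leg23_commute e cartan).eq, mul_assoc, ← map_mul, ← mul_assoc,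
      cartan_mul_right H_weight_f, mul_assoc,
      (cartan_commute (H_commute_kpow 2) (.one_right H)).eq, ← mul_assoc, ten_mul, kpow_neg_mul,
      map_mul, leg23_ten, ← mul_assoc, ten3_mul]
    simp
  have h2 : tensorIdHom comulHom quasiR = s * leg23 quasiR := by
    refine ((quasiR_hasAdicSum.map (tensorIdHom comulHom).toLinearMap).congr fun n => ?_).unique
      (hasAdicSum_coeffR_add ?_ hs leg23_quasiR)
    · rw [map_smul, AlgHom.toLinearMap_apply, map_pow, tensorIdHom_ten, comul_e, map_add, leg12_ten,
        leg12_ten, add_mul, ten3_mul, ten3_mul]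
      simp
    · rw [ten3_mul, ten3_mul, kpow_mul_e, ten3, TensorProduct.tmul_smul, ← TensorProduct.smul_tmul',
        map_smul, mul_one, one_mul]
      rfl
  rw [R_eq, map_mul, tensorIdHom_cartan, h2, map_mul, map_mul, mul_assoc, mul_assoc,
    ← mul_assoc (leg23 cartan), HasAdicSum_semiconj h1 hs leg13_quasiR, mul_assoc]

theorem idTensorHom_R : idTensorHom comulHom R = leg13 R * leg12 R := by
  obtain ⟨s, hs⟩ := exists_coeffR_sum (ten3 e (kpow (-2)) f)
  have h1 : leg12 cartan * ten3 e (kpow (-2)) f = ten3 e 1 f * leg12 cartan := by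
    have a1 : ten3 e (kpow (-2)) f = leg12 (ten e 1 * ten 1 (kpow (-2))) * ten3 1 1 f := by
      rw [ten_mul, leg12_ten, ten3_mul]; simp
    rw [a1, ← mul_assoc, ← map_mul, ← mul_assoc,
      cartan_mul_left H_weight_e, mul_assoc,
      (cartan_commute (.one_right H) (H_commute_kpow (-2))).eq, ← mul_assoc, ten_mul, kpow_mul_neg,
      map_mul, mul_assoc, (leg12_commute cartan f).eq, leg12_ten, ← mul_assoc, ten3_mul]
    simp
  have h2 : idTensorHom comulHom quasiR = s * leg12 quasiR := by
    refine ((quasiR_hasAdicSum.map (idTensorHom comulHom).toLinearMap).congr fun n => ?_).unique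
      (hasAdicSum_coeffR_add ?_ hs leg12_quasiR)
    · rw [map_smul, AlgHom.toLinearMap_apply, map_pow, idTensorHom_ten, comul_f, map_add, leg23_ten,
        leg23_ten, mul_add, ten3_mul, ten3_mul, add_comm]
      simp
    · rw [ten3_mul, ten3_mul, kpow_mul_f, neg_neg, ten3, TensorProduct.tmul_smul,
        ← TensorProduct.smul_tmul', map_smul, mul_one, one_mul]
      rfl
  rw [R_eq, map_mul, idTensorHom_cartan, h2, map_mul, map_mul, mul_assoc, mul_assoc,
    ← mul_assoc (leg12 cartan), HasAdicSum_semiconj h1 hs leg13_quasiR, mul_assoc]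

/-! ### The intertwining property of the R-matrix -/

theorem quasiR_term_e (n : ℕ) :
    coeffR (n + 1) • (ten 1 e * ten e f ^ (n + 1) - ten e f ^ (n + 1) * ten 1 e) =
      coeffR n • ten e f ^ n * ten e (kpow 2) - ten e (kpow (-2)) * coeffR n • ten e f ^ n := by
  rw [ten_pow, ten_pow, ten_mul, ten_mul, one_mul, mul_one, ← ten_sub_right, ← ten_smul_right,
    coeffR_smul_e_mul_f_pow, smul_mul_assoc, mul_smul_comm, ten_mul, ten_mul, ← pow_succ,
    ← pow_succ', ← smul_sub, ← ten_sub_right, ten_smul_right]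

theorem quasiR_term_f (n : ℕ) :
    coeffR (n + 1) • (ten f 1 * ten e f ^ (n + 1) - ten e f ^ (n + 1) * ten f 1) =
      coeffR n • ten e f ^ n * ten (kpow (-2)) f - ten (kpow 2) f * coeffR n • ten e f ^ n := by
  rw [← neg_sub, smul_neg, ten_pow, ten_pow, ten_mul, ten_mul, one_mul, mul_one, ← ten_sub_left,
    ← ten_smul_left, coeffR_smul_e_pow_mul_f, smul_mul_assoc, mul_smul_comm, ten_mul, ten_mul,
    ← pow_succ, ← pow_succ', ← smul_sub, ← ten_sub_left, ten_smul_left, ← smul_neg, ← ten_neg_left,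
    neg_sub]

/-- A commutator with `quasiR` is computed by shifting the summation index. -/
theorem quasiR_commutator {a b c : CT2 Uh}
    (habc : ∀ n, coeffR (n + 1) • (a * ten e f ^ (n + 1) - ten e f ^ (n + 1) * a) =
      coeffR n • ten e f ^ n * b - c * coeffR n • ten e f ^ n) :
    (a + c) * quasiR = quasiR * (a + b) := by
  have hs := (quasiR_hasAdicSum.mul_left a).sub (quasiR_hasAdicSum.mul_right a)
  have ht := (quasiR_hasAdicSum.mul_right b).sub (quasiR_hasAdicSum.mul_left c)
  have h1 := hs.unique (HasAdicSum.of_succ (ht.congr fun n => by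
    rw [← habc, smul_sub, mul_smul_comm, smul_mul_assoc]) hs.term_mem)
  simp only [pow_zero, mul_smul_comm, smul_mul_assoc, mul_one, one_mul, sub_self, zero_add] at h1
  rw [sub_eq_sub_iff_add_eq_add] at h1
  rw [add_mul, mul_add, h1, add_comm]

theorem twist_comul_e : twist (comulHom e) * R = R * comulHom e := by
  have h1 : (ten (kpow 2) e + ten e 1) * cartan = cartan * (ten 1 e + ten e (kpow (-2))) := by
    have a1 : ten e (kpow (-2)) = ten e 1 * ten 1 (kpow (-2)) := by simp [ten_mul]
    rw [add_mul, mul_add, cartan_mul_right H_weight_e, a1, ← mul_assoc, cartan_mul_left H_weight_e,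
      mul_assoc (ten e (kpow 2)), (cartan_commute (.one_right H) (H_commute_kpow (-2))).eq,
      ← mul_assoc (ten e (kpow 2)), ten_mul, kpow_mul_neg, mul_one]
  rw [comul_e, map_add, twist_ten, twist_ten, R_eq, ← mul_assoc, h1, mul_assoc,
    quasiR_commutator quasiR_term_e, mul_assoc, add_comm]

theorem twist_comul_f : twist (comulHom f) * R = R * comulHom f := by
  have h1 : (ten 1 f + ten f (kpow (-2))) * cartan = cartan * (ten f 1 + ten (kpow 2) f) := by
    have a1 : ten (kpow 2) f = ten 1 f * ten (kpow 2) 1 := by simp [ten_mul]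
    rw [add_mul, mul_add, cartan_mul_left H_weight_f, a1, ← mul_assoc, cartan_mul_right H_weight_f,
      mul_assoc (ten (kpow (-2)) f), (cartan_commute (H_commute_kpow 2) (.one_right H)).eq,
      ← mul_assoc (ten (kpow (-2)) f), ten_mul, kpow_neg_mul, mul_one, add_comm]
  rw [comul_f, map_add, twist_ten, twist_ten, R_eq, ← mul_assoc, h1, mul_assoc,
    quasiR_commutator quasiR_term_f, mul_assoc]

theorem comul_H_commute_R : Commute (ten H 1 + ten 1 H) R := by
  refine Commute.mul_right ?_ ?_
  · exact ((cartan_commute (.refl H) (.one_right H)).add_right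
      (cartan_commute (.one_right H) (.refl H))).symm
  · refine HasAdicSum_semiconj ?_ quasiR_hasAdicSum quasiR_hasAdicSum
    rw [add_mul, mul_add, ten_mul, ten_mul, ten_mul, ten_mul, H_weight_e, H_weight_f]
    rw [show cst (-2) = -cst 2 from map_neg _ _]
    simp only [mul_add, ten_add_left, ten_add_right, mul_one, one_mul, mul_smul_comm, ten_smul_left,
      ten_smul_right, neg_smul, mul_neg, ten_neg_right]
    abel

theorem twist_comul_kpow (c : ℂ) : twist (comulHom (kpow c)) * R = R * comulHom (kpow c) := by
  have h1 : twist (comulHom (kpow c)) = comulHom (kpow c) := by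
    rw [map_kpow_of_map_H comulHom_H, twist_ten]
  rw [h1, kpow, map_hexp, map_smul, comulHom_H]
  exact hexp_intertwine (by rw [smul_mul_assoc, comul_H_commute_R.eq, mul_smul_comm])

theorem twist_comul_mul {a b : Uh} (ha : twist (comulHom a) * R = R * comulHom a)
    (hb : twist (comulHom b) * R = R * comulHom b) :
    twist (comulHom (a * b)) * R = R * comulHom (a * b) := by
  rw [map_mul, map_mul, mul_assoc, hb, ← mul_assoc, ha, mul_assoc]

theorem twist_comul_mul_R (a : Uh) : twist (comulHom a) * R = R * comulHom a := by
  refine DFunLike.congr_fun (linearMap_ext_of_mul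
    (f := LinearMap.mulRight K R ∘ₗ twist.toLinearMap ∘ₗ comulHom.toLinearMap)
    (g := LinearMap.mulLeft K R ∘ₗ comulHom.toLinearMap) ?_
    (fun a b ha hb => twist_comul_mul ha hb) ?_ ?_ ?_) a
  · simp
  · change twist (comulHom H) * R = R * comulHom H
    rw [comulHom_H, map_add, twist_ten, twist_ten, add_comm, comul_H_commute_R.eq]
  · change twist (comulHom x) * R = R * comulHom x
    rw [x_eq]
    exact twist_comul_mul (twist_comul_kpow _) twist_comul_e
  · change twist (comulHom y) * R = R * comulHom y
    rw [y_eq]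
    exact twist_comul_mul (twist_comul_kpow _) twist_comul_f

theorem R_isUniversalR : hopf.IsUniversalR R where
  isUnit := R_isUnit
  twist_comul a := by
    change twist (comulHom a) = R * comulHom a * Ring.inverse R
    rw [← twist_comul_mul_R, mul_assoc, Ring.mul_inverse_cancel _ R_isUnit, mul_one]
  comul_left := by
    change tensorId comulHom.toLinearMap R = _
    rw [tensorId_apply, tensorIdHom_R]
  comul_right := by
    change idTensor comulHom.toLinearMap R = _
    rw [idTensor_apply, idTensorHom_R]

/-! ### Weights -/

theorem weight_mul {a b : Uh} {m w : ℂ} (ha : H * a = a * (H + cst m • 1))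
    (hb : H * b = b * (H + cst w • 1)) : H * (a * b) = a * b * (H + cst (m + w) • 1) := by
  rw [← mul_assoc, ha, mul_assoc, add_mul, hb, show cst (m + w) = cst m + cst w from map_add _ _ _]
  simp only [mul_add, mul_smul_comm, smul_mul_assoc, mul_one, one_mul, add_smul, mul_assoc]
  abel

theorem weight_pow {a : Uh} {m : ℂ} (ha : H * a = a * (H + cst m • 1)) (n : ℕ) :
    H * a ^ n = a ^ n * (H + cst (n * m) • 1) := by
  induction n with
  | zero => simp
  | succ n ih =>
    rw [pow_succ, weight_mul ih ha]
    push_cast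
    ring_nf

theorem H_commute_of_weight {a : Uh} {m : ℂ} (ha : H * a = a * (H + cst m • 1)) (hm : m = 0) :
    Commute H a := by
  rw [hm, show cst 0 = 0 from map_zero _, zero_smul, add_zero] at ha
  exact ha

theorem H_commute_y_pow_mul_x_pow (n : ℕ) : Commute H (y ^ n * x ^ n) :=
  H_commute_of_weight (weight_mul (weight_pow H_weight_y n) (weight_pow H_weight_x n)) (by ring)

theorem H_commute_x_pow_mul_y_pow (n : ℕ) : Commute H (x ^ n * y ^ n) :=
  H_commute_of_weight (weight_mul (weight_pow H_weight_x n) (weight_pow H_weight_y n)) (by ring)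

theorem kpow_commute {a : Uh} (ha : Commute H a) (c : ℂ) : Commute (kpow c) a :=
  hexp_intertwine (by rw [smul_mul_assoc, mul_smul_comm, ha.eq])

/-- The element `e^{-(h/4) H²}`. -/
def gauss : Uh := hexp (cst (-1 / 4) • H ^ 2)

theorem gauss_commute {a : Uh} (ha : Commute H a) : Commute gauss a :=
  hexp_intertwine (by rw [smul_mul_assoc, mul_smul_comm, (ha.pow_left 2).eq])

/-- Moving `e^{-(h/4) H²}` past an element of weight `w`. -/
theorem gauss_mul {a : Uh} {w : ℂ} (ha : H * a = a * (H + cst w • 1)) :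
    gauss * a = qpow (-w ^ 2 / 2) • (a * gauss * kpow (-2 * w)) := by
  have h1 : cst (-1 / 4) • H ^ 2 * a =
      a * (cst (-1 / 4) • H ^ 2 + (cst (-2 * w / 4) • H + cst (-w ^ 2 / 4) • 1)) := by
    have e1 : cst (-2 * w / 4) = 2 * (cst (-1 / 4) * cst w) := by
      rw [show (2 : K) = cst 2 from (map_ofNat _ 2).symm, cst, cst, cst, cst, ← map_mul, ← map_mul]
      ring_nf
    have e2 : cst (-w ^ 2 / 4) = cst (-1 / 4) * (cst w * cst w) := by
      rw [cst, cst, cst, ← map_mul, ← map_mul]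
      ring_nf
    have e3 : H ^ 2 * a = a * (H + cst w • 1) * (H + cst w • 1) := by
      rw [pow_two, mul_assoc, ha, ← mul_assoc, ha]
    rw [smul_mul_assoc, e3, e1, e2, mul_assoc, ← mul_smul_comm]
    congr 1
    simp only [mul_add, add_mul, mul_smul_comm, smul_mul_assoc, mul_one, one_mul, smul_add,
      mul_smul, two_smul, pow_two]
    abel
  rw [gauss, hexp_intertwine h1, hexp_add, hexp_add, hexp_smul_one, mul_smul_comm, mul_one,
    mul_smul_comm, mul_smul_comm, mul_assoc]
  · congr 2
    ring
  · exact (Commute.one_right _).smul_right _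
  · exact Commute.add_right ((((Commute.refl H).pow_left 2).smul_left _).smul_right _)
      ((Commute.one_right _).smul_right _)

/-! ### The Drinfeld element -/

theorem unopLin_pow {A : Type*} [Ring A] [Algebra K A] (S : A →ₐ[K] Aᵐᵒᵖ) (a : A) (n : ℕ) :
    unopLin S (a ^ n) = unopLin S a ^ n := by
  simp [unopLin_apply]

/-- The Drinfeld element `u = ∑ S(βᵢ) αᵢ` of `R = ∑ αᵢ ⊗ βᵢ`. -/
def drinfeld : Uh := mulMap (unopLin antipodeHom) LinearMap.id (twist R)

theorem hopf_u : hopf.u R = drinfeld := rfl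

theorem mulMap_twist_cartan :
    mulMap (unopLin antipodeHom) LinearMap.id (twist cartan) = gauss := by
  refine (((hexp_hasAdicSum (cst (1 / 4) • ten H H)).map
    (mulMap (unopLin antipodeHom) LinearMap.id ∘ₗ twist.toLinearMap)).congr fun n => ?_).unique
    (hexp_hasAdicSum (cst (-1 / 4) • H ^ 2))
  have e1 : cst (-1 / 4) • H ^ 2 = cst (1 / 4) • (-H * H) := by
    rw [neg_div, cst, map_neg, neg_smul, neg_mul, smul_neg, pow_two]
  rw [e1, map_smul, smul_pow, smul_pow, map_smul, ten_pow, LinearMap.comp_apply,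
    AlgHom.toLinearMap_apply, twist_ten, mulMap_ten, unopLin_pow, antipodeHom_H, LinearMap.id_apply,
    ((Commute.refl H).neg_left).mul_pow]

theorem mulMap_twist_mul_ten (z : CT2 Uh) (a b : Uh) :
    mulMap (unopLin antipodeHom) LinearMap.id (twist (z * ten a b)) =
      unopLin antipodeHom b * mulMap (unopLin antipodeHom) LinearMap.id (twist z) * a := by
  rw [map_mul, twist_ten, mulMap_left_mul_ten]

/-- The element `k y = -S(f)`. -/
def g : Uh := kpow 1 * y

theorem antipode_f : unopLin antipodeHom f = -g := by
  rw [f, unopLin_mul, ki_eq, anti_kpow antipodeHom_H, antipodeHom_y, neg_mul, smul_mul_assoc,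
    y_mul_kpow, smul_smul, neg_neg, ← q, mul_comm, q_mul_qi, one_smul, g]

/-- The Drinfeld element is `∑ cₙ S(f)ⁿ e^{-(h/4) H²} eⁿ`. -/
theorem drinfeld_hasAdicSum :
    HasAdicSum (fun n => coeffR n • ((-g) ^ n * gauss * e ^ n)) drinfeld :=
  ((quasiR_hasAdicSum.mul_left cartan).map
    (mulMap (unopLin antipodeHom) LinearMap.id ∘ₗ twist.toLinearMap)).congr fun n => by
    rw [mul_smul_comm, map_smul, ten_pow, LinearMap.comp_apply, AlgHom.toLinearMap_apply,
      mulMap_twist_mul_ten, mulMap_twist_cartan, unopLin_pow, antipode_f]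

theorem H_weight_g : H * g = g * (H + cst (-2) • 1) := by
  rw [g, ← mul_assoc, (H_commute_kpow _).eq, mul_assoc, H_weight_y, mul_assoc]

theorem kpow_mul_g (c : ℂ) : kpow c * g = qpow (-c) • (g * kpow c) := by
  rw [kpow_weight H_weight_g]; congr 2; ring

theorem f_eq : f = kpow (-2) * g := by
  rw [g, ← mul_assoc, ← kpow_add, f, ki_eq]
  norm_num

theorem gauss_mul_f : gauss * f = g * gauss * kpow 2 := by
  rw [gauss_mul H_weight_f, f_eq, kpow_mul_g, smul_mul_assoc, smul_mul_assoc, smul_smul,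
    mul_assoc g, ← (gauss_commute (H_commute_kpow (-2))).eq, mul_assoc, mul_assoc, ← kpow_add,
    ← qpow_add, ← mul_assoc]
  norm_num [qpow_zero]

/-- This is `u f = S²(f) u`, as `S²(f) = k² f k⁻² = g k⁻²` and `H` commutes with `u`. -/
theorem drinfeld_mul_f : drinfeld * f = g * drinfeld * kpow (-2) := by
  have s1 := drinfeld_hasAdicSum.mul_right f
  have s2 := (drinfeld_hasAdicSum.mul_left g).mul_right (kpow (-2))
  have hc : ∀ n, (-g) ^ n * gauss * f * e ^ n = -((-g) ^ (n + 1) * gauss * (kpow 2 * e ^ n)) := by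
    intro n
    rw [mul_assoc _ gauss, gauss_mul_f, pow_succ]
    noncomm_ring
  -- The terms with `f` moved to the left of `eⁿ`.
  obtain ⟨s, hs⟩ : ∃ s, HasAdicSum (fun n => coeffR n • ((-g) ^ n * gauss * f * e ^ n)) s :=
    ⟨_, adicSum_hasAdicSum _ fun n => pow_smul_mem (coeffR_mem n) _⟩
  have h1 := s1.sub hs
  have h2 := h1.unique (HasAdicSum.of_succ ((hs.neg.add s2).congr fun n => ?_) h1.term_mem)
  · simp only [pow_zero, mul_one, one_mul, smul_mul_assoc, mul_assoc, sub_self, zero_add] at h2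
    rw [sub_eq_neg_add] at h2
    rw [add_left_cancel h2, mul_assoc]
  · have l := congrArg (fun z => (-g) ^ (n + 1) * gauss * z) (coeffR_smul_e_pow_mul_f n)
    simp only [mul_smul_comm, mul_sub, smul_sub] at l
    rw [hc]
    simp only [smul_mul_assoc, mul_smul_comm, smul_neg, neg_neg, mul_assoc] at l ⊢
    rw [l, pow_succ' (-g) n]
    simp only [neg_mul, mul_assoc, smul_neg, sub_neg_eq_add]

theorem H_commute_drinfeld : Commute H drinfeld := by
  refine (drinfeld_hasAdicSum.mul_left H).unique
    ((drinfeld_hasAdicSum.mul_right H).congr fun n => ?_)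
  have h1 : H * -g = -g * (H + cst (-2) • 1) := by rw [mul_neg, H_weight_g, neg_mul]
  have h2 : H * gauss = gauss * (H + cst 0 • 1) := by
    rw [show cst 0 = 0 from map_zero _, zero_smul, add_zero]
    exact (gauss_commute (Commute.refl H)).eq.symm
  rw [smul_mul_assoc, mul_smul_comm]
  congr 1
  exact (H_commute_of_weight (weight_mul (weight_mul (weight_pow h1 n) h2)
    (weight_pow H_weight_e n)) (by ring)).eq.symm

/-! ### The ribbon element -/

theorem v_hasAdicSum :
    HasAdicSum (fun n => coeffV n • (gauss * (kpow (-2 * (n + 1)) * (y ^ n * x ^ n)))) v :=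
  ((adicSum_hasAdicSum (fun n => coeffV n • (ki ^ (2 * (n + 1)) * y ^ n * x ^ n))
    (fun n => pow_smul_mem (coeffV_mem n) _)).mul_left gauss).congr fun n => by
    rw [mul_smul_comm, ki_pow, mul_assoc]
    push_cast
    ring_nf

theorem kpow_mul_pow {z : Uh} {a b : ℂ} (hz : z * kpow a = qpow b • (kpow a * z)) (n : ℕ) :
    (kpow a * z) ^ n = qpow (b * (n * (n - 1) / 2)) • (kpow (n * a) * z ^ n) := by
  have h1 : ∀ n : ℕ, z ^ n * kpow a = qpow (n * b) • (kpow a * z ^ n) := by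
    intro n
    induction n with
    | zero => simp [qpow_zero]
    | succ n ih =>
      rw [pow_succ', mul_assoc, ih, mul_smul_comm, ← mul_assoc, hz, smul_mul_assoc, smul_smul,
        ← qpow_add, mul_assoc]
      congr 2
      push_cast
      ring
  induction n with
  | zero => simp [qpow_zero, kpow_zero]
  | succ n ih =>
    rw [pow_succ, ih, smul_mul_assoc, ← mul_assoc, mul_assoc (kpow (n * a)), h1, mul_smul_comm,
      smul_mul_assoc, smul_smul, ← qpow_add, ← mul_assoc (kpow (n * a)), ← kpow_add, mul_assoc,
      ← pow_succ]
    congr 2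
    · push_cast; ring
    · push_cast; ring_nf

theorem y_pow_mul_kpow (n : ℕ) (c : ℂ) : y ^ n * kpow c = qpow (n * c) • (kpow c * y ^ n) := by
  have := kpow_weight (weight_pow H_weight_y n) c
  rw [this, smul_smul, ← qpow_add]
  ring_nf
  simp [qpow_zero]

theorem coeffV_eq (n : ℕ) : coeffV n = (-1) ^ n * coeffR n * qpow (-(n : ℂ) ^ 2) := by
  have h1 : qpow (-((n : ℂ) * (n + 3) / 2)) =
      qpow ((n : ℂ) * (n - 3) / 2) * qpow (-(n : ℂ) ^ 2) := by
    rw [← qpow_add]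
    congr 1
    ring
  rw [coeffV, coeffR, h1, ← neg_sub q qi, neg_pow]
  ring

/-- The relation `v = k⁻² u`, term by term: `e^{-(h/4) H²}` is moved to the left of `S(f)ⁿ`. -/
theorem v_eq : v = kpow (-2) * drinfeld := by
  refine v_hasAdicSum.unique ((drinfeld_hasAdicSum.mul_left (kpow (-2))).congr fun n => ?_)
  have h1 : gauss * (qpow (-2) • (kpow (-3) * y)) = g * gauss := by
    have e1 : kpow (-3) * y = kpow (-4) * g := by
      rw [g, ← mul_assoc, ← kpow_add]; norm_num
    rw [e1, kpow_mul_g, smul_smul, ← qpow_add, mul_smul_comm, ← mul_assoc, gauss_mul H_weight_g,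
      smul_mul_assoc, mul_assoc _ (kpow _), ← kpow_add, smul_smul, ← qpow_add]
    norm_num [qpow_zero, kpow_zero]
  have h2 : g ^ n * gauss = gauss * (qpow (-2) • (kpow (-3) * y)) ^ n :=
    (SemiconjBy.pow_right (show SemiconjBy gauss _ g from h1) n).eq.symm
  have h3 : (qpow (-2) • (kpow (-3) * y)) ^ n * e ^ n =
      qpow (-(n : ℂ) ^ 2) • (kpow (-2 * n) * (y ^ n * x ^ n)) := by
    rw [smul_pow, e, k_eq, kpow_mul_pow (y_mul_kpow (-3)), kpow_mul_pow (x_mul_kpow 1),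
      smul_mul_assoc, smul_mul_assoc, mul_smul_comm, mul_assoc, ← mul_assoc (y ^ n),
      y_pow_mul_kpow, smul_mul_assoc, mul_smul_comm, smul_smul, smul_smul, smul_smul,
      mul_assoc _ (y ^ n) (x ^ n), ← mul_assoc (kpow _) (kpow _), ← kpow_add,
      ← qpow_nsmul, ← qpow_add, ← qpow_add, ← qpow_add]
    congr 2
    · ring
    · ring_nf
  have h4 : (-g) ^ n * gauss * e ^ n =
      ((-1) ^ n * qpow (-(n : ℂ) ^ 2)) • (gauss * (kpow (-2 * n) * (y ^ n * x ^ n))) := by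
    have e1 : (-g) ^ n = ((-1 : K) ^ n) • g ^ n := by
      rw [← smul_pow, neg_smul, one_smul]
    rw [e1, smul_mul_assoc, smul_mul_assoc, h2, mul_assoc, h3, mul_smul_comm, mul_smul]
  rw [h4, mul_smul_comm, mul_smul_comm, ← mul_assoc (kpow (-2)),
    ← (gauss_commute (H_commute_kpow (-2))).eq,
    mul_assoc gauss, ← mul_assoc (kpow (-2)), ← kpow_add, smul_smul, coeffV_eq]
  congr 1
  · ring
  · ring_nf

theorem H_commute_v : Commute H v := by
  rw [v_eq]
  exact (H_commute_kpow (-2)).mul_right H_commute_drinfeld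

theorem v_commute_f : Commute v f := by
  have h1 := kpow_commute H_commute_drinfeld (-2)
  rw [Commute, SemiconjBy, v_eq, mul_assoc, drinfeld_mul_f, ← mul_assoc, ← mul_assoc, ← f_eq,
    mul_assoc, h1.eq]

theorem v_commute_y : Commute v y := by
  rw [y_eq]
  exact (kpow_commute H_commute_v 1).symm.mul_right v_commute_f

/-- The anti-automorphism of `U_h(sl₂)` which fixes `H` and exchanges `x` and `y`. -/
def transposeHom : Uh →ₐ[K] Uhᵐᵒᵖ :=
  lift (.op H) (.op y) (.op x)
    (by
      apply MulOpposite.unop_injective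
      have := H_comm_y
      rw [sub_eq_iff_eq_add] at this
      simp [this, two_mul, two_smul])
    (by
      apply MulOpposite.unop_injective
      have := H_comm_x
      rw [sub_eq_iff_eq_add] at this
      simp [this, two_mul, two_smul])
    (by
      rw [← op_bracket, ← x_mul_y]
      rfl)

theorem transpose_H : unopLin transposeHom H = H :=
  congrArg MulOpposite.unop (show transposeHom H = .op H from lift_H _ _ _)

theorem transpose_x : unopLin transposeHom x = y :=
  congrArg MulOpposite.unop (show transposeHom x = .op y from lift_x _ _ _)

theorem transpose_y : unopLin transposeHom y = x :=
  congrArg MulOpposite.unop (show transposeHom y = .op x from lift_y _ _ _)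

theorem unopLin_hexp {A : Type*} [Ring A] [Algebra K A] [IsAdicComplete hIdeal A]
    (S : A →ₐ[K] Aᵐᵒᵖ) (a : A) : unopLin S (hexp a) = hexp (unopLin S a) := by
  apply MulOpposite.op_injective
  rw [op_hexp, unopLin_apply, map_hexp, MulOpposite.op_unop, unopLin_apply, MulOpposite.op_unop]

theorem transpose_kpow (c : ℂ) : unopLin transposeHom (kpow c) = kpow c := by
  rw [kpow, unopLin_hexp, map_smul, transpose_H]

theorem transpose_gauss : unopLin transposeHom gauss = gauss := by
  rw [gauss, unopLin_hexp, map_smul, unopLin_pow, transpose_H]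

theorem transpose_v : unopLin transposeHom v = v := by
  refine ((v_hasAdicSum.map (unopLin transposeHom)).congr fun n => ?_).unique v_hasAdicSum
  have h1 := H_commute_y_pow_mul_x_pow n
  rw [map_smul, unopLin_mul, unopLin_mul, unopLin_mul, unopLin_pow, unopLin_pow, transpose_x,
    transpose_y, transpose_gauss, transpose_kpow, ← (kpow_commute h1 _).eq,
    (gauss_commute ((H_commute_kpow _).mul_right h1)).eq]

/-- The transpose anti-automorphism fixes `v`, so that this follows from the case of `y`. -/
theorem v_commute_x : Commute v x := by
  have h1 := congrArg (unopLin transposeHom) v_commute_y.eq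
  rw [unopLin_mul, unopLin_mul, transpose_v, transpose_y] at h1
  exact h1.symm

theorem v_central (a : Uh) : v * a = a * v :=
  DFunLike.congr_fun (linearMap_ext_of_mul (f := LinearMap.mulLeft K v)
    (g := LinearMap.mulRight K v) (by simp)
    (fun a b ha hb => by
      simp only [LinearMap.mulLeft_apply, LinearMap.mulRight_apply] at ha hb ⊢
      rw [← mul_assoc, ha, mul_assoc, hb, mul_assoc])
    H_commute_v.eq.symm v_commute_x.eq v_commute_y.eq) a

theorem counit_v : counitHom v = 1 := by
  refine ((v_hasAdicSum.map counitHom.toLinearMap).congr fun n => ?_).unique HasAdicSum.single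
  have h1 : counitHom gauss = 1 := by
    rw [gauss, map_hexp, map_smul, map_pow, counitHom_H]; simp [hexp_zero]
  rcases n with _ | n
  · simp [h1, character_kpow counitHom_H, coeffV, qFact, qpow_zero]
  · simp [counitHom_x]

end Uh

/-! ### A `q`-binomial identity -/

/-- The `q`-number `[c] = (q^c - q^{-c}) / (q - q⁻¹)`, for a complex number `c`. -/
def qNum (c : ℂ) : K := bracket (cst c)

theorem qNum_mul (c : ℂ) : qNum c * (q - qi) = qpow c - qpow (-c) := bracket_cst_mul c

theorem qNum_neg (c : ℂ) : qNum (-c) = -qNum c := by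
  rw [qNum, qNum, ← bracket_neg, cst, map_neg]

theorem qNum_zero : qNum 0 = 0 := by
  rw [qNum, cst, map_zero, bracket_zero]

theorem qNum_natCast (n : ℕ) : qNum n = qInt n := bracket_natCast n

theorem eq_of_mul_q_sub_qi_sq {a b : K} (hab : a * (q - qi) ^ 2 = b * (q - qi) ^ 2) : a = b :=
  mul_right_cancel₀ (pow_ne_zero 2 q_sub_qi_ne_zero) hab

theorem qNum_mul_qNum (a b : ℂ) : qNum a * qNum b * (q - qi) ^ 2 =
    qpow (a + b) + qpow (-(a + b)) - qpow (a - b) - qpow (b - a) := by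
  have h1 : qNum a * qNum b * (q - qi) ^ 2 = (qNum a * (q - qi)) * (qNum b * (q - qi)) := by ring
  rw [h1, qNum_mul, qNum_mul, sub_mul, mul_sub, mul_sub, ← qpow_add, ← qpow_add, ← qpow_add,
    ← qpow_add]
  ring_nf

/-- The `q`-binomial coefficient `(-1)ⁿ [j] [j - 1] ⋯ [j - n + 1] / [n]!`, multiplied by a power of
`q`; the upper argument `j` is any complex number. -/
def qBinom (j : ℂ) (n : ℕ) : K :=
  (-1) ^ n * (qFact n)⁻¹ * (∏ i ∈ Finset.range n, qNum (j - i)) * qpow (n * (j - 1))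

/-- The `q`-shifted factorial `(1 - q^w) (1 - q^{w-2}) ⋯ (1 - q^{w-2n+2})`. -/
def qPoch (w : ℂ) (n : ℕ) : K := ∏ i ∈ Finset.range n, (1 - qpow (w - 2 * i))

theorem qFact_inv_succ (n : ℕ) : (qFact n)⁻¹ = qNum (n + 1) * (qFact (n + 1))⁻¹ := by
  rw [← Uh.qInt_succ_mul_inv, ← qNum_natCast]
  push_cast
  rfl

theorem h_dvd_one_sub_qpow (w : ℂ) : h ∣ 1 - qpow w := by
  rw [PowerSeries.X_dvd_iff, ← PowerSeries.coeff_zero_eq_constantCoeff_apply]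
  simp [qpow]

theorem qPoch_mem (w : ℂ) (n : ℕ) : qPoch w n ∈ hPow K n := by
  have h1 : h ^ n ∣ qPoch w n := by
    have := Finset.prod_dvd_prod_of_dvd (s := Finset.range n) (fun _ => h)
      (fun i : ℕ => 1 - qpow (w - 2 * i)) fun i _ => h_dvd_one_sub_qpow _
    rwa [Finset.prod_const, Finset.card_range] at this
  obtain ⟨m, hm⟩ := h1
  exact mem_hPow.2 ⟨m, by rw [hm, smul_eq_mul]⟩

theorem qBinom_zero (j : ℂ) : qBinom j 0 = 1 := by simp [qBinom, qFact, qpow_zero]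

theorem prod_qNum_succ (j : ℂ) (n : ℕ) : ∏ i ∈ Finset.range (n + 1), qNum (j + 1 - i) =
    qNum (j + 1) * ∏ i ∈ Finset.range n, qNum (j - i) := by
  have h1 : ∀ i : ℕ, qNum (j + 1 - (i + 1 : ℕ)) = qNum (j - i) := fun i => by
    push_cast
    ring_nf
  rw [Finset.prod_range_succ', mul_comm, Nat.cast_zero, sub_zero]
  simp only [h1]

/-- The Pascal rule. -/
theorem qBinom_succ (j : ℂ) (n : ℕ) : qBinom (j + 1) (n + 1) =
    qBinom j (n + 1) * qpow (2 * (n + 1)) - qBinom j n * qpow (2 * n) := by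
  have key : qNum (j + 1) = qpow (n + 1) * qNum (j - n) + qpow (n - j) * qNum (n + 1) := by
    refine mul_right_cancel₀ q_sub_qi_ne_zero ?_
    rw [add_mul, mul_assoc, mul_assoc, qNum_mul, qNum_mul, qNum_mul, mul_sub, mul_sub, ← qpow_add,
      ← qpow_add, ← qpow_add, ← qpow_add]
    ring_nf
  have e1 : qpow (((n + 1 : ℕ) : ℂ) * (j + 1 - 1)) =
      qpow (n * (j - 1)) * qpow (2 * n) * qpow (j - n) := by
    rw [← qpow_add, ← qpow_add]; push_cast; ring_nf
  have e2 : qpow (((n + 1 : ℕ) : ℂ) * (j - 1)) * qpow (2 * (n + 1)) =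
      qpow (n * (j - 1)) * qpow (2 * n) * qpow (j - n) * qpow (n + 1) := by
    rw [← qpow_add, ← qpow_add, ← qpow_add, ← qpow_add]; push_cast; ring_nf
  have e3 : qpow (j - n) * qpow (n - j) = 1 := by
    rw [← qpow_add, ← qpow_zero]; ring_nf
  rw [qBinom, qBinom, qBinom, prod_qNum_succ, Finset.prod_range_succ, key, e1, qFact_inv_succ n,
    mul_assoc _ (qpow _) (qpow (2 * (n + 1))), e2]
  generalize qpow (n * (j - 1)) = a1 at *
  generalize (qFact (n + 1))⁻¹ = a2 at *
  generalize ∏ i ∈ Finset.range n, qNum (j - i) = a3 at *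
  rw [pow_succ]
  linear_combination (-(-1) ^ n * a2 * qNum (n + 1) * a3 * a1 * qpow (2 * n)) * e3

theorem qPoch_succ (w : ℂ) (n : ℕ) :
    qpow w * qPoch w n = qpow (2 * n) * (qPoch w n - qPoch w (n + 1)) := by
  have e1 : qpow w = qpow (2 * n) * qpow (w - 2 * n) := by
    rw [← qpow_add]; ring_nf
  rw [qPoch, qPoch, Finset.prod_range_succ, e1]
  ring

theorem qpow_mul_sum_qBinom (j w : ℂ) (n : ℕ) :
    qpow w * ∑ i ∈ Finset.range (n + 1), qBinom j i * qPoch w i =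
      ∑ i ∈ Finset.range (n + 1), qBinom (j + 1) i * qPoch w i -
        qBinom j n * qpow (2 * n) * qPoch w (n + 1) := by
  have key : ∀ i, qpow w * (qBinom j i * qPoch w i) =
      qBinom j i * qpow (2 * i) * (qPoch w i - qPoch w (i + 1)) := fun i => by
    linear_combination qBinom j i * qPoch_succ w i
  induction n with
  | zero =>
    rw [Finset.sum_range_one, Finset.sum_range_one, key, qBinom_zero, qBinom_zero]
    simp [qpow_zero]
  | succ n ih =>
    rw [Finset.sum_range_succ, mul_add, ih, key, Finset.sum_range_succ _ (n + 1), qBinom_succ]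
    push_cast
    ring

/-- The partial sums for `j` and `j + 1` determine each other modulo `hⁿ`, which allows for
induction in both directions. -/
theorem qBinom_sum_mem (j w : ℂ) (s : K) (n : ℕ) :
    qpow w * s - ∑ i ∈ Finset.range n, qBinom (j + 1) i * qPoch w i ∈ hPow K n ↔
      s - ∑ i ∈ Finset.range n, qBinom j i * qPoch w i ∈ hPow K n := by
  rcases n with _ | n
  · simp [hPow]
  have h1 := qpow_mul_sum_qBinom j w n
  have h2 : qBinom j n * qpow (2 * n) * qPoch w (n + 1) ∈ hPow K (n + 1) :=
    Completion.mul_mem_hPow_right (qPoch_mem w (n + 1)) _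
  set P := ∑ i ∈ Finset.range (n + 1), qBinom j i * qPoch w i
  set Q := ∑ i ∈ Finset.range (n + 1), qBinom (j + 1) i * qPoch w i
  have h3 : qpow w * s - Q =
      qpow w * (s - P) - qBinom j n * qpow (2 * n) * qPoch w (n + 1) := by
    linear_combination h1
  rw [h3]
  constructor
  · intro h4
    have h5 := Completion.mul_mem_hPow_right (add_mem h4 h2) (qpow (-w))
    rwa [sub_add_cancel, ← mul_assoc, mul_comm (qpow (-w)), qpow_mul_neg, one_mul] at h5
  · exact fun h4 => sub_mem (Completion.mul_mem_hPow_right h4 _) h2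

/-- The `q`-binomial theorem with an integral exponent of either sign. -/
theorem qBinom_hasAdicSum (j : ℤ) (w : ℂ) :
    HasAdicSum (fun n => qBinom j n * qPoch w n) (qpow (j * w)) := by
  induction j using Int.induction_on with
  | zero =>
    refine HasAdicSum.single.congr fun n => ?_
    rcases n with _ | n
    · simp [qBinom_zero, qPoch, qpow_zero]
    · have : qBinom 0 (n + 1) = 0 := by
        rw [qBinom, Finset.prod_range_succ', Nat.cast_zero, sub_zero, qNum_zero, mul_zero, mul_zero,
          zero_mul]
      simp [this]
  | succ j ih =>
    intro n
    have := (qBinom_sum_mem ((j : ℤ) : ℂ) w (qpow (((j : ℤ) : ℂ) * w)) n).2 (ih n)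
    rw [← qpow_add] at this
    convert this using 3
    · push_cast; ring_nf
    · push_cast; rfl
  | pred j ih =>
    intro n
    refine (qBinom_sum_mem ((-(j : ℤ) - 1 : ℤ) : ℂ) w _ n).1 ?_
    have := ih n
    rw [← qpow_add]
    convert this using 3
    · push_cast; ring_nf
    · push_cast; ring_nf

namespace Uh

/-! ### The two expansions of the ribbon element -/

theorem coeffV_succ (n : ℕ) : coeffV (n + 1) * qNum (n + 1) =
    coeffV n * (qi - q) * qpow (-(n + 2)) := by
  have e1 : qpow (-(((n + 1 : ℕ) : ℂ) * ((n + 1 : ℕ) + 3) / 2)) =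
      qpow (-((n : ℂ) * (n + 3) / 2)) * qpow (-(n + 2)) := by
    rw [← qpow_add]; push_cast; ring_nf
  rw [coeffV, coeffV, e1, qFact_inv_succ n]
  ring

theorem qNum_natCast_succ_ne_zero (n : ℕ) : qNum (n + 1) ≠ 0 := by
  have h1 := qFact_mul_inv n
  rw [qFact_inv_succ] at h1
  exact left_ne_zero_of_mul (right_ne_zero_of_mul_eq_one h1)

/-- At a point `H = c`, `y x = [j] [c + j + 1]`, the values of `yⁿ xⁿ` are the products below, and
the terms of the series for `v` become, up to a common factor, those of a `q`-binomial series. -/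
theorem coeffV_mul_prod (c j : ℂ) (n : ℕ) :
    coeffV n * (qpow (-(n + 1) * c) *
      ∏ i ∈ Finset.range n, qNum (j - i) * qNum (c + j + 1 + i)) =
      qpow (-c) * (qBinom j n * qPoch (-2 * c - 2 * j - 2) n) := by
  induction n with
  | zero => simp [coeffV, qFact, qpow_zero, qBinom_zero, qPoch]
  | succ n ih =>
    refine mul_right_cancel₀ (qNum_natCast_succ_ne_zero n) ?_
    have h1 : qBinom j (n + 1) * qNum (n + 1) = -qBinom j n * qNum (j - n) * qpow (j - 1) := by
      have e1 : qpow (((n + 1 : ℕ) : ℂ) * (j - 1)) = qpow (n * (j - 1)) * qpow (j - 1) := by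
        rw [← qpow_add]; push_cast; ring_nf
      rw [qBinom, qBinom, e1, qFact_inv_succ n, Finset.prod_range_succ]
      ring
    have h2 : qPoch (-2 * c - 2 * j - 2) (n + 1) =
        qPoch (-2 * c - 2 * j - 2) n * (1 - qpow (-2 * c - 2 * j - 2 - 2 * n)) :=
      Finset.prod_range_succ _ _
    have h3 : qpow (-((n + 1 : ℕ) + 1 : ℂ) * c) = qpow (-(n + 1) * c) * qpow (-c) := by
      rw [← qpow_add]; push_cast; ring_nf
    have h4 : qpow (-(n + 2)) * qpow (-c) * ((q - qi) * qNum (c + j + 1 + n)) =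
        qpow (j - 1) - qpow (j - 1) * qpow (-2 * c - 2 * j - 2 - 2 * n) := by
      rw [mul_comm (q - qi), qNum_mul, mul_sub, ← qpow_add, ← qpow_add, ← qpow_add, ← qpow_add]
      ring_nf
    rw [Finset.prod_range_succ, h2, h3]
    linear_combination (qpow (-(n + 1) * c) * qpow (-c) *
        (∏ i ∈ Finset.range n, qNum (j - i) * qNum (c + j + 1 + i)) *
        (qNum (j - n) * qNum (c + j + 1 + n))) * coeffV_succ n -
      (qpow (-c) * qPoch (-2 * c - 2 * j - 2) n * (1 - qpow (-2 * c - 2 * j - 2 - 2 * n))) * h1 -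
      (qNum (j - n) * (qpow (j - 1) - qpow (j - 1) * qpow (-2 * c - 2 * j - 2 - 2 * n))) * ih -
      (coeffV n * qpow (-(n + 1) * c) *
        (∏ i ∈ Finset.range n, qNum (j - i) * qNum (c + j + 1 + i)) * qNum (j - n)) * h4

open TwoVar in
/-- The two-variable function whose value at `(H, y x)` is `yⁿ xⁿ`. -/
def lowerPoly : ℕ → TwoVar
  | 0 => 1
  | n + 1 => lowerPoly n *
      (s - ∑ i ∈ Finset.range n, bracket (t + cst (2 * (i + 1)) • (1 : TwoVar)))

open TwoVar in
/-- The two-variable function whose value at `(H, y x)` is `xⁿ yⁿ`. -/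
def raisePoly : ℕ → TwoVar
  | 0 => 1
  | n + 1 => raisePoly n *
      (s + ∑ i ∈ Finset.range (n + 1), bracket (t + cst (-2 * i) • (1 : TwoVar)))

theorem ev_bracket_shift (c a : ℂ) (d : K) :
    TwoVar.ev (cst c) d (bracket (TwoVar.t + cst a • (1 : TwoVar))) = qNum (c + a) := by
  rw [map_bracket, map_add, map_smul, map_one, TwoVar.ev_t, smul_eq_mul, mul_one, ← map_add, qNum]

theorem sum_qNum_lower (c : ℂ) (n : ℕ) :
    ∑ i ∈ Finset.range n, qNum (c + 2 * (i + 1)) = qNum n * qNum (c + n + 1) := by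
  induction n with
  | zero => simp [qNum_zero]
  | succ n ih =>
    rw [Finset.sum_range_succ, ih]
    apply eq_of_mul_q_sub_qi_sq
    have e1 : qNum (c + 2 * (n + 1)) = qNum (c + 2 * (n + 1)) * qNum 1 := by
      have : qNum 1 = 1 := by
        have := qNum_mul 1
        rw [← q, ← qi] at this
        exact mul_right_cancel₀ q_sub_qi_ne_zero (by rw [this, one_mul])
      rw [this, mul_one]
    rw [e1, add_mul, qNum_mul_qNum, qNum_mul_qNum, qNum_mul_qNum]
    push_cast
    ring_nf

theorem sum_qNum_raise (c : ℂ) (n : ℕ) :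
    ∑ i ∈ Finset.range n, qNum (c + -2 * i) = qNum n * qNum (c - n + 1) := by
  have := sum_qNum_lower (-c - 2) n
  rw [← neg_inj, ← Finset.sum_neg_distrib, ← mul_neg, ← qNum_neg]
  convert this using 2
  · rw [← qNum_neg]; ring_nf
  · ring_nf

theorem ev_lowerPoly (c j : ℂ) (n : ℕ) :
    TwoVar.ev (cst c) (qNum j * qNum (c + j + 1)) (lowerPoly n) =
      ∏ i ∈ Finset.range n, qNum (j - i) * qNum (c + j + 1 + i) := by
  induction n with
  | zero => simp [lowerPoly]
  | succ n ih =>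
    rw [lowerPoly, map_mul, ih, Finset.prod_range_succ, map_sub, TwoVar.ev_s, map_sum]
    simp only [ev_bracket_shift]
    rw [sum_qNum_lower]
    congr 1
    apply eq_of_mul_q_sub_qi_sq
    rw [sub_mul, qNum_mul_qNum, qNum_mul_qNum, qNum_mul_qNum]
    ring_nf

/-- The values are those of `ev_lowerPoly` with `-c` and `-j - 1` in place of `c` and `j`. -/
theorem ev_raisePoly (c j : ℂ) (n : ℕ) :
    TwoVar.ev (cst c) (qNum j * qNum (c + j + 1)) (raisePoly n) =
      ∏ i ∈ Finset.range n, qNum (-j - 1 - i) * qNum (-c + (-j - 1) + 1 + i) := by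
  induction n with
  | zero => simp [raisePoly]
  | succ n ih =>
    rw [raisePoly, map_mul, ih, Finset.prod_range_succ, map_add, TwoVar.ev_s, map_sum]
    simp only [ev_bracket_shift]
    rw [sum_qNum_raise]
    congr 1
    apply eq_of_mul_q_sub_qi_sq
    rw [add_mul, qNum_mul_qNum, qNum_mul_qNum, qNum_mul_qNum]
    push_cast
    ring_nf

/-- The two-variable function whose value at `(H, y x)` is `e^{(h/4) H²} v`. -/
def lowerSum : TwoVar :=
  adicSum (fun n => coeffV n • (hexp (cst (-(n + 1) / 2) • TwoVar.t) * lowerPoly n))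
    (fun n => pow_smul_mem (coeffV_mem n) _)

/-- The two-variable function whose value at `(H, y x)` is `e^{(h/4) H²} S(v)`. -/
def raiseSum : TwoVar :=
  adicSum (fun n => coeffV n • (hexp (cst ((n + 1) / 2) • TwoVar.t) * raisePoly n))
    (fun n => pow_smul_mem (coeffV_mem n) _)

theorem lowerSum_hasAdicSum {B : Type*} [Ring B] [Algebra K B] [IsAdicComplete hIdeal B]
    (φ : TwoVar →ₐ[K] B) : HasAdicSum
      (fun n => coeffV n • (hexp (cst (-(n + 1) / 2) • φ TwoVar.t) * φ (lowerPoly n)))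
      (φ lowerSum) :=
  ((adicSum_hasAdicSum (fun n => coeffV n • (hexp (cst (-(n + 1) / 2) • TwoVar.t) * lowerPoly n))
    (fun n => pow_smul_mem (coeffV_mem n) _)).map φ.toLinearMap).congr fun n => by
    rw [map_smul, AlgHom.toLinearMap_apply, map_mul, map_hexp, map_smul]

theorem raiseSum_hasAdicSum {B : Type*} [Ring B] [Algebra K B] [IsAdicComplete hIdeal B]
    (φ : TwoVar →ₐ[K] B) : HasAdicSum
      (fun n => coeffV n • (hexp (cst ((n + 1) / 2) • φ TwoVar.t) * φ (raisePoly n)))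
      (φ raiseSum) :=
  ((adicSum_hasAdicSum (fun n => coeffV n • (hexp (cst ((n + 1) / 2) • TwoVar.t) * raisePoly n))
    (fun n => pow_smul_mem (coeffV_mem n) _)).map φ.toLinearMap).congr fun n => by
    rw [map_smul, AlgHom.toLinearMap_apply, map_mul, map_hexp, map_smul]

theorem ev_lowerSum (c : ℂ) (j : ℕ) :
    TwoVar.ev (cst c) (qNum j * qNum (c + j + 1)) lowerSum =
      qpow (-(2 * j + 1) * c - 2 * j ^ 2 - 2 * j) := by
  refine (lowerSum_hasAdicSum _).unique ?_
  have h1 := (qBinom_hasAdicSum j (-2 * c - 2 * j - 2)).mul_left (qpow (-c))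
  have h2 : qpow (-c) * qpow ((j : ℤ) * (-2 * c - 2 * j - 2)) =
      qpow (-(2 * j + 1) * c - 2 * j ^ 2 - 2 * j) := by
    rw [← qpow_add]; push_cast; ring_nf
  rw [h2] at h1
  refine h1.congr fun n => ?_
  rw [TwoVar.ev_t, ev_lowerPoly, smul_eq_mul, smul_eq_mul, ← map_mul, hexp_cst, Int.cast_natCast,
    ← coeffV_mul_prod]
  ring_nf

theorem ev_raiseSum (c : ℂ) (j : ℕ) :
    TwoVar.ev (cst c) (qNum j * qNum (c + j + 1)) raiseSum =
      qpow (-(2 * j + 1) * c - 2 * j ^ 2 - 2 * j) := by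
  refine (raiseSum_hasAdicSum _).unique ?_
  have h1 := (qBinom_hasAdicSum (-j - 1) (-2 * -c - 2 * (-j - 1) - 2)).mul_left (qpow (- -c))
  have h2 : qpow (- -c) * qpow (((-j - 1 : ℤ) : ℂ) * (-2 * -c - 2 * (-j - 1) - 2)) =
      qpow (-(2 * j + 1) * c - 2 * j ^ 2 - 2 * j) := by
    rw [← qpow_add]; push_cast; ring_nf
  rw [h2] at h1
  refine h1.congr fun n => ?_
  have h3 : (((-j - 1 : ℤ)) : ℂ) = -j - 1 := by push_cast; rfl
  rw [TwoVar.ev_t, ev_raisePoly, smul_eq_mul, smul_eq_mul, ← map_mul, hexp_cst, h3,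
    ← coeffV_mul_prod]
  ring_nf

theorem constantCoeff_qNum (c : ℂ) : PowerSeries.constantCoeff (qNum c) = c := by
  have h1 : PowerSeries.coeff 1 (qNum c * (q - qi)) = PowerSeries.coeff 1 (qpow c - qpow (-c)) := by
    rw [qNum_mul]
  have h2 : PowerSeries.coeff 1 (qNum c * (q - qi)) = PowerSeries.constantCoeff (qNum c) := by
    rw [PowerSeries.coeff_mul, Finset.Nat.sum_antidiagonal_eq_sum_range_succ_mk]
    simp [Finset.sum_range_succ, q, qi, qpow]
    norm_num
  rw [← h2, h1]
  simp [qpow]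
  ring

/-- At `H = c`, `y x = [j] [c + j + 1]`, the first series is a `q`-binomial series with exponent `j`
and the second one with exponent `-j - 1`; both have the same sum. -/
theorem lowerSum_eq_raiseSum : lowerSum = raiseSum := by
  -- The shift of `j` makes the constant terms `j (c + j + 1)` pairwise distinct.
  refine TwoVar.ext_of_eval
    (d := fun c j => qNum ((j + ⌈‖c‖⌉₊ : ℕ) : ℂ) * qNum (c + ((j + ⌈‖c‖⌉₊ : ℕ) : ℂ) + 1))
    (fun c => Set.infinite_range_of_injective fun i j hij => ?_) fun c j => ?_
  · simp only [map_mul, constantCoeff_qNum] at hij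
    set N := ⌈‖c‖⌉₊
    have h1 : (((i : ℂ) - j)) * (c + (i + N : ℕ) + (j + N : ℕ) + 1) = 0 := by
      push_cast at hij ⊢
      linear_combination hij
    rcases mul_eq_zero.1 h1 with h2 | h2
    · exact_mod_cast sub_eq_zero.1 h2
    · exfalso
      have h3 := congrArg Complex.re h2
      simp only [Complex.add_re, Complex.natCast_re, Complex.one_re, Complex.zero_re] at h3
      have h4 : -‖c‖ ≤ c.re := (abs_le.1 (Complex.abs_re_le_norm c)).1
      have h5 : ‖c‖ ≤ N := Nat.le_ceil _
      push_cast at h3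
      have h6 : (0 : ℝ) ≤ i := Nat.cast_nonneg i
      have h7 : (0 : ℝ) ≤ j := Nat.cast_nonneg j
      have h8 : (0 : ℝ) ≤ N := Nat.cast_nonneg N
      linarith
  · rw [ev_lowerSum, ev_raiseSum]

theorem bracket_shift_mul {z : Uh} {w : ℂ} (hz : H * z = z * (H + cst w • 1)) (a : ℂ) :
    bracket (H + cst a • 1) * z = z * bracket (H + cst (a + w) • 1) := by
  refine bracket_intertwine ?_
  rw [add_mul, hz, show cst (a + w) = cst a + cst w from map_add _ _ _]
  simp only [mul_add, add_smul, smul_mul_assoc, mul_smul_comm, one_mul, mul_one]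
  abel

theorem yx_mul_x_pow (n : ℕ) : y * x * x ^ n =
    x ^ n * (y * x - ∑ i ∈ Finset.range n, bracket (H + cst (2 * (i + 1)) • 1)) := by
  induction n with
  | zero => simp
  | succ n ih =>
    have h0 : y * x * x = x * (y * x - bracket (H + cst 2 • 1)) := by
      have h1 := bracket_shift_mul H_weight_x 0
      rw [show cst 0 = 0 from map_zero _, zero_smul, add_zero, zero_add] at h1
      rw [mul_sub, ← h1, ← x_mul_y]
      noncomm_ring
    have h1 : (∑ i ∈ Finset.range n, bracket (H + cst (2 * (i + 1)) • 1)) * x =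
        x * ∑ i ∈ Finset.range n, bracket (H + cst (2 * ((i + 1 : ℕ) + 1)) • 1) := by
      rw [Finset.sum_mul, Finset.mul_sum]
      refine Finset.sum_congr rfl fun i _ => ?_
      rw [bracket_shift_mul H_weight_x]
      push_cast
      ring_nf
    rw [pow_succ, ← mul_assoc, ih, mul_assoc, sub_mul, h0, h1, Finset.sum_range_succ',
      ← mul_sub, ← mul_assoc, Nat.cast_zero, zero_add, mul_one, sub_sub, add_comm (bracket _)]

theorem xy_mul_y_pow (n : ℕ) : x * y * y ^ n =
    y ^ n * (y * x + ∑ i ∈ Finset.range (n + 1), bracket (H + cst (-2 * i) • 1)) := by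
  induction n with
  | zero =>
    simp only [pow_zero, mul_one, one_mul, zero_add, Finset.sum_range_one, Nat.cast_zero, mul_zero]
    rw [show cst 0 = 0 from map_zero _, zero_smul, add_zero, ← x_mul_y]
    abel
  | succ n ih =>
    have h0 : y * x * y = y * (y * x + bracket H) := by
      rw [← x_mul_y]
      noncomm_ring
    have h1 : (∑ i ∈ Finset.range (n + 1), bracket (H + cst (-2 * i) • 1)) * y =
        y * ∑ i ∈ Finset.range (n + 1), bracket (H + cst (-2 * (i + 1 : ℕ)) • 1) := by
      rw [Finset.sum_mul, Finset.mul_sum]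
      refine Finset.sum_congr rfl fun i _ => ?_
      rw [bracket_shift_mul H_weight_y]
      push_cast
      ring_nf
    rw [pow_succ, ← mul_assoc, ih, mul_assoc, add_mul, h0, h1, Finset.sum_range_succ' _ (n + 1),
      ← mul_add, ← mul_assoc, Nat.cast_zero, mul_zero, show cst 0 = 0 from map_zero _, zero_smul,
      add_zero]
    abel_nf

theorem H_commute_yx : Commute H (y * x) := by
  simpa using H_commute_y_pow_mul_x_pow 1

theorem subst_bracket_shift (a : ℂ) :
    TwoVar.subst H_commute_yx (bracket (TwoVar.t + cst a • (1 : TwoVar))) =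
      bracket (H + cst a • 1) := by
  rw [map_bracket, map_add, map_smul, map_one, TwoVar.subst_t]

theorem subst_lowerPoly (n : ℕ) : TwoVar.subst H_commute_yx (lowerPoly n) = y ^ n * x ^ n := by
  induction n with
  | zero => simp [lowerPoly]
  | succ n ih =>
    rw [lowerPoly, map_mul, ih, map_sub, TwoVar.subst_s, map_sum]
    simp only [subst_bracket_shift]
    rw [mul_assoc, ← yx_mul_x_pow, pow_succ y, pow_succ' x]
    simp only [mul_assoc]

theorem subst_raisePoly (n : ℕ) : TwoVar.subst H_commute_yx (raisePoly n) = x ^ n * y ^ n := by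
  induction n with
  | zero => simp [raisePoly]
  | succ n ih =>
    rw [raisePoly, map_mul, ih, map_add, TwoVar.subst_s, map_sum]
    simp only [subst_bracket_shift]
    rw [mul_assoc, ← xy_mul_y_pow, pow_succ x, pow_succ' y]
    simp only [mul_assoc]

theorem antipode_gauss : unopLin antipodeHom gauss = gauss := by
  rw [gauss, unopLin_hexp, map_smul, unopLin_pow, antipodeHom_H, neg_sq]

/-- The antipode exchanges the two expansions of the ribbon element. -/
theorem antipode_v : unopLin antipodeHom v = v := by
  have h1 : gauss * TwoVar.subst H_commute_yx lowerSum = v := by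
    refine (((lowerSum_hasAdicSum (TwoVar.subst H_commute_yx)).mul_left gauss).congr
      fun n => ?_).unique v_hasAdicSum
    rw [mul_smul_comm, subst_lowerPoly, TwoVar.subst_t, kpow]
    ring_nf
  have h2 : gauss * TwoVar.subst H_commute_yx raiseSum = unopLin antipodeHom v := by
    refine (((raiseSum_hasAdicSum (TwoVar.subst H_commute_yx)).mul_left gauss).congr
      fun n => ?_).unique (v_hasAdicSum.map (unopLin antipodeHom))
    have e1 : unopLin antipodeHom (y ^ n * x ^ n) = x ^ n * y ^ n := by
      rw [unopLin_mul, unopLin_pow, unopLin_pow, antipodeHom_x, antipodeHom_y, ← smul_neg,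
        ← smul_neg, smul_pow, smul_pow, smul_mul_smul_comm, ← mul_pow, q_mul_qi, one_pow, one_smul,
        neg_pow, neg_pow y]
      have : ((-1 : Uh) ^ n) * ((-1) ^ n) = 1 := by
        rw [← pow_add, Even.neg_one_pow ⟨n, rfl⟩]
      rw [mul_assoc, ← mul_assoc (x ^ n), ((Commute.neg_one_right (x ^ n)).pow_right n).eq,
        mul_assoc, ← mul_assoc, this, one_mul]
    have h3 := H_commute_x_pow_mul_y_pow n
    rw [mul_smul_comm, subst_raisePoly, TwoVar.subst_t, map_smul, unopLin_mul, unopLin_mul, e1,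
      anti_kpow antipodeHom_H, antipode_gauss,
      ← (kpow_commute h3 _).eq, ← (gauss_commute ((H_commute_kpow _).mul_right h3)).eq, kpow]
    ring_nf
  rw [← h2, ← h1, lowerSum_eq_raiseSum]

end Uh

/-! ### Sandwich products -/

section Sandwich

variable {C D B : Type*} [Ring C] [Algebra K C] [Ring D] [Algebra K D] [Ring B] [Algebra K B]
  [IsAdicComplete hIdeal B]

/-- For linear maps `φ, ψ` and an element `t`, the map `c ⊗ d ↦ φ(d) t ψ(c)` on the completed
tensor product. -/
def sandwich (φ : D →ₗ[K] B) (ψ : C →ₗ[K] B) (t : B) : Completion (C ⊗[K] D) →ₗ[K] B :=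
  Completion.extend (LinearMap.mul' K B ∘ₗ TensorProduct.map φ (LinearMap.mulLeft K t ∘ₗ ψ) ∘ₗ
    (TensorProduct.comm K C D).toLinearMap)

theorem sandwich_of (φ : D →ₗ[K] B) (ψ : C →ₗ[K] B) (t : B) (c : C) (d : D) :
    sandwich φ ψ t (Completion.of _ (c ⊗ₜ d)) = φ d * (t * ψ c) := by
  rw [sandwich, Completion.extend_of]
  rfl

variable {A : Type*} [Ring A] [Algebra K A]

theorem sandwich_ten (φ ψ : A →ₗ[K] B) (t : B) (a b : A) :
    sandwich φ ψ t (ten a b) = φ b * (t * ψ a) :=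
  sandwich_of φ ψ t a b

end Sandwich

/-! ### The antipode on tensor squares -/

section Anti

variable {A : Type*} [Ring A] [Algebra K A] (S : A →ₐ[K] Aᵐᵒᵖ)

/-- For an anti-homomorphism `S`, the map `S ⊗ S` on the completed tensor square. -/
def antiTen : CT2 A →ₗ[K] CT2 A :=
  Completion.mapLin (TensorProduct.map (unopLin S) (unopLin S))

theorem antiTen_ten (a b : A) : antiTen S (ten a b) = ten (unopLin S a) (unopLin S b) :=
  Completion.mapLin_of _ _

theorem antiTen_mul (z w : CT2 A) : antiTen S (z * w) = antiTen S w * antiTen S z := by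
  refine ten_linearMap_ext (f := antiTen S ∘ₗ LinearMap.mulLeft K z)
    (g := LinearMap.mulRight K (antiTen S z) ∘ₗ antiTen S) (fun c d => ?_) w
  refine ten_linearMap_ext (f := antiTen S ∘ₗ LinearMap.mulRight K (ten c d))
    (g := LinearMap.mulLeft K (antiTen S (ten c d)) ∘ₗ antiTen S) (fun a b => ?_) z
  simp [ten_mul, antiTen_ten, unopLin_mul]

theorem twist_antiTen (z : CT2 A) : twist (antiTen S z) = antiTen S (twist z) :=
  ten_linearMap_ext (f := twist.toLinearMap ∘ₗ antiTen S) (g := antiTen S ∘ₗ twist.toLinearMap)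
    (fun a b => by simp [antiTen_ten, twist_ten]) z

theorem twist_twist (z : CT2 A) : twist (twist z) = z :=
  ten_linearMap_ext (f := twist.toLinearMap ∘ₗ twist.toLinearMap) (g := LinearMap.id)
    (fun a b => by simp [twist_ten]) z

end Anti

namespace Uh

/-- The antipode of `U_h(sl₂)`, as a linear map. -/
abbrev antipodeLin : Uh →ₗ[K] Uh := unopLin antipodeHom

theorem comul_antipode (a : Uh) :
    comulHom (antipodeLin a) = antiTen antipodeHom (twist (comulHom a)) := by
  refine DFunLike.congr_fun (linearMap_ext_of_mul
    (f := comulHom.toLinearMap ∘ₗ antipodeLin)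
    (g := antiTen antipodeHom ∘ₗ twist.toLinearMap ∘ₗ comulHom.toLinearMap) ?_
    (fun a b ha hb => ?_) ?_ ?_ ?_) a
  · simp [unopLin_one, ← ten_one, twist_ten, antiTen_ten]
  · simp only [LinearMap.comp_apply, AlgHom.toLinearMap_apply] at ha hb ⊢
    rw [unopLin_mul, map_mul, map_mul, map_mul, antiTen_mul, ha, hb]
  · simp only [LinearMap.comp_apply, AlgHom.toLinearMap_apply]
    rw [comulHom_H, antipodeHom_H, map_neg, comulHom_H, map_add, map_add, twist_ten, twist_ten,
      antiTen_ten, antiTen_ten, unopLin_one, antipodeHom_H, ten_neg_left, ten_neg_right, neg_add,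
      add_comm]
  · simp only [LinearMap.comp_apply, AlgHom.toLinearMap_apply]
    rw [comulHom_x, antipodeHom_x, map_neg, map_smul, comulHom_x, map_add, map_add, twist_ten,
      twist_ten, antiTen_ten, antiTen_ten, antipodeHom_x, anti_kpow antipodeHom_H,
      anti_kpow antipodeHom_H, ten_neg_left, ten_neg_right, ten_smul_left, ten_smul_right, smul_add,
      neg_add, neg_neg, add_comm]
  · simp only [LinearMap.comp_apply, AlgHom.toLinearMap_apply]
    rw [comulHom_y, antipodeHom_y, map_neg, map_smul, comulHom_y, map_add, map_add, twist_ten,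
      twist_ten, antiTen_ten, antiTen_ten, antipodeHom_y, anti_kpow antipodeHom_H,
      anti_kpow antipodeHom_H, ten_neg_left, ten_neg_right, ten_smul_left, ten_smul_right, smul_add,
      neg_add, neg_neg, add_comm]

/-- The anti-homomorphism `(S ⊗ S) ∘ Δ`. -/
def antiComul : Uh →ₗ[K] CT2 Uh := antiTen antipodeHom ∘ₗ comulHom.toLinearMap

theorem antiComul_apply (a : Uh) : antiComul a = antiTen antipodeHom (comulHom a) := rfl

theorem antiComul_mul (a b : Uh) : antiComul (a * b) = antiComul b * antiComul a := by
  rw [antiComul_apply, map_mul, antiTen_mul]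
  rfl

/-- This combines `Δ ∘ S = (S ⊗ S) ∘ τ ∘ Δ` and `τ(Δ(a)) R = R Δ(a)`. -/
theorem antiComul_mul_R (a : Uh) : antiComul a * R = R * comulHom (antipodeLin a) := by
  rw [← twist_comul_mul_R, comul_antipode, twist_antiTen, twist_twist, antiComul_apply]

/-! ### The coproduct of the Drinfeld element -/

/-- For `z = ∑ a ⊗ b`, this is `R Δ(∑ S(b) a) = ∑ (S ⊗ S)(Δ(b)) R Δ(a)`. -/
theorem R_mul_comul_mulMap (z : CT2 Uh) :
    R * comulHom (mulMap antipodeLin LinearMap.id (twist z)) =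
      sandwich antiComul comulHom.toLinearMap R z :=
  ten_linearMap_ext (f := LinearMap.mulLeft K R ∘ₗ comulHom.toLinearMap ∘ₗ
      mulMap antipodeLin LinearMap.id ∘ₗ twist.toLinearMap)
    (g := sandwich antiComul comulHom.toLinearMap R) (fun a b => by
      simp only [LinearMap.comp_apply, AlgHom.toLinearMap_apply, LinearMap.mulLeft_apply]
      rw [twist_ten, mulMap_ten, map_mul, ← mul_assoc, ← antiComul_mul_R, sandwich_ten, mul_assoc]
      rfl) z

/-- The map `a ⊗ b ⊗ c ↦ (S ⊗ S)(Δ(c)) t (a ⊗ b)`. -/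
def sandwichLeft (t : CT2 Uh) : CT3 Uh →ₗ[K] CT2 Uh :=
  sandwich antiComul (Completion.of (Uh ⊗[K] Uh)).toLinearMap t

theorem sandwichLeft_ten3 (t : CT2 Uh) (a b c : Uh) :
    sandwichLeft t (ten3 a b c) = antiComul c * (t * ten a b) :=
  sandwich_of _ _ _ _ _

theorem sandwichLeft_leg12_mul (t z : CT2 Uh) (c : Uh) :
    sandwichLeft t (leg12 z * ten3 1 1 c) = antiComul c * (t * z) :=
  ten_linearMap_ext (f := sandwichLeft t ∘ₗ LinearMap.mulRight K (ten3 1 1 c) ∘ₗ leg12.toLinearMap)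
    (g := LinearMap.mulLeft K (antiComul c) ∘ₗ LinearMap.mulLeft K t) (fun a b => by
      simp [leg12_ten, ten3_mul, sandwichLeft_ten3]) z

theorem sandwichLeft_tensorIdHom (t z : CT2 Uh) :
    sandwichLeft t (tensorIdHom comulHom z) = sandwich antiComul comulHom.toLinearMap t z :=
  ten_linearMap_ext (f := sandwichLeft t ∘ₗ (tensorIdHom comulHom).toLinearMap)
    (g := sandwich antiComul comulHom.toLinearMap t) (fun a b => by
      simp [tensorIdHom_ten, sandwichLeft_leg12_mul, sandwich_ten]) z

/-- With `sandwichLeft_tensorIdHom`, the identity `(Δ ⊗ id)(R) = R₁₃ R₂₃` splits the sandwich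
product by `R` into one over the first and one over the second tensor factor. -/
theorem sandwichLeft_mul (t z w : CT2 Uh) :
    sandwichLeft t (leg13 z * leg23 w) = sandwich antiComul inr.toLinearMap
      (sandwich antiComul inl.toLinearMap t z) w := by
  refine ten_linearMap_ext (f := sandwichLeft t ∘ₗ LinearMap.mulLeft K (leg13 z) ∘ₗ
    leg23.toLinearMap) (g := sandwich antiComul inr.toLinearMap _) (fun c d => ?_) w
  refine (ten_linearMap_ext (f := sandwichLeft t ∘ₗ LinearMap.mulRight K (leg23 (ten c d)) ∘ₗ
    leg13.toLinearMap) (g := LinearMap.mulLeft K (antiComul d) ∘ₗ LinearMap.mulRight K (inr c) ∘ₗ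
      sandwich antiComul inl.toLinearMap t) (fun a b => ?_) z).trans ?_
  · simp [leg13_ten, leg23_ten, ten3_mul, sandwichLeft_ten3, sandwich_ten, antiComul_mul, inl_apply,
      inr_apply, ten_mul, mul_assoc]
  · simp [sandwich_ten]

/-- The map `a ⊗ b ⊗ c ↦ (S(b) ⊗ S(c)) t ι(a)`. -/
def sandwichRight (ι : Uh →ₐ[K] CT2 Uh) (t : CT2 Uh) : CT3 Uh →ₗ[K] CT2 Uh :=
  sandwich (inr.toLinearMap ∘ₗ antipodeLin)
    (sandwich (inl.toLinearMap ∘ₗ antipodeLin) ι.toLinearMap t ∘ₗ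
      (Completion.of (Uh ⊗[K] Uh)).toLinearMap) 1

theorem sandwichRight_ten3 (ι : Uh →ₐ[K] CT2 Uh) (t : CT2 Uh) (a b c : Uh) :
    sandwichRight ι t (ten3 a b c) = ten (antipodeLin b) (antipodeLin c) * (t * ι a) := by
  refine (sandwich_of _ _ _ _ _).trans ?_
  rw [one_mul, LinearMap.comp_apply, AlgHom.toLinearMap_apply]
  refine (congrArg _ (sandwich_of _ _ _ _ _)).trans ?_
  change inr _ * (inl _ * (t * ι a)) = _
  rw [← mul_assoc, inl_apply, inr_apply, ten_mul, one_mul, mul_one]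

theorem sandwichRight_mul_leg23 (ι : Uh →ₐ[K] CT2 Uh) (t z : CT2 Uh) (a : Uh) :
    sandwichRight ι t (ten3 a 1 1 * leg23 z) = antiTen antipodeHom z * (t * ι a) :=
  ten_linearMap_ext (f := sandwichRight ι t ∘ₗ LinearMap.mulLeft K (ten3 a 1 1) ∘ₗ
      leg23.toLinearMap)
    (g := LinearMap.mulRight K (t * ι a) ∘ₗ antiTen antipodeHom) (fun b c => by
      simp [leg23_ten, ten3_mul, sandwichRight_ten3, antiTen_ten, mul_assoc]) z

theorem sandwichRight_idTensorHom (ι : Uh →ₐ[K] CT2 Uh) (t z : CT2 Uh) :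
    sandwichRight ι t (idTensorHom comulHom z) = sandwich antiComul ι.toLinearMap t z :=
  ten_linearMap_ext (f := sandwichRight ι t ∘ₗ (idTensorHom comulHom).toLinearMap)
    (g := sandwich antiComul ι.toLinearMap t) (fun a b => by
      simp [idTensorHom_ten, sandwichRight_mul_leg23, sandwich_ten, antiComul_apply]) z

/-- With `sandwichRight_idTensorHom`, the identity `(id ⊗ Δ)(R) = R₁₃ R₁₂` splits the sandwich
product by `R` once more. -/
theorem sandwichRight_mul (ι : Uh →ₐ[K] CT2 Uh) (t z w : CT2 Uh) :
    sandwichRight ι t (leg13 z * leg12 w) =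
      sandwich (inl.toLinearMap ∘ₗ antipodeLin) ι.toLinearMap
        (sandwich (inr.toLinearMap ∘ₗ antipodeLin) ι.toLinearMap t z) w := by
  refine ten_linearMap_ext (f := sandwichRight ι t ∘ₗ LinearMap.mulLeft K (leg13 z) ∘ₗ
    leg12.toLinearMap) (g := sandwich _ ι.toLinearMap _) (fun c d => ?_) w
  refine (ten_linearMap_ext (f := sandwichRight ι t ∘ₗ LinearMap.mulRight K (leg12 (ten c d)) ∘ₗ
    leg13.toLinearMap) (g := LinearMap.mulLeft K (inl (antipodeLin d)) ∘ₗ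
      LinearMap.mulRight K (ι c) ∘ₗ sandwich (inr.toLinearMap ∘ₗ antipodeLin) ι.toLinearMap t)
      (fun a b => ?_) z).trans ?_
  · have h1 : ten (antipodeLin d) (antipodeLin b) =
        ten (antipodeLin d) 1 * ten 1 (antipodeLin b) := by simp [ten_mul]
    simp [leg13_ten, leg12_ten, ten3_mul, sandwichRight_ten3, sandwich_ten, inl_apply,
      inr_apply, h1, mul_assoc]
  · simp [sandwich_ten]

/-- The map `a ⊗ b ⊗ c ↦ a ⊗ S(b) c`. -/
def contractRight : CT3 Uh →ₗ[K] CT2 Uh :=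
  Completion.extend (LinearMap.mul' K (CT2 Uh) ∘ₗ TensorProduct.map
    ((Completion.of (Uh ⊗[K] Uh)).toLinearMap ∘ₗ TensorProduct.map LinearMap.id antipodeLin)
    inr.toLinearMap)

theorem contractRight_ten3 (a b c : Uh) :
    contractRight (ten3 a b c) = ten a (antipodeLin b * c) := by
  rw [contractRight, ten3, Completion.extend_of]
  change ten a (antipodeLin b) * ten 1 c = _
  rw [ten_mul, mul_one]

theorem contractRight_mul_leg23 (a : Uh) (z : CT2 Uh) :
    contractRight (ten3 a 1 1 * leg23 z) = ten a (mulMap antipodeLin LinearMap.id z) := by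
  have h1 := ten_linearMap_ext (f := contractRight ∘ₗ LinearMap.mulLeft K (ten3 a 1 1) ∘ₗ
    leg23.toLinearMap) (g := LinearMap.mulLeft K (ten a 1) ∘ₗ inr.toLinearMap ∘ₗ
      mulMap antipodeLin LinearMap.id) (fun b c => by
      simp [leg23_ten, ten3_mul, contractRight_ten3, mulMap_ten, inr_apply, ten_mul]) z
  refine h1.trans ?_
  simp [inr_apply, ten_mul]

theorem contractRight_idTensorHom (z : CT2 Uh) :
    contractRight (idTensorHom comulHom z) = inl (characterRight counitHom z) :=
  ten_linearMap_ext (f := contractRight ∘ₗ (idTensorHom comulHom).toLinearMap)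
    (g := inl.toLinearMap ∘ₗ (characterRight counitHom).toLinearMap) (fun a b => by
      simp only [LinearMap.comp_apply, AlgHom.toLinearMap_apply]
      rw [idTensorHom_ten, contractRight_mul_leg23, comulHom_antipode_left, characterRight_ten,
        Algebra.algebraMap_eq_smul_one, ten_smul_right, map_smul, inl_apply]) z

theorem contractRight_mul (z w : CT2 Uh) : contractRight (leg13 z * leg12 w) =
    sandwich (inr.toLinearMap ∘ₗ antipodeLin) inl.toLinearMap z w := by
  refine ten_linearMap_ext (f := contractRight ∘ₗ LinearMap.mulLeft K (leg13 z) ∘ₗ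
    leg12.toLinearMap) (g := sandwich _ _ z) (fun c d => ?_) w
  refine (ten_linearMap_ext (f := contractRight ∘ₗ LinearMap.mulRight K (leg12 (ten c d)) ∘ₗ
    leg13.toLinearMap) (g := LinearMap.mulLeft K (inr (antipodeLin d)) ∘ₗ
      LinearMap.mulRight K (inl c)) (fun a b => ?_) z).trans ?_
  · simp [leg13_ten, leg12_ten, ten3_mul, contractRight_ten3, inl_apply, inr_apply, ten_mul]
  · simp [sandwich_ten]

theorem characterRight_R : characterRight counitHom R = 1 := by
  have h1 : characterRight counitHom quasiR = 1 :=
    ((quasiR_hasAdicSum.map (characterRight counitHom).toLinearMap).congr fun n => by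
      rw [map_smul, AlgHom.toLinearMap_apply, map_pow, characterRight_ten, f, map_mul, counitHom_y,
        mul_zero, zero_smul]
      rcases n with _ | n
      · simp [coeffR_zero]
      · simp).unique HasAdicSum.single
  rw [R_eq, map_mul, h1, cartan, map_hexp, map_smul, characterRight_ten, counitHom_H, zero_smul,
    smul_zero, hexp_zero, mul_one]

/-- The identity `∑ αⱼ αᵢ ⊗ S(βᵢ) βⱼ = 1`, that is, `(id ⊗ S⁻¹)(R) = R⁻¹`. -/
theorem sandwich_inr_inl_R :
    sandwich (inr.toLinearMap ∘ₗ antipodeLin) inl.toLinearMap R R = 1 := by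
  rw [← contractRight_mul, ← idTensorHom_R, contractRight_idTensorHom, characterRight_R, map_one]

theorem sandwich_inl_inl (z : CT2 Uh) :
    sandwich (inl.toLinearMap ∘ₗ antipodeLin) inl.toLinearMap 1 z =
      ten (mulMap antipodeLin LinearMap.id (twist z)) 1 :=
  ten_linearMap_ext (f := sandwich _ _ 1) (g := inl.toLinearMap ∘ₗ
    mulMap antipodeLin LinearMap.id ∘ₗ twist.toLinearMap) (fun a b => by
      simp [sandwich_ten, twist_ten, mulMap_ten]) z

theorem sandwich_inr_inr (c : Uh) (z : CT2 Uh) :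
    sandwich (inr.toLinearMap ∘ₗ antipodeLin) inr.toLinearMap (ten c 1) z =
      ten c (mulMap antipodeLin LinearMap.id (twist z)) := by
  refine (ten_linearMap_ext (f := sandwich _ _ (ten c 1)) (g := LinearMap.mulLeft K (ten c 1) ∘ₗ
    inr.toLinearMap ∘ₗ mulMap antipodeLin LinearMap.id ∘ₗ twist.toLinearMap) (fun a b => by
      simp [sandwich_ten, twist_ten, mulMap_ten, inr_apply, ten_mul]) z).trans ?_
  simp [inr_apply, ten_mul]

theorem antipode_antipode (a : Uh) : antipodeLin (antipodeLin a) = kpow 2 * a * kpow (-2) := by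
  refine DFunLike.congr_fun (linearMap_ext_of_mul (f := antipodeLin ∘ₗ antipodeLin)
    (g := LinearMap.mulRight K (kpow (-2)) ∘ₗ LinearMap.mulLeft K (kpow 2)) ?_
    (fun a b ha hb => ?_) ?_ ?_ ?_) a
  · simp [unopLin_one, kpow_mul_neg]
  · simp only [LinearMap.comp_apply, LinearMap.mulLeft_apply, LinearMap.mulRight_apply] at ha hb ⊢
    rw [unopLin_mul, unopLin_mul, ha, hb]
    have : kpow 2 * a * kpow (-2) * (kpow 2 * b * kpow (-2)) =
      kpow 2 * a * (kpow (-2) * kpow 2) * b * kpow (-2) := by noncomm_ring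
    rw [this, kpow_neg_mul]
    noncomm_ring
  · simp only [LinearMap.comp_apply, LinearMap.mulLeft_apply, LinearMap.mulRight_apply]
    rw [antipodeHom_H, map_neg, antipodeHom_H, neg_neg, ← (H_commute_kpow 2).eq, mul_assoc,
      kpow_mul_neg, mul_one]
  · simp only [LinearMap.comp_apply, LinearMap.mulLeft_apply, LinearMap.mulRight_apply]
    rw [antipodeHom_x, map_neg, map_smul, antipodeHom_x, kpow_mul_x, smul_mul_assoc, mul_assoc,
      kpow_mul_neg, mul_one, smul_neg, neg_neg, smul_smul, q, ← qpow_add]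
    norm_num
  · simp only [LinearMap.comp_apply, LinearMap.mulLeft_apply, LinearMap.mulRight_apply]
    rw [antipodeHom_y, map_neg, map_smul, antipodeHom_y, kpow_mul_y, smul_mul_assoc, mul_assoc,
      kpow_mul_neg, mul_one, smul_neg, neg_neg, smul_smul, qi, ← qpow_add]
    norm_num

/-- The inverse of the antipode, `a ↦ k⁻² S(a) k²`. -/
def antipodeInv : Uh →ₗ[K] Uh :=
  LinearMap.mulRight K (kpow 2) ∘ₗ LinearMap.mulLeft K (kpow (-2)) ∘ₗ antipodeLin

theorem antipodeInv_apply (a : Uh) : antipodeInv a = kpow (-2) * antipodeLin a * kpow 2 := rfl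

theorem antipodeInv_antipode (a : Uh) : antipodeInv (antipodeLin a) = a := by
  rw [antipodeInv_apply, antipode_antipode]
  have : kpow (-2) * (kpow 2 * a * kpow (-2)) * kpow 2 =
    (kpow (-2) * kpow 2) * a * (kpow (-2) * kpow 2) := by noncomm_ring
  rw [this, kpow_neg_mul, one_mul, mul_one]

theorem antipodeInv_mul (a b : Uh) : antipodeInv (a * b) = antipodeInv b * antipodeInv a := by
  rw [antipodeInv_apply, antipodeInv_apply, antipodeInv_apply, unopLin_mul]
  have : kpow (-2) * antipodeLin b * kpow 2 * (kpow (-2) * antipodeLin a * kpow 2) =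
    kpow (-2) * antipodeLin b * (kpow 2 * kpow (-2)) * antipodeLin a * kpow 2 := by noncomm_ring
  rw [this, kpow_mul_neg]
  noncomm_ring

theorem antipodeInv_one : antipodeInv 1 = 1 := by
  rw [antipodeInv_apply, unopLin_one, mul_one, kpow_neg_mul]

/-- The map `a ⊗ b ↦ S⁻¹(b) ⊗ a`. -/
def twistInv : CT2 Uh →ₗ[K] CT2 Uh :=
  Completion.mapLin (TensorProduct.map antipodeInv LinearMap.id) ∘ₗ twist.toLinearMap

theorem twistInv_ten (a b : Uh) : twistInv (ten a b) = ten (antipodeInv b) a := by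
  rw [twistInv, LinearMap.comp_apply, AlgHom.toLinearMap_apply, twist_ten]
  exact Completion.mapLin_of _ _

theorem twistInv_sandwich (z w : CT2 Uh) :
    twistInv (sandwich (inr.toLinearMap ∘ₗ antipodeLin) inl.toLinearMap z w) =
      twistInv z * twist w := by
  refine ten_linearMap_ext (f := twistInv ∘ₗ sandwich _ _ z)
    (g := LinearMap.mulLeft K (twistInv z) ∘ₗ twist.toLinearMap) (fun c d => ?_) w
  refine (LinearMap.comp_apply _ _ _).trans ?_
  rw [sandwich_ten]
  refine ten_linearMap_ext (f := twistInv ∘ₗ LinearMap.mulLeft K (inr (antipodeLin d)) ∘ₗ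
      LinearMap.mulRight K (inl c))
    (g := LinearMap.mulRight K (twist (ten c d)) ∘ₗ twistInv) (fun a b => ?_) z
  simp [inl_apply, inr_apply, ten_mul, twistInv_ten, twist_ten, antipodeInv_mul,
    antipodeInv_antipode]

/-- The twist of `(id ⊗ S⁻¹)(R) = R⁻¹`. -/
theorem twistInv_R_mul_twist_R : twistInv R * twist R = 1 := by
  rw [← twistInv_sandwich, sandwich_inr_inl_R, ← ten_one, twistInv_ten, antipodeInv_one]

theorem drinfeld_eq : drinfeld = kpow 2 * v := by
  rw [v_eq, ← mul_assoc, kpow_mul_neg, one_mul]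

/-- As `u = k² v` with `v` central, `u` intertwines `S` and `S⁻¹`. -/
theorem antipode_mul_drinfeld (a : Uh) : antipodeLin a * drinfeld = drinfeld * antipodeInv a := by
  rw [antipodeInv_apply, drinfeld_eq, mul_assoc (kpow 2), v_central, ← mul_assoc (kpow 2),
    ← mul_assoc (kpow 2), ← mul_assoc (kpow 2), kpow_mul_neg, one_mul, mul_assoc]

theorem sandwich_inl_inr (z : CT2 Uh) :
    sandwich (inl.toLinearMap ∘ₗ antipodeLin) inr.toLinearMap (ten drinfeld drinfeld) z =
      ten drinfeld drinfeld * twistInv z :=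
  ten_linearMap_ext (f := sandwich _ _ _) (g := LinearMap.mulLeft K _ ∘ₗ twistInv) (fun a b => by
    simp [sandwich_ten, inl_apply, inr_apply, ten_mul, twistInv_ten, antipode_mul_drinfeld]) z

theorem sandwich_antiComul_R (ι : Uh →ₐ[K] CT2 Uh) (t : CT2 Uh) :
    sandwich antiComul ι.toLinearMap t R = sandwich (inl.toLinearMap ∘ₗ antipodeLin) ι.toLinearMap
      (sandwich (inr.toLinearMap ∘ₗ antipodeLin) ι.toLinearMap t R) R := by
  rw [← sandwichRight_idTensorHom, idTensorHom_R, sandwichRight_mul]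

theorem R_mul_comul_drinfeld :
    R * comulHom drinfeld = ten drinfeld drinfeld * twistInv R := by
  rw [← sandwich_inl_inr, drinfeld, R_mul_comul_mulMap, ← sandwichLeft_tensorIdHom, tensorIdHom_R,
    sandwichLeft_mul, sandwich_antiComul_R, sandwich_antiComul_R, sandwich_inr_inl_R,
    sandwich_inl_inl, sandwich_inr_inr]

/-! ### The ribbon structure -/

theorem ten_v_central (z : CT2 Uh) : ten v v * z = z * ten v v :=
  ten_linearMap_ext (f := LinearMap.mulLeft K (ten v v)) (g := LinearMap.mulRight K (ten v v))
    (fun a b => by simp [ten_mul, v_central]) z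

/-- By `R_mul_comul_drinfeld`, `R Δ(v) τ(R) = v ⊗ v`, and `v ⊗ v` is central. -/
theorem comul_v : comulHom v = Ring.inverse (twist R * R) * ten v v := by
  have hR : IsUnit (twist R) := R_isUnit.map twist
  have h1 : R * comulHom v * twist R = ten v v := by
    rw [v_eq, map_mul, ← mul_assoc, ← twist_comul_mul_R, map_kpow_of_map_H comulHom_H, twist_ten,
      mul_assoc (ten _ _), R_mul_comul_drinfeld, mul_assoc, mul_assoc, twistInv_R_mul_twist_R,
      mul_one, ten_mul]
  have h2 : twist R * R * comulHom v = ten v v := by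
    refine hR.mul_right_cancel ?_
    rw [ten_v_central, ← h1]
    simp only [mul_assoc]
  rw [← h2, ← mul_assoc, Ring.inverse_mul_cancel _ (hR.mul R_isUnit), one_mul]

theorem v_sq : v ^ 2 = antipodeLin drinfeld * drinfeld := by
  have h1 : v * kpow (-2) * (kpow 2 * v) = v * (kpow (-2) * kpow 2) * v := by noncomm_ring
  rw [drinfeld_eq, unopLin_mul, antipode_v, anti_kpow antipodeHom_H, h1, kpow_neg_mul, mul_one,
    pow_two]

theorem v_isRibbon : hopf.IsRibbon R v where
  isUniversalR := R_isUniversalR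
  central := v_central
  sq := v_sq
  antipode_v := antipode_v
  counit_v := counit_v
  comul_v := comul_v

theorem v_eq_ki_sq_mul_u : v = ki ^ 2 * hopf.u R := by
  rw [hopf_u, v_eq, ki_pow]
  norm_num

end Uh

end QuantumSl2

end

open QuantumSl2 Uh in
theorem theoremL :
    (∃! 𝓗 : HopfStructure Uh, IsStandard 𝓗) ∧
    ∀ 𝓗 : HopfStructure Uh, IsStandard 𝓗 → 𝓗.IsRibbon R v ∧ v = ki ^ 2 * 𝓗.u R := by
  refine ⟨⟨hopf, hopf_isStandard, fun 𝓗 h𝓗 => h𝓗.eq_hopf⟩, fun 𝓗 h𝓗 => ?_⟩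
  rw [h𝓗.eq_hopf]
  exact ⟨v_isRibbon, v_eq_ki_sq_mul_u⟩
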